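/- **Setting.** Let $n=n_k\to\infty$ be a sequence of integers (for instance $n_k=k$), and let $q=q_k\ge 2$ be integers and $d=d_k>0$, $\lambda=\lambda_k\in(0,1)$ reals with $d=o(n)$ (for instance constants $d,\lambda$). All asymptotics are as $k\to\infty$. *Stochastic block model* $\mathbb P_{d,\lambda,q,n}$: draw $\sigma\in[q]^n$ uniformly; given $\sigma$, the bits $Y_{ij}$ ($1\le i<j\le n$) are independent Bernoulli variables with parameter $\frac{(1+(q-1)\lambda)d}{n}$ if $\sigma(i)=\sigma(j)$ and $\frac{(1-\lambda)d}{n}$ otherwise. (In the regime below these parameters lie in $[0,1]$ for all large $k$.) The signal is $\Theta_{ij}=\frac{(q\mathbf 1\{\sigma(i)=\sigma(j)\}-1)\lambda d}{n}$, $i<j$. Let $\mathbb Q_{d,n}$ be the law of the Erdős–Rényi graph on $[n]$ with edge probability $d/n$. *Algorithms.* An algorithm is a sequence (in $k$) of Boolean straight-line programs acting on the input bits, each step of which reads an input bit, loads a constant, or computes the NAND of two earlier bits, followed by writing the output bits; the program may depend on $k$, hence on the known parameters. Its running time is the number of steps plus the number of output bits. Tests output one bit; estimators $\mathcal X(Y)\in\mathbb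 R^{\binom n2}$ output integer coordinates in binary (only their direction matters). *Weak recovery*: $\mathbb E\Big[\frac{\langle \mathcal X(Y),\Theta\rangle}{\|\mathcal X(Y)\|\,\|\Theta\|}\Big]\ge c$ for some constant $c>0$ and all large $k$ (the ratio is $0$ if $\mathcal X(Y)=0$). *Weak detection* between $P_k$ and $Q_k$: $Q_k(\mathcal A=1)+P_k(\mathcal A=0)\le 1-\epsilon$ for some constant $\epsilon>0$ and all large $k$. *Low-degree heuristic* for laws $P_k,Q_k$ on $\{0,1\}^{N_k}$: for every sequence $D_k\in\mathbb N$ with $\mathsf{Adv}_{\le D_k}(P_k;Q_k):=\sup_{\deg f\le D_k}\mathbb E_{P_k}[f]/\sqrt{\mathbb E_{Q_k}[f^2]}\to 1$ there is a constant $C>0$ such that no algorithm with running time at most $N_k^{D_k/(C\log N_k)}$ for all large $k$ achieves weak detection between $P_k$ and $Q_k$. *Hidden sample problem* with $M$ samples built from $(\mathbb P,\mathbb Q)$: under the null law, $Y_1,\dots,Y_M$ are i.i.d. from $\mathbb Q$; under the planted law, $Y_a\sim\mathbb P$ for a uniformly random $a\in[M]$, and the other samples are independent draws from $\mathbb Q$.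 **Assumption.** For the given $n,q$, for all $d'=d'_k>0$, $\lambda'=\lambda'_k\in(0,1)$ with $d'=o(n)$ and $d'\lambda'^2<1-\delta'$ for some constant $\delta'>0$ and all large $k$, and all $M=M_k\ge1$, the low-degree heuristic holds for the hidden sample problem with $M$ samples built from $(\mathbb P_{d',\lambda',q,n},\mathbb Q_{d',n})$. **Theorem.** Suppose that $d\lambda^2<1-\delta$ for some constant $\delta>0$ and all large $k$. 1. If $q\le n^{1/8-\varepsilon}$ for some constant $\varepsilon>0$ and all large $k$, then no algorithm whose running time is at most $\exp\!\big(n q^{-6}(\log n)^{-3}\big)$ for all large $k$ achieves weak recovery. 2. In particular, if $q=n^{o(1)}$, then there is a sequence $r_k\to0$, such that no algorithm whose running time is at most $\exp(n^{1-r_k})$ for all large $k$ achieves weak recovery. -/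

import Mathlib

open Filter Topology

/-! ### Algorithms on bit strings, with a step count -/

/-- One step of a Boolean straight-line program with input bits indexed by `ι`: read an input bit,
load a constant, or form the NAND of two bits computed earlier. The result is stored in a fresh
memory cell. -/
inductive BoolInstr (ι : Type) : Type
  | input (e : ι) : BoolInstr ι
  | const (b : Bool) : BoolInstr ι
  | nand (i j : ℕ) : BoolInstr ι

/-- The bit produced by an instruction on input `y` when the memory is `mem`
(cells that have not been written hold `false`). -/
def BoolInstr.value {ι : Type} (y : ι → Bool) (mem : List Bool) : BoolInstr ι → Bool
  | .input e => y e
  | .const b => b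
  | .nand i j => !(mem.getD i false && mem.getD j false)

/-- An algorithm for inputs of a fixed format: a straight-line program, followed by writing, for
each output position `o : κ`, the list of memory cells `out o` as a bit string.
An algorithm for a sequence of problems is a sequence of such programs. -/
structure BoolProgram (ι κ : Type) : Type where
  code : List (BoolInstr ι)
  out : κ → List ℕ

namespace BoolProgram

/-- The memory after executing all instructions on input `y`. -/
def memory {ι κ : Type} (A : BoolProgram ι κ) (y : ι → Bool) : List Bool :=
  A.code.foldl (fun mem s => mem ++ [s.value y mem]) []

/-- The bit string written at output position `o`. -/
def output {ι κ : Type} (A : BoolProgram ι κ) (y : ι → Bool) (o : κ) : List Bool :=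
  (A.out o).map fun i => (A.memory y).getD i false

/-- Running time: the number of executed instructions plus the number of output bits written. -/
def time {ι κ : Type} [Fintype κ] (A : BoolProgram ι κ) : ℕ :=
  A.code.length + ∑ o, (A.out o).length

/-- For a program with one output position, used as a `{0,1}`-valued test: whether it outputs 1. -/
def accepts {ι : Type} (A : BoolProgram ι Unit) (y : ι → Bool) : Bool :=
  decide (A.output y () = [true])

end BoolProgram

/-- The integer encoded by a bit string in sign-magnitude form: the first bit is the sign, the
others are the binary digits of the absolute value, least significant digit first. -/
def decodeInt : List Bool → ℤ
  | [] => 0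
  | s :: bs => (if s then -1 else 1) * (Nat.ofDigits 2 (bs.map Bool.toNat) : ℤ)

/-- The real vector output by a program. (Only the direction of an estimator matters below, so
integer coordinates are as general as rational ones.) -/
def BoolProgram.vector {ι κ : Type} (A : BoolProgram ι κ) (y : ι → Bool) (o : κ) : ℝ :=
  (decodeInt (A.output y o) : ℝ)

/-! ### Probability mass functions on `{0,1}^ι`, low-degree advantage, detection -/

noncomputable section

/-- Expectation of `f` under the mass function `μ` on a finite space. -/
def expect {Ω : Type} [Fintype Ω] (μ f : Ω → ℝ) : ℝ := ∑ y, μ y * f y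

/-- Probability of the event `S` under the mass function `μ`. -/
def prob {Ω : Type} [Fintype Ω] (μ : Ω → ℝ) (S : Ω → Bool) : ℝ :=
  expect μ fun y => if S y then 1 else 0

/-- A bit vector as a point of `ℝ^ι`. -/
def bitVec {ι : Type} (y : ι → Bool) : ι → ℝ := fun e => if y e then 1 else 0

/-- `Adv_{≤ D}(P; Q) = sup_f E_P[f] / √(E_Q[f²])` over real polynomials `f` of degree at most `D`,
as an element of `[0, ∞]`. Since `f = 1` has ratio `1`, replacing negative expectations by `0` does
not change the supremum; here `0 / 0 = 0` and `a / 0 = ∞` for `a > 0`. -/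
def lowDegAdv {ι : Type} [Fintype ι] [DecidableEq ι] (D : ℕ) (P Q : (ι → Bool) → ℝ) : ENNReal :=
  ⨆ f : {f : MvPolynomial ι ℝ // f.totalDegree ≤ D},
    ENNReal.ofReal (expect P fun y => MvPolynomial.eval (bitVec y) f.1) /
      ENNReal.ofReal (√(expect Q fun y => (MvPolynomial.eval (bitVec y) f.1) ^ 2))

/-- Weak detection between `P k` and `Q k`: the sum of the two error probabilities is at most
`1 - ε` for some fixed `ε > 0` and all large `k`. -/
def WeakDetection {ι : ℕ → Type} [∀ k, Fintype (ι k)] [∀ k, DecidableEq (ι k)]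
    (P Q : ∀ k, (ι k → Bool) → ℝ) (A : ∀ k, BoolProgram (ι k) Unit) : Prop :=
  ∃ ε : ℝ, 0 < ε ∧ ∀ᶠ k in atTop,
    prob (Q k) (fun y => (A k).accepts y) + prob (P k) (fun y => !(A k).accepts y) ≤ 1 - ε

/-- The low-degree heuristic for weak detection between `P k` and `Q k`, in dimension
`N k = |ι k|`: whenever `Adv_{≤ D k}(P k; Q k) = 1 + o(1)`, there is a constant `C` such that no
algorithm with running time `N ^ (D / (C log N))` achieves weak detection. -/
def LowDegreeHeuristic {ι : ℕ → Type} [∀ k, Fintype (ι k)] [∀ k, DecidableEq (ι k)]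
    (P Q : ∀ k, (ι k → Bool) → ℝ) : Prop :=
  ∀ D : ℕ → ℕ, Tendsto (fun k => lowDegAdv (D k) (P k) (Q k)) atTop (𝓝 1) →
    ∃ C : ℝ, 0 < C ∧ ¬ ∃ A : ∀ k, BoolProgram (ι k) Unit,
      (∀ᶠ k in atTop, ((A k).time : ℝ) ≤
        (Fintype.card (ι k) : ℝ) ^ ((D k : ℝ) / (C * Real.log (Fintype.card (ι k) : ℝ)))) ∧
      WeakDetection P Q A

/-- Hidden informative sample, null law: `M` independent samples from `Q`. -/
def hiddenNull {ι : Type} (M : ℕ) (Q : (ι → Bool) → ℝ) (y : Fin M × ι → Bool) : ℝ :=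
  ∏ j : Fin M, Q fun e => y (j, e)

/-- Hidden informative sample, planted law: for a uniformly random position `a`, the `a`-th of `M`
independent samples is drawn from `P`, all the others from `Q`. -/
def hiddenPlanted {ι : Type} (M : ℕ) (P Q : (ι → Bool) → ℝ) (y : Fin M × ι → Bool) : ℝ :=
  (M : ℝ)⁻¹ * ∑ a : Fin M, ∏ j : Fin M, (if j = a then P else Q) fun e => y (j, e)

/-! ### The stochastic block model -/

/-- The unordered pairs of distinct vertices of `{0, …, n-1}`, as ordered pairs `i < j`. -/
abbrev Pair (n : ℕ) : Type := {p : Fin n × Fin n // p.1 < p.2}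

/-- Mass function of a Bernoulli variable. The parameter is clipped to `[0, 1]`; in the regime
considered below all edge probabilities lie in `[0, 1]` for large `n`. -/
def bernoulliMass (p : ℝ) (b : Bool) : ℝ :=
  if b then max 0 (min 1 p) else 1 - max 0 (min 1 p)

/-- Edge probability given the labels: `(1 + (q-1)λ) d / n` inside a community and
`(1 - λ) d / n` across communities. -/
def sbmEdgeProb (n q : ℕ) (d lam : ℝ) (σ : Fin n → Fin q) (e : Pair n) : ℝ :=
  if σ e.1.1 = σ e.1.2 then (1 + ((q : ℝ) - 1) * lam) * d / n else (1 - lam) * d / n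

/-- Joint law of the uniformly random labelling `σ` and the observed graph `y`. -/
def sbmJoint (n q : ℕ) (d lam : ℝ) (σ : Fin n → Fin q) (y : Pair n → Bool) : ℝ :=
  ((q : ℝ) ^ n)⁻¹ * ∏ e : Pair n, bernoulliMass (sbmEdgeProb n q d lam σ e) (y e)

/-- Law of the graph in the stochastic block model. -/
def sbmLaw (n q : ℕ) (d lam : ℝ) (y : Pair n → Bool) : ℝ :=
  ∑ σ : Fin n → Fin q, sbmJoint n q d lam σ y

/-- Law of the Erdős–Rényi graph with edge probability `d / n`. -/
def erdosRenyiLaw (n : ℕ) (d : ℝ) (y : Pair n → Bool) : ℝ :=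
  ∏ e : Pair n, bernoulliMass (d / n) (y e)

/-- The signal `Θ_{ij} = (q 1{σ i = σ j} - 1) λ d / n`. -/
def sbmSignal (n q : ℕ) (d lam : ℝ) (σ : Fin n → Fin q) (e : Pair n) : ℝ :=
  ((q : ℝ) * (if σ e.1.1 = σ e.1.2 then 1 else 0) - 1) * lam * d / n

/-- Normalized correlation `⟨x, θ⟩ / (‖x‖ ‖θ‖)`, equal to `0` if `x = 0`. -/
def correlation {κ : Type} [Fintype κ] (x θ : κ → ℝ) : ℝ :=
  (∑ e, x e * θ e) / (√(∑ e, x e ^ 2) * √(∑ e, θ e ^ 2))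

/-- Weak recovery: the expected correlation of the estimator with the signal is at least a fixed
`c > 0` for all large `k`. Here the `k`-th graph has `n k` vertices. -/
def WeakRecovery (n q : ℕ → ℕ) (d lam : ℕ → ℝ)
    (X : ∀ k, BoolProgram (Pair (n k)) (Pair (n k))) : Prop :=
  ∃ c : ℝ, 0 < c ∧ ∀ᶠ k in atTop,
    c ≤ ∑ σ : Fin (n k) → Fin (q k), expect (sbmJoint (n k) (q k) (d k) (lam k) σ)
      fun y => correlation ((X k).vector y) (sbmSignal (n k) (q k) (d k) (lam k) σ)

/-- Sparse parameters below the Kesten–Stigum threshold: `d > 0`, `λ ∈ (0,1)`, `d = o(n)`, and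
`d λ² < 1 - δ` for a constant `δ > 0`. Constant `d`, `λ` with `d λ² < 1` are the main example. -/
structure BelowKestenStigum (n : ℕ → ℕ) (d lam : ℕ → ℝ) : Prop where
  d_pos : ∀ k, 0 < d k
  lam_pos : ∀ k, 0 < lam k
  lam_lt_one : ∀ k, lam k < 1
  sparse : Tendsto (fun k => d k / (n k : ℝ)) atTop (𝓝 0)
  below : ∃ δ : ℝ, 0 < δ ∧ ∀ᶠ k in atTop, d k * lam k ^ 2 < 1 - δ

/-- The standing assumption: the low-degree heuristic holds for the hidden informative sample
problem built from the stochastic block model with `q` communities against the Erdős–Rényi graph of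
the same average degree, for any parameters below the Kesten–Stigum threshold and any number of
samples. -/
def SBMLowDegreeHeuristic (n q : ℕ → ℕ) : Prop :=
  ∀ (d lam : ℕ → ℝ) (M : ℕ → ℕ), BelowKestenStigum n d lam → (∀ k, 1 ≤ M k) →
    LowDegreeHeuristic
      (fun k => hiddenPlanted (M k) (sbmLaw (n k) (q k) (d k) (lam k)) (erdosRenyiLaw (n k) (d k)))
      (fun k => hiddenNull (M k) (erdosRenyiLaw (n k) (d k)))

end

/-! The proof is by contradiction: a fast estimator would give a fast test for a hidden sample
problem, and the low-degree heuristic excludes such a test. Write `E = n / (q⁶ log³ n)`.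

Hardness of detection. Hiding one planted sample among `M` divides the nonconstant part of the
truncated squared likelihood ratio by `M` (`lowDegAdv_hidden_le`). For the block model that part is
at most `exp(O(q² log n))` (`sum_sq_sbm_le`), which `M ≈ exp(E)` dwarfs once `q⁸ log⁴ n` is much
smaller than `n`; this is where `q ≤ n^(1/8 - ε)` enters. To bound it, the squared Fourier
coefficients of degree `k` are compared with the `k`-th moment of the edge overlap of two
independent labellings. Up to a diagonal constant, the overlap is half the squared norm of a sum of
`n` independent centred vectors in `ℝ^(q×q)`. A net of the unit ball reduces its moments to those of
one-dimensional projections with variance at most one per term, and the condition `d λ² < 1` makes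
the powers `k` cancel. The price is the size of the net (`expect_overlap_pow_le`).

From recovery to detection. Choose stronger parameters `(d', λ')`, still below the threshold.
Overwriting bits at random by constants turns the block model at `(d', λ')` into the one at `(d, λ)`
(`exists_stronger_parameters`, `sum_rules_expect`). The estimator is run on the degraded graph.
Where the degraded graph has no edge, the original one has an edge with a probability almost affine
in its prior (`abs_posterior_sub_le`), so a correlated estimate predicts where unseen edges lie. One
signed binary digit of the estimate already does so (`exists_digitSet_large`), and the test counts
original edges on the corresponding set of pairs. False positives have probability `exp(-Ω(n))`,
which survives a union bound over the digits and the `M` samples; the planted sample is missed with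
probability at most `1 - c + o(1)` (`exists_hidden_detector`).

The resulting test runs in time `exp(4E)`, whereas the heuristic at degree `E log n` forbids time
`exp(E log n / C)`. -/

/-! ### Fourier analysis of product Bernoulli measures -/

noncomputable section

/-- The law of independent Bernoulli bits with common parameter `p`. -/
def productBernoulli {ι : Type} [Fintype ι] (p : ℝ) (y : ι → Bool) : ℝ :=
  ∏ e, bernoulliMass p (y e)

/-- A Bernoulli bit, centred and normalized. -/
def bitChar (p : ℝ) (b : Bool) : ℝ := ((if b then 1 else 0) - p) / √(p * (1 - p))

/-- The orthonormal basis function of `productBernoulli p` indexed by `α`. -/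
def fourierChar {ι : Type} (p : ℝ) (α : Finset ι) (y : ι → Bool) : ℝ := ∏ e ∈ α, bitChar p (y e)

end

theorem bernoulliMass_true {p : ℝ} (h0 : 0 ≤ p) (h1 : p ≤ 1) : bernoulliMass p true = p := by
  simp [bernoulliMass, h0, h1]

theorem bernoulliMass_false {p : ℝ} (h0 : 0 ≤ p) (h1 : p ≤ 1) :
    bernoulliMass p false = 1 - p := by
  simp [bernoulliMass, h0, h1]

theorem bernoulliMass_nonneg (p : ℝ) (b : Bool) : 0 ≤ bernoulliMass p b := by
  cases b <;> simp [bernoulliMass]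

theorem sum_bernoulliMass (p : ℝ) : ∑ b, bernoulliMass p b = 1 := by
  simp [bernoulliMass]

theorem sum_bernoulliMass_mul_bitChar (p : ℝ) {r : ℝ} (hr0 : 0 ≤ r)
    (hr1 : r ≤ 1) : ∑ b, bernoulliMass r b * bitChar p b = (r - p) / √(p * (1 - p)) := by
  simp only [Fintype.sum_bool, bernoulliMass_true hr0 hr1, bernoulliMass_false hr0 hr1, bitChar]
  simp only [if_true, Bool.false_eq_true, if_false]
  ring

theorem sum_bernoulliMass_mul_bitChar_sq {p : ℝ} (h0 : 0 < p) (h1 : p < 1) :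
    ∑ b, bernoulliMass p b * (bitChar p b * bitChar p b) = 1 := by
  have hp : 0 < p * (1 - p) := mul_pos h0 (by linarith)
  have hs : √(p * (1 - p)) * √(p * (1 - p)) = p * (1 - p) := Real.mul_self_sqrt hp.le
  simp only [Fintype.sum_bool, bernoulliMass_true h0.le h1.le, bernoulliMass_false h0.le h1.le,
    bitChar, div_mul_div_comm, hs]
  simp only [if_true, Bool.false_eq_true, if_false]
  have h2 : 1 - p ≠ 0 := by linarith
  field_simp
  ring

theorem productBernoulli_nonneg {ι : Type} [Fintype ι] (p : ℝ) (y : ι → Bool) :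
    0 ≤ productBernoulli p y :=
  Finset.prod_nonneg fun _ _ => bernoulliMass_nonneg _ _

theorem fourierChar_eq_prod_univ {ι : Type} [Fintype ι] [DecidableEq ι] (p : ℝ) (α : Finset ι)
    (y : ι → Bool) : fourierChar p α y = ∏ e, if e ∈ α then bitChar p (y e) else 1 := by
  simp [fourierChar, Finset.prod_ite_mem]

theorem expect_prod_fourierChar {ι : Type} [Fintype ι] [DecidableEq ι] (p : ℝ) (m : ι → Bool → ℝ)
    (α : Finset ι) : expect (fun y => ∏ e, m e (y e)) (fourierChar p α) =
      ∏ e, ∑ b, m e b * (if e ∈ α then bitChar p b else 1) := by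
  rw [Fintype.prod_sum]
  refine Finset.sum_congr rfl fun y _ => ?_
  rw [fourierChar_eq_prod_univ, ← Finset.prod_mul_distrib]

theorem expect_fourierChar {ι : Type} [Fintype ι] [DecidableEq ι] {p : ℝ} (h0 : 0 < p)
    (h1 : p < 1) (α : Finset ι) :
    expect (productBernoulli p) (fourierChar p α) = if α = ∅ then 1 else 0 := by
  have := expect_prod_fourierChar p (fun _ : ι => bernoulliMass p) α
  refine this.trans ?_
  split_ifs with h
  · subst h
    simp only [Finset.notMem_empty, if_false, mul_one, sum_bernoulliMass, Finset.prod_const_one]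
  · obtain ⟨e, he⟩ := Finset.nonempty_iff_ne_empty.2 h
    refine Finset.prod_eq_zero (Finset.mem_univ e) ?_
    simp only [he, if_true, sum_bernoulliMass_mul_bitChar p h0.le h1.le, sub_self, zero_div]

theorem expect_fourierChar_mul {ι : Type} [Fintype ι] [DecidableEq ι] {p : ℝ} (h0 : 0 < p)
    (h1 : p < 1) (α β : Finset ι) :
    expect (productBernoulli p) (fun y => fourierChar p α y * fourierChar p β y) =
      if α = β then 1 else 0 := by
  have key : expect (productBernoulli p) (fun y => fourierChar p α y * fourierChar p β y) =
      ∏ e : ι, ∑ b, bernoulliMass p b *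
        ((if e ∈ α then bitChar p b else 1) * (if e ∈ β then bitChar p b else 1)) := by
    rw [Fintype.prod_sum]
    refine Finset.sum_congr rfl fun y _ => ?_
    dsimp only
    rw [fourierChar_eq_prod_univ, fourierChar_eq_prod_univ, productBernoulli,
      ← Finset.prod_mul_distrib, ← Finset.prod_mul_distrib]
  rw [key]
  split_ifs with h
  · subst h
    refine Finset.prod_eq_one fun e _ => ?_
    by_cases he : e ∈ α
    · simp only [he, if_true, sum_bernoulliMass_mul_bitChar_sq h0 h1]
    · simp only [he, if_false, mul_one, sum_bernoulliMass]
  · obtain ⟨e, he⟩ : ∃ e, ¬ (e ∈ α ↔ e ∈ β) := by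
      by_contra hc
      push Not at hc
      exact h (Finset.ext hc)
    refine Finset.prod_eq_zero (Finset.mem_univ e) ?_
    have hz := sum_bernoulliMass_mul_bitChar p h0.le h1.le
    rw [sub_self, zero_div] at hz
    by_cases ha : e ∈ α <;> by_cases hb : e ∈ β
    · exact absurd ⟨fun _ => hb, fun _ => ha⟩ he
    · simpa only [ha, hb, if_true, if_false, mul_one] using hz
    · simpa only [ha, hb, if_true, if_false, one_mul] using hz
    · exact absurd ⟨fun h => absurd h ha, fun h => absurd h hb⟩ he

/-- On bit vectors, a polynomial of degree at most `D` is a combination of basis functions of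
size at most `D`. -/
theorem eval_bitVec_mem_span {ι : Type} [Fintype ι] [DecidableEq ι] {p : ℝ} (h0 : 0 < p)
    (h1 : p < 1) {D : ℕ} {f : MvPolynomial ι ℝ} (hf : f.totalDegree ≤ D) :
    (fun y => MvPolynomial.eval (bitVec y) f) ∈
      Submodule.span ℝ (Set.image (fourierChar p) {α : Finset ι | α.card ≤ D}) := by
  have hmono : ∀ s : Finset ι, s.card ≤ D → (fun y : ι → Bool => ∏ e ∈ s, bitVec y e) ∈
      Submodule.span ℝ (Set.image (fourierChar p) {α : Finset ι | α.card ≤ D}) := by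
    intro s hs
    have hp : 0 < √(p * (1 - p)) := Real.sqrt_pos.2 (mul_pos h0 (by linarith))
    have : (fun y : ι → Bool => ∏ e ∈ s, bitVec y e) =
        ∑ t ∈ s.powerset, (√(p * (1 - p)) ^ t.card * p ^ (s \ t).card) • fourierChar p t := by
      funext y
      rw [Finset.sum_apply]
      -- Expanding a product of these affine functions only produces subsets of `s`, so the degree
      -- does not grow.
      have hb : ∀ e, bitVec y e = √(p * (1 - p)) * bitChar p (y e) + p := by
        intro e
        simp only [bitVec, bitChar]
        field_simp
        ring
      simp only [hb, Finset.prod_add, Finset.prod_mul_distrib, Finset.prod_const, Pi.smul_apply,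
        smul_eq_mul, fourierChar]
      refine Finset.sum_congr rfl fun t _ => ?_
      ring
    rw [this]
    refine Submodule.sum_mem _ fun t ht => Submodule.smul_mem _ _ (Submodule.subset_span ?_)
    exact ⟨t, (Finset.card_le_card (Finset.mem_powerset.1 ht)).trans hs, rfl⟩
  have : (fun y => MvPolynomial.eval (bitVec y) f) =
      ∑ m ∈ f.support, MvPolynomial.coeff m f •
        (fun y : ι → Bool => ∏ e ∈ m.support, bitVec y e) := by
    funext y
    rw [MvPolynomial.eval_eq, Finset.sum_apply]
    refine Finset.sum_congr rfl fun m _ => ?_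
    rw [Pi.smul_apply, smul_eq_mul]
    congr 1
    -- A positive power of a 0/1 value is that value, so only the support of the monomial matters.
    refine Finset.prod_congr rfl fun e he => ?_
    have : m e ≠ 0 := Finsupp.mem_support_iff.1 he
    unfold bitVec
    split_ifs <;> simp [this]
  rw [this]
  refine Submodule.sum_mem _ fun m hm => Submodule.smul_mem _ _ (hmono _ ?_)
  refine le_trans ?_ ((MvPolynomial.le_totalDegree hm).trans hf)
  rw [Finset.card_eq_sum_ones]
  exact Finset.sum_le_sum fun e he => Nat.one_le_iff_ne_zero.2 (Finsupp.mem_support_iff.1 he)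

theorem expect_sum {Ω κ : Type} [Fintype Ω] (μ : Ω → ℝ) (s : Finset κ) (f : κ → Ω → ℝ) :
    expect μ (fun y => ∑ i ∈ s, f i y) = ∑ i ∈ s, expect μ (f i) := by
  simp only [expect, Finset.mul_sum]
  exact Finset.sum_comm

theorem expect_const_mul {Ω : Type} [Fintype Ω] (μ : Ω → ℝ) (c : ℝ) (f : Ω → ℝ) :
    expect μ (fun y => c * f y) = c * expect μ f := by
  simp only [expect, Finset.mul_sum]
  exact Finset.sum_congr rfl fun y _ => by ring

theorem expect_mul_le_sqrt {Ω : Type} [Fintype Ω] {μ : Ω → ℝ} (hμ : ∀ y, 0 ≤ μ y)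
    (f g : Ω → ℝ) : expect μ (fun y => f y * g y) ≤
      √(expect μ fun y => f y ^ 2) * √(expect μ fun y => g y ^ 2) := by
  have := Real.sum_mul_le_sqrt_mul_sqrt Finset.univ (fun y => √(μ y) * f y)
    (fun y => √(μ y) * g y)
  simp only [mul_pow, Real.sq_sqrt (hμ _)] at this
  refine le_trans (le_of_eq ?_) this
  refine Finset.sum_congr rfl fun y _ => ?_
  have := Real.mul_self_sqrt (hμ y)
  linear_combination (-f y * g y) * this

/-- The sum on the right is the projection of the likelihood ratio onto degree at most `D`; pairing
with a low-degree function does not see the rest. Cauchy–Schwarz then bounds the advantage by the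
norm of this projection. -/
theorem expect_eq_expect_truncated {ι : Type} [Fintype ι] [DecidableEq ι] {p : ℝ} (h0 : 0 < p)
    (h1 : p < 1) (P : (ι → Bool) → ℝ) {D : ℕ} {g : (ι → Bool) → ℝ}
    (hg : g ∈ Submodule.span ℝ (Set.image (fourierChar p) {α : Finset ι | α.card ≤ D})) :
    expect P g = expect (productBernoulli p) fun y => g y *
      ∑ α : Finset ι with α.card ≤ D, expect P (fourierChar p α) * fourierChar p α y := by
  induction hg using Submodule.span_induction with
  | mem x hx =>
    obtain ⟨β, hβ, rfl⟩ := hx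
    simp only [Finset.mul_sum, expect_sum]
    rw [Finset.sum_eq_single β]
    · have : ∀ y, fourierChar p β y * (expect P (fourierChar p β) * fourierChar p β y) =
          expect P (fourierChar p β) * (fourierChar p β y * fourierChar p β y) := fun y => by ring
      simp only [this, expect_const_mul, expect_fourierChar_mul h0 h1, if_true, mul_one]
    · intro α _ hα
      have : ∀ y, fourierChar p β y * (expect P (fourierChar p α) * fourierChar p α y) =
          expect P (fourierChar p α) * (fourierChar p β y * fourierChar p α y) := fun y => by ring
      simp only [this, expect_const_mul, expect_fourierChar_mul h0 h1, hα.symm, if_false, mul_zero]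
    · intro h
      exact absurd (Finset.mem_filter.2 ⟨Finset.mem_univ _, hβ⟩) h
  | zero => simp [expect]
  | add x y _ _ hx hy =>
    have e1 : expect P (x + y) = expect P x + expect P y := by
      simp only [expect, Pi.add_apply, mul_add, Finset.sum_add_distrib]
    rw [e1, hx, hy]
    simp only [expect, Pi.add_apply, add_mul, mul_add, Finset.sum_add_distrib]
  | smul c x _ hx =>
    have e1 : expect P (c • x) = c * expect P x := expect_const_mul P c x
    rw [e1, hx, ← expect_const_mul]
    simp only [Pi.smul_apply, smul_eq_mul, mul_assoc]

theorem expect_truncated_sq {ι : Type} [Fintype ι] [DecidableEq ι] {p : ℝ} (h0 : 0 < p)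
    (h1 : p < 1) (s : Finset (Finset ι)) (c : Finset ι → ℝ) :
    expect (productBernoulli p) (fun y => (∑ α ∈ s, c α * fourierChar p α y) ^ 2) =
      ∑ α ∈ s, c α ^ 2 := by
  have : ∀ y, (∑ α ∈ s, c α * fourierChar p α y) ^ 2 =
      ∑ α ∈ s, ∑ β ∈ s, c α * c β * (fourierChar p α y * fourierChar p β y) := by
    intro y
    rw [sq, Finset.sum_mul_sum]
    exact Finset.sum_congr rfl fun α _ => Finset.sum_congr rfl fun β _ => by ring
  simp only [this, expect_sum, expect_const_mul, expect_fourierChar_mul h0 h1, mul_ite, mul_one,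
    mul_zero]
  refine Finset.sum_congr rfl fun α hα => ?_
  rw [Finset.sum_ite_eq, if_pos hα, sq]

/-- The low-degree advantage against a product measure is at most the norm of the truncated
likelihood ratio. -/
theorem lowDegAdv_le_sqrt {ι : Type} [Fintype ι] [DecidableEq ι] {p : ℝ} (h0 : 0 < p)
    (h1 : p < 1) (P : (ι → Bool) → ℝ) (D : ℕ) :
    lowDegAdv D P (productBernoulli p) ≤ ENNReal.ofReal
      (√(∑ α : Finset ι with α.card ≤ D, expect P (fourierChar p α) ^ 2)) := by
  refine iSup_le fun f => ?_
  refine ENNReal.div_le_of_le_mul ?_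
  rw [← ENNReal.ofReal_mul (Real.sqrt_nonneg _)]
  refine ENNReal.ofReal_le_ofReal ?_
  rw [expect_eq_expect_truncated h0 h1 P (eval_bitVec_mem_span h0 h1 f.2),
    ← expect_truncated_sq h0 h1, mul_comm]
  exact expect_mul_le_sqrt (productBernoulli_nonneg p) _ _

theorem expect_productBernoulli_one {ι : Type} [Fintype ι] [DecidableEq ι] (p : ℝ) :
    expect (productBernoulli p) (fun _ : ι → Bool => 1) = 1 := by
  simp only [expect, productBernoulli, mul_one]
  rw [← Fintype.prod_sum (fun (_ : ι) b => bernoulliMass p b)]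
  simp only [sum_bernoulliMass, Finset.prod_const_one]

theorem one_le_lowDegAdv {ι : Type} [Fintype ι] [DecidableEq ι] {P Q : (ι → Bool) → ℝ}
    (hP : expect P (fun _ => 1) = 1) (hQ : expect Q (fun _ => 1) = 1) (D : ℕ) :
    1 ≤ lowDegAdv D P Q := by
  refine le_trans ?_ (le_iSup _ ⟨1, by simp⟩)
  simp [hP, hQ]

/-! ### The hidden informative sample problem -/

/-- Hence `fourierChar` over all `M × ι` bits is an orthonormal basis for the null law. -/
theorem hiddenNull_productBernoulli {ι : Type} [Fintype ι] (M : ℕ) (p : ℝ) :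
    hiddenNull M (productBernoulli (ι := ι) p) = productBernoulli p := by
  funext y
  simp only [hiddenNull, productBernoulli]
  rw [Fintype.prod_prod_type]

/-- Sums over the `M × ι`-indexed bits of functions that factor over the samples. -/
theorem sum_curry_prod {ι : Type} [Fintype ι] [DecidableEq ι] (M : ℕ)
    (g : Fin M → (ι → Bool) → ℝ) :
    ∑ y : Fin M × ι → Bool, ∏ j, g j (fun e => y (j, e)) = ∏ j, ∑ z, g j z := by
  rw [Fintype.prod_sum]
  exact Fintype.sum_equiv (Equiv.curry (Fin M) ι Bool) _ _ fun y => rfl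

theorem fourierChar_prod_samples {ι : Type} [Fintype ι] [DecidableEq ι] {M : ℕ} (p : ℝ)
    (α : Finset (Fin M × ι)) (y : Fin M × ι → Bool) :
    fourierChar p α y =
      ∏ j, fourierChar p (Finset.univ.filter fun e => (j, e) ∈ α) (fun e => y (j, e)) := by
  simp only [fourierChar_eq_prod_univ, Fintype.prod_prod_type, Finset.mem_filter,
    Finset.mem_univ, true_and]

/-- A basis function touching a sample other than the planted one averages to zero there, because
that sample comes from the product measure. -/
theorem expect_hiddenPlanted_fourierChar {ι : Type} [Fintype ι] [DecidableEq ι] {M : ℕ} {p : ℝ}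
    (h0 : 0 < p) (h1 : p < 1) (P : (ι → Bool) → ℝ) (α : Finset (Fin M × ι)) :
    expect (hiddenPlanted M P (productBernoulli p)) (fourierChar p α) =
      (M : ℝ)⁻¹ * ∑ a : Fin M, if ∀ x ∈ α, x.1 = a then
        expect P (fourierChar p (Finset.univ.filter fun e => (a, e) ∈ α)) else 0 := by
  simp only [expect, hiddenPlanted]
  rw [Finset.mul_sum]
  simp only [mul_assoc, Finset.sum_mul, Finset.mul_sum]
  rw [Finset.sum_comm]
  refine Finset.sum_congr rfl fun a _ => ?_
  rw [← Finset.mul_sum]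
  congr 1
  simp only [fourierChar_prod_samples p α, ← Finset.prod_mul_distrib]
  rw [sum_curry_prod M fun j z => (if j = a then P else productBernoulli p) z *
    fourierChar p (Finset.univ.filter fun e => (j, e) ∈ α) z]
  rw [Fintype.prod_eq_mul_prod_compl a]
  have hrest : ∀ j ∈ ({a}ᶜ : Finset (Fin M)), (∑ z, (if j = a then P else productBernoulli p) z *
      fourierChar p (Finset.univ.filter fun e => (j, e) ∈ α) z) =
      if (Finset.univ.filter fun e => (j, e) ∈ α) = ∅ then 1 else 0 := by
    intro j hj
    have hja : j ≠ a := by simpa using hj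
    rw [if_neg hja]
    exact expect_fourierChar h0 h1 _
  rw [Finset.prod_congr rfl hrest, if_pos rfl]
  split_ifs with h
  · rw [Finset.prod_eq_one, mul_one]
    intro j hj
    have hja : j ≠ a := by simpa using hj
    refine if_pos (Finset.filter_eq_empty_iff.2 fun e _ he => hja (h _ he))
  · push Not at h
    obtain ⟨⟨j, e⟩, hx, hja⟩ := h
    rw [Finset.prod_eq_zero (i := j), mul_zero]
    · simpa using hja
    · refine if_neg fun hc => ?_
      exact Finset.filter_eq_empty_iff.1 hc (Finset.mem_univ e) hx

/-- A nonempty index set inside one sample has `M⁻¹` times the coefficient of a single sample; one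
that meets two samples has coefficient zero. Squaring gives `M⁻²`, and summing over the `M` samples
leaves `M⁻¹`. -/
theorem sum_sq_hiddenPlanted_le {ι : Type} [Fintype ι] [DecidableEq ι] {M : ℕ} (hM : 1 ≤ M)
    {p : ℝ} (h0 : 0 < p) (h1 : p < 1) {P : (ι → Bool) → ℝ} (hP : expect P (fun _ => 1) = 1)
    (D : ℕ) :
    ∑ α : Finset (Fin M × ι) with α.card ≤ D,
      expect (hiddenPlanted M P (productBernoulli p)) (fourierChar p α) ^ 2 ≤
      1 + (M : ℝ)⁻¹ * ∑ β : Finset ι with β ≠ ∅ ∧ β.card ≤ D, expect P (fourierChar p β) ^ 2 := by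
  have hM0 : (M : ℝ) ≠ 0 := by positivity
  rw [← Finset.add_sum_erase _ _ (show (∅ : Finset (Fin M × ι)) ∈ _ by simp)]
  have hempty : expect (hiddenPlanted M P (productBernoulli p))
      (fourierChar p (∅ : Finset (Fin M × ι))) ^ 2 = 1 := by
    rw [expect_hiddenPlanted_fourierChar h0 h1]
    have : fourierChar p (∅ : Finset ι) = fun _ => 1 := by funext y; simp [fourierChar]
    simp [this, hP, hM0]
  rw [hempty]
  refine add_le_add le_rfl ?_
  set F : Finset (Fin M × ι) → Fin M → ℝ := fun α a => if ∀ x ∈ α, x.1 = a then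
        expect P (fourierChar p (Finset.univ.filter fun e => (a, e) ∈ α)) else 0 with hF
  have hsq : ∀ α ∈ (Finset.univ.filter fun α : Finset (Fin M × ι) => α.card ≤ D).erase ∅,
      expect (hiddenPlanted M P (productBernoulli p)) (fourierChar p α) ^ 2 =
        (M : ℝ)⁻¹ ^ 2 * ∑ a, F α a ^ 2 := by
    intro α hα
    rw [expect_hiddenPlanted_fourierChar h0 h1, mul_pow]
    congr 1
    obtain ⟨x, hx⟩ := Finset.nonempty_iff_ne_empty.2 (Finset.ne_of_mem_erase hα)
    -- At most one `a` contributes, so the square of the sum is the sum of the squares.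
    have hz : ∀ a, a ≠ x.1 → F α a = 0 := fun a ha => if_neg fun h => ha (h x hx).symm
    rw [Finset.sum_eq_single x.1 (fun a _ ha => hz a ha) (by simp),
      Finset.sum_eq_single x.1 (fun a _ ha => by rw [hz a ha]; simp) (by simp)]
  rw [Finset.sum_congr rfl hsq, ← Finset.mul_sum, Finset.sum_comm]
  have hfib : ∀ a : Fin M, ∑ α ∈ (Finset.univ.filter fun α : Finset (Fin M × ι) =>
      α.card ≤ D).erase ∅, F α a ^ 2 =
      ∑ β : Finset ι with β ≠ ∅ ∧ β.card ≤ D, expect P (fourierChar p β) ^ 2 := by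
    intro a
    have hcard : ∀ α : Finset (Fin M × ι), (∀ x ∈ α, x.1 = a) →
        (Finset.univ.filter fun e => (a, e) ∈ α).map ⟨fun e => (a, e), Prod.mk_right_injective a⟩
          = α := by
      intro α h
      ext ⟨j, e⟩
      simp only [Finset.mem_map, Finset.mem_filter, Finset.mem_univ, true_and,
        Function.Embedding.coeFn_mk, Prod.mk.injEq]
      constructor
      · rintro ⟨e', he', rfl, rfl⟩
        exact he'
      · intro hx
        have := h _ hx
        dsimp at this
        subst this
        exact ⟨e, hx, rfl, rfl⟩
    symm
    refine Finset.sum_of_injOn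
      (fun β : Finset ι => β.map ⟨fun e => (a, e), Prod.mk_right_injective a⟩)
      ?_ ?_ ?_ ?_
    · intro β _ β' _ h
      exact Finset.map_injective _ h
    · intro β hβ
      simp only [Finset.coe_filter, Set.mem_ofPred_eq, Finset.mem_univ, true_and] at hβ
      simp [hβ.1, hβ.2]
    · intro α hα hnot
      simp only [hF]
      rw [if_neg, sq, zero_mul]
      intro h
      refine hnot ⟨Finset.univ.filter fun e => (a, e) ∈ α, ?_, hcard α h⟩
      have h1 := congrArg Finset.card (hcard α h)
      rw [Finset.card_map] at h1
      simp only [Finset.mem_erase, Finset.mem_filter, Finset.mem_univ, true_and] at hα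
      simp only [Finset.coe_filter, Set.mem_ofPred_eq, Finset.mem_univ, true_and, h1]
      refine ⟨fun h2 => hα.1 ?_, hα.2⟩
      rw [← hcard α h, h2, Finset.map_empty]
    · intro β _
      simp only [hF]
      rw [if_pos (by simp)]
      congr 3
      ext e
      simp
  simp only [hfib, Finset.sum_const, Finset.card_univ, Fintype.card_fin, nsmul_eq_mul]
  refine le_of_eq ?_
  field_simp

theorem expect_hiddenPlanted_one {ι : Type} [Fintype ι] [DecidableEq ι] {M : ℕ} (hM : 1 ≤ M)
    {P Q : (ι → Bool) → ℝ} (hP : expect P (fun _ => 1) = 1) (hQ : expect Q (fun _ => 1) = 1) :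
    expect (hiddenPlanted M P Q) (fun _ => 1) = 1 := by
  simp only [expect, mul_one] at hP hQ
  simp only [expect, hiddenPlanted, mul_one, ← Finset.mul_sum]
  rw [Finset.sum_comm]
  have : ∀ a : Fin M, ∑ y : Fin M × ι → Bool,
      ∏ j : Fin M, (if j = a then P else Q) (fun e => y (j, e)) = 1 := by
    intro a
    rw [sum_curry_prod M fun j z => (if j = a then P else Q) z]
    refine Finset.prod_eq_one fun j _ => ?_
    split_ifs <;> assumption
  have hM0 : (M : ℝ) ≠ 0 := by positivity
  simp [this, hM0]

/-- The low-degree advantage of the hidden sample problem is controlled by the number of samples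
and the nonconstant part of the truncated likelihood ratio of one sample. -/
theorem lowDegAdv_hidden_le {ι : Type} [Fintype ι] [DecidableEq ι] {M : ℕ} (hM : 1 ≤ M)
    {p : ℝ} (h0 : 0 < p) (h1 : p < 1) {P : (ι → Bool) → ℝ} (hP : expect P (fun _ => 1) = 1)
    (D : ℕ) : lowDegAdv D (hiddenPlanted M P (productBernoulli p))
      (hiddenNull M (productBernoulli p)) ≤ ENNReal.ofReal
      (√(1 + (M : ℝ)⁻¹ * ∑ β : Finset ι with β ≠ ∅ ∧ β.card ≤ D,
        expect P (fourierChar p β) ^ 2)) := by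
  rw [hiddenNull_productBernoulli]
  refine (lowDegAdv_le_sqrt h0 h1 _ D).trans (ENNReal.ofReal_le_ofReal (Real.sqrt_le_sqrt ?_))
  exact sum_sq_hiddenPlanted_le hM h0 h1 hP D

/-! ### Moment comparison -/

theorem multinomial_indicator {ι : Type} [Fintype ι] [DecidableEq ι] (α : Finset ι) :
    Nat.multinomial Finset.univ (fun e => if e ∈ α then 1 else 0) = α.card.factorial := by
  rw [Nat.multinomial]
  have h1 : ∑ e : ι, (if e ∈ α then 1 else 0) = α.card := by simp
  have h2 : ∏ e : ι, (if e ∈ α then 1 else 0 : ℕ).factorial = 1 :=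
    Finset.prod_eq_one fun e _ => by split_ifs <;> rfl
  rw [h1, h2, Nat.div_one]

/-- If all mixed moments are nonnegative, the multilinear part of a power of a sum has expectation
at most that of the power. -/
theorem factorial_mul_sum_expect_prod_le {ι Ω : Type} [Fintype ι] [DecidableEq ι] [Fintype Ω]
    (μ : Ω → ℝ) (z : ι → Ω → ℝ)
    (hz : ∀ m : ι → ℕ, 0 ≤ expect μ fun ω => ∏ e, z e ω ^ m e) (k : ℕ) :
    (k.factorial : ℝ) * ∑ α : Finset ι with α.card = k, expect μ (fun ω => ∏ e ∈ α, z e ω) ≤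
      expect μ fun ω => (∑ e, z e ω) ^ k := by
  simp only [Finset.sum_pow_eq_sum_piAntidiag, expect_sum, expect_const_mul]
  rw [Finset.mul_sum]
  have hinj : Set.InjOn (fun (α : Finset ι) (e : ι) => if e ∈ α then 1 else 0)
      ((Finset.univ.filter fun α : Finset ι => α.card = k : Finset (Finset ι)) :
        Set (Finset ι)) := by
    intro α _ β _ h
    ext e
    have := congrFun h e
    dsimp only at this
    by_cases ha : e ∈ α <;> by_cases hb : e ∈ β <;> simp_all
  calc _ = ∑ m ∈ (Finset.univ.filter fun α : Finset ι => α.card = k).image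
        (fun (α : Finset ι) (e : ι) => if e ∈ α then 1 else 0),
        (Nat.multinomial Finset.univ m : ℝ) * expect μ fun ω => ∏ e, z e ω ^ m e := by
        rw [Finset.sum_image hinj]
        refine Finset.sum_congr rfl fun α hα => ?_
        rw [multinomial_indicator, (Finset.mem_filter.1 hα).2]
        congr 2
        funext ω
        rw [← Finset.prod_filter_mul_prod_filter_not Finset.univ (fun e => e ∈ α)]
        rw [Finset.prod_congr rfl (g := fun e => z e ω), Finset.prod_eq_one (s := Finset.filter
          (fun e => ¬ e ∈ α) Finset.univ), mul_one]
        · simp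
        · intro e he
          simp [(Finset.mem_filter.1 he).2]
        · intro e _
          simp
    _ ≤ _ := by
        refine Finset.sum_le_sum_of_subset_of_nonneg ?_ fun m _ _ =>
          mul_nonneg (Nat.cast_nonneg _) (hz m)
        intro m hm
        obtain ⟨α, hα, rfl⟩ := Finset.mem_image.1 hm
        rw [Finset.mem_piAntidiag]
        refine ⟨?_, fun e _ => Finset.mem_univ e⟩
        simpa using (Finset.mem_filter.1 hα).2

theorem expect_pow_nonneg {ι Ω : Type} [Fintype ι] [DecidableEq ι] [Fintype Ω]
    (μ : Ω → ℝ) (z : ι → Ω → ℝ)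
    (hz : ∀ m : ι → ℕ, 0 ≤ expect μ fun ω => ∏ e, z e ω ^ m e) (k : ℕ) :
    0 ≤ expect μ fun ω => (∑ e, z e ω) ^ k := by
  simp only [Finset.sum_pow_eq_sum_piAntidiag, expect_sum, expect_const_mul]
  exact Finset.sum_nonneg fun m _ => mul_nonneg (Nat.cast_nonneg _) (hz m)

/-- Every term of the binomial expansion has nonnegative mean, and the top one is the left side. It
serves to complete a sum over edges by its diagonal. -/
theorem expect_pow_le_expect_add_pow {Ω : Type} [Fintype Ω] (μ W : Ω → ℝ)
    (hW : ∀ k : ℕ, 0 ≤ expect μ fun ω => W ω ^ k) {c : ℝ} (hc : 0 ≤ c) (k : ℕ) :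
    expect μ (fun ω => W ω ^ k) ≤ expect μ fun ω => (W ω + c) ^ k := by
  have : ∀ ω, (W ω + c) ^ k =
      ∑ m ∈ Finset.range (k + 1), (c ^ (k - m) * (k.choose m : ℝ)) * W ω ^ m := by
    intro ω
    rw [add_pow]
    exact Finset.sum_congr rfl fun m _ => by ring
  simp only [this, expect_sum, expect_const_mul]
  refine le_trans (le_of_eq ?_) (Finset.single_le_sum
    (f := fun m => (c ^ (k - m) * (k.choose m : ℝ)) * expect μ fun ω => W ω ^ m)
    (fun m _ => mul_nonneg (by positivity) (hW m)) (Finset.self_mem_range_succ k))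
  simp

/-! ### A grid net of the unit ball -/

noncomputable section

/-- The points of the grid of mesh `1 / R` in the cube `[-1, 1]^ι`. -/
def gridPoint {ι : Type} (R : ℕ) (j : ι → Bool × Fin (R + 1)) (i : ι) : ℝ :=
  (if (j i).1 then 1 else -1) * (((j i).2 : ℕ) : ℝ) / R

end

/-- Divide `S` by its norm and round each coordinate toward zero. This direction of rounding keeps
the point in the unit ball, and it costs at most `∑ |S i| / R`, which Cauchy–Schwarz and `hcard`
bound by `η` times the norm. -/
theorem exists_gridPoint {ι : Type} [Fintype ι] {R : ℕ} {η : ℝ} (hR : 0 < R) (hη : 0 ≤ η)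
    (hcard : (Fintype.card ι : ℝ) ≤ (η * R) ^ 2) (S : ι → ℝ) :
    ∃ j : ι → Bool × Fin (R + 1), ∑ i, gridPoint R j i ^ 2 ≤ 1 ∧
      (1 - η) * √(∑ i, S i ^ 2) ≤ ∑ i, gridPoint R j i * S i := by
  have hR' : (0 : ℝ) < R := by exact_mod_cast hR
  set N := √(∑ i, S i ^ 2) with hN
  have hN0 : 0 ≤ N := Real.sqrt_nonneg _
  have hNsq : N ^ 2 = ∑ i, S i ^ 2 := Real.sq_sqrt (Finset.sum_nonneg fun i _ => sq_nonneg _)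
  have hSN : ∀ i, |S i| ≤ N := fun i => by
    rw [← Real.sqrt_sq_eq_abs]
    exact Real.sqrt_le_sqrt (Finset.single_le_sum (f := fun i => S i ^ 2)
      (fun i _ => sq_nonneg _) (Finset.mem_univ i))
  rcases hN0.eq_or_lt with h0 | hpos
  · refine ⟨fun _ => (true, 0), by simp [gridPoint], ?_⟩
    rw [← h0]
    simp [gridPoint]
  have hle : ∀ i, R * |S i| / N ≤ R := fun i => by
    rw [div_le_iff₀ hpos]
    exact mul_le_mul_of_nonneg_left (hSN i) hR'.le
  have hlt : ∀ i, ⌊R * |S i| / N⌋₊ < R + 1 := fun i =>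
    Nat.lt_succ_of_le (by exact_mod_cast (Nat.floor_le (by positivity)).trans (hle i))
  set j : ι → Bool × Fin (R + 1) := fun i => (decide (0 ≤ S i), ⟨⌊R * |S i| / N⌋₊, hlt i⟩) with hj
  have hv : ∀ i, gridPoint R j i = (if 0 ≤ S i then 1 else -1) * (⌊R * |S i| / N⌋₊ : ℝ) / R := by
    intro i
    simp [gridPoint, hj]
  have hsign : ∀ i, (if 0 ≤ S i then (1 : ℝ) else -1) * S i = |S i| := fun i => by
    split_ifs with h
    · rw [abs_of_nonneg h, one_mul]
    · rw [abs_of_neg (not_le.1 h)]; ring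
  have hsign2 : ∀ i, (if 0 ≤ S i then (1 : ℝ) else -1) ^ 2 = 1 := fun i => by
    split_ifs <;> norm_num
  refine ⟨j, ?_, ?_⟩
  · have : ∀ i, gridPoint R j i ^ 2 ≤ S i ^ 2 / N ^ 2 := by
      intro i
      rw [hv, div_pow, mul_pow, hsign2, one_mul, div_le_div_iff₀ (by positivity) (by positivity)]
      have h1 : (⌊R * |S i| / N⌋₊ : ℝ) ≤ R * |S i| / N := Nat.floor_le (by positivity)
      rw [le_div_iff₀ hpos] at h1
      have h2 := pow_le_pow_left₀ (by positivity) h1 2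
      rw [mul_pow, mul_pow, sq_abs] at h2
      linarith
    refine (Finset.sum_le_sum fun i _ => this i).trans ?_
    rw [← Finset.sum_div, ← hNsq, div_self (by positivity)]
  · have : ∀ i, S i ^ 2 / N - |S i| / R ≤ gridPoint R j i * S i := by
      intro i
      have h1 : R * |S i| / N - 1 ≤ (⌊R * |S i| / N⌋₊ : ℝ) := (Nat.sub_one_lt_floor _).le
      have e1 : gridPoint R j i * S i = |S i| / R * (⌊R * |S i| / N⌋₊ : ℝ) := by
        rw [hv, ← hsign i]
        ring
      rw [e1]
      refine le_trans (le_of_eq ?_) (mul_le_mul_of_nonneg_left h1 (by positivity))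
      rw [← sq_abs (S i)]
      field_simp
    refine le_trans ?_ (Finset.sum_le_sum fun i _ => this i)
    rw [Finset.sum_sub_distrib, ← Finset.sum_div, ← Finset.sum_div, ← hNsq]
    have hcs : ∑ i, |S i| ≤ η * R * N := by
      have h1 := Real.sum_mul_le_sqrt_mul_sqrt Finset.univ (fun _ : ι => (1 : ℝ)) (fun i => |S i|)
      simp only [one_mul, one_pow, Finset.sum_const, Finset.card_univ, nsmul_eq_mul, mul_one,
        sq_abs, ← hN] at h1
      refine h1.trans (mul_le_mul_of_nonneg_right ?_ hN0)
      exact Real.sqrt_le_iff.2 ⟨by positivity, hcard⟩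
    have h2 : (∑ i, |S i|) / R ≤ η * N := by
      rw [div_le_iff₀ hR']
      linarith
    have h3 : N ^ 2 / N = N := by field_simp
    rw [h3]
    linarith

/-- The maximum over the net is replaced by the sum, which commutes with expectations; even powers
make all terms nonnegative. -/
theorem sum_sq_pow_le_sum_grid {ι : Type} [Fintype ι] [DecidableEq ι] {R : ℕ} {η : ℝ} (hR : 0 < R)
    (hη : 0 ≤ η) (hη1 : η ≤ 1) (hcard : (Fintype.card ι : ℝ) ≤ (η * R) ^ 2) (S : ι → ℝ) (k : ℕ) :
    (1 - η) ^ (2 * k) * (∑ i, S i ^ 2) ^ k ≤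
      ∑ j : ι → Bool × Fin (R + 1) with ∑ i, gridPoint R j i ^ 2 ≤ 1,
        (∑ i, gridPoint R j i * S i) ^ (2 * k) := by
  obtain ⟨j, hj1, hj2⟩ := exists_gridPoint hR hη hcard S
  refine le_trans ?_ (Finset.single_le_sum
    (f := fun j : ι → Bool × Fin (R + 1) => (∑ i, gridPoint R j i * S i) ^ (2 * k))
    (fun j _ => by rw [pow_mul]; positivity) (Finset.mem_filter.2 ⟨Finset.mem_univ j, hj1⟩))
  refine le_trans (le_of_eq ?_) (pow_le_pow_left₀
    (mul_nonneg (by linarith) (Real.sqrt_nonneg _)) hj2 (2 * k))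
  rw [mul_pow, pow_mul (√_), Real.sq_sqrt (Finset.sum_nonneg fun i _ => sq_nonneg _)]

/-! ### Elementary estimates -/

/-- The quadratic coefficient stays within a factor `1 + η` of `1/2`. A worse constant would miss
the exact threshold `d λ² = 1`. -/
theorem exp_le_quadratic {x η : ℝ} (hη : η ≤ 1) (hx : |x| ≤ η) :
    Real.exp x ≤ 1 + x + x ^ 2 * ((1 + η) / 2) := by
  have h := Real.exp_bound (x := x) (hx.trans hη) (n := 3) (by norm_num)
  have h2 := (abs_le.1 h).2
  simp only [Finset.sum_range_succ, Finset.sum_range_zero, Nat.factorial] at h2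
  norm_num at h2
  have h3 : |x| ^ 3 ≤ x ^ 2 * η := by
    have : |x| ^ 3 = x ^ 2 * |x| := by rw [← sq_abs x]; ring
    rw [this]
    exact mul_le_mul_of_nonneg_left hx (sq_nonneg x)
  have h4 : 0 ≤ |x| ^ 3 := by positivity
  nlinarith

/-- Stirling's bound up to a factor linear in `k`, which is harmless here. The induction rests on `e
≤ ((k + 1) / k) ^ (k + 1)`. -/
theorem factorial_le_mul_div_exp_pow (k : ℕ) (hk : 1 ≤ k) :
    (k.factorial : ℝ) ≤ Real.exp 1 * k * (k / Real.exp 1) ^ k := by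
  induction k, hk using Nat.le_induction with
  | base => simp
  | succ k hk ih =>
    have hk0 : (0 : ℝ) < k := by exact_mod_cast hk
    have he : Real.exp 1 ≠ 0 := (Real.exp_pos 1).ne'
    have h1 : Real.exp 1 ≤ ((k + 1 : ℝ) / k) ^ (k + 1) := by
      have h2 : Real.exp (-(1 / (k + 1 : ℝ))) ≥ 1 - 1 / (k + 1 : ℝ) := by
        have := Real.add_one_le_exp (-(1 / (k + 1 : ℝ)))
        linarith
      have h3 : (1 : ℝ) - 1 / (k + 1) = k / (k + 1) := by field_simp; ring
      rw [h3] at h2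
      have h4 := pow_le_pow_left₀ (by positivity) h2 (k + 1)
      rw [← Real.exp_nat_mul] at h4
      have h5 : ((k + 1 : ℕ) : ℝ) * -(1 / (k + 1 : ℝ)) = -1 := by push_cast; field_simp
      rw [h5, Real.exp_neg] at h4
      have h6 := (le_inv_comm₀ (by positivity) (Real.exp_pos 1)).1 h4
      rwa [← inv_pow, inv_div] at h6
    rw [Nat.factorial_succ]
    push_cast
    calc ((k : ℝ) + 1) * (k.factorial : ℝ)
        ≤ (k + 1) * (Real.exp 1 * k * (k / Real.exp 1) ^ k) := by gcongr
      _ = Real.exp 1 * (k + 1) * (k ^ (k + 1) / Real.exp 1 ^ (k + 1)) * Real.exp 1 := by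
          rw [div_pow]; field_simp; ring
      _ ≤ Real.exp 1 * (k + 1) * (k ^ (k + 1) / Real.exp 1 ^ (k + 1)) *
          ((k + 1 : ℝ) / k) ^ (k + 1) := by gcongr
      _ = Real.exp 1 * (k + 1) * ((k + 1) / Real.exp 1) ^ (k + 1) := by
          rw [div_pow, div_pow]; field_simp

theorem pow_even_le_exp_add_exp (x : ℝ) (k : ℕ) :
    x ^ (2 * k) ≤ ((2 * k).factorial : ℝ) * (Real.exp x + Real.exp (-x)) := by
  have h1 := Real.pow_div_factorial_le_exp |x| (abs_nonneg x) (2 * k)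
  rw [div_le_iff₀ (by positivity), pow_mul, sq_abs, ← pow_mul] at h1
  rw [mul_comm _ (Real.exp x + _)]
  refine h1.trans (mul_le_mul_of_nonneg_right ?_ (by positivity))
  rcases abs_cases x with ⟨h, _⟩ | ⟨h, _⟩ <;> rw [h]
  · linarith [Real.exp_pos (-x)]
  · linarith [Real.exp_pos x]

/-! ### The community kernel and its overlap statistic -/

noncomputable section

/-- The kernel `q 1{x = y} - 1`. -/
def communityKernel (q : ℕ) (x y : Fin q) : ℝ := (q : ℝ) * (if x = y then 1 else 0) - 1

/-- The vector `e_x - 1/q`. -/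
def centredIndicator (q : ℕ) (x a : Fin q) : ℝ := (if x = a then 1 else 0) - (q : ℝ)⁻¹

/-- The double centring of the matrix `v`, multiplied by `q`. -/
def centredForm (q : ℕ) (v : Fin q × Fin q → ℝ) (x y : Fin q) : ℝ :=
  q * ∑ a : Fin q × Fin q, v a * (centredIndicator q x a.1 * centredIndicator q y a.2)

/-- The uniform law on pairs of labellings. -/
def uniformPair (n q : ℕ) (_ : (Fin n → Fin q) × (Fin n → Fin q)) : ℝ := ((q : ℝ) ^ n)⁻¹ ^ 2

end

theorem sum_centredIndicator_mul {q : ℕ} (x : Fin q) (f : Fin q → ℝ) :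
    ∑ a, f a * centredIndicator q x a = f x - (q : ℝ)⁻¹ * ∑ a, f a := by
  simp only [centredIndicator, mul_sub, Finset.sum_sub_distrib, mul_ite, mul_one, mul_zero,
    Finset.sum_ite_eq, Finset.mem_univ, if_true, ← Finset.sum_mul]
  ring

theorem sum_centredIndicator {q : ℕ} (hq : q ≠ 0) (a : Fin q) :
    ∑ x, centredIndicator q x a = 0 := by
  simp [centredIndicator, hq]

/-- The kernel is a Gram matrix. This makes it positive semidefinite and turns the overlap of two
labellings into a sum of squares. -/
theorem sum_centredIndicator_sq {q : ℕ} (hq : q ≠ 0) (x y : Fin q) :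
    q * ∑ a, centredIndicator q x a * centredIndicator q y a = communityKernel q x y := by
  have hq' : (q : ℝ) ≠ 0 := by exact_mod_cast hq
  rw [sum_centredIndicator_mul]
  have : ∑ a, centredIndicator q x a = 0 := by simp [centredIndicator, hq]
  rw [this, communityKernel, centredIndicator]
  field_simp
  ring

/-- Centring is a contraction. -/
theorem sum_sq_centred_le {q : ℕ} (hq : q ≠ 0) (f : Fin q → ℝ) :
    ∑ x, (∑ a, f a * centredIndicator q x a) ^ 2 ≤ ∑ a, f a ^ 2 := by
  have hq' : (0 : ℝ) < q := by exact_mod_cast Nat.pos_of_ne_zero hq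
  simp only [sum_centredIndicator_mul]
  set s := ∑ a, f a
  have : ∑ x, (f x - (q : ℝ)⁻¹ * s) ^ 2 = ∑ x, f x ^ 2 - (q : ℝ)⁻¹ * s ^ 2 := by
    simp only [sub_sq, Finset.sum_add_distrib, Finset.sum_sub_distrib, Finset.sum_const,
      Finset.card_univ, Fintype.card_fin, nsmul_eq_mul, ← Finset.sum_mul, ← Finset.mul_sum]
    change _ - 2 * s * _ + _ = _
    field_simp
    ring
  rw [this]
  have : 0 ≤ (q : ℝ)⁻¹ * s ^ 2 := by positivity
  linarith

theorem centredForm_eq {q : ℕ} (v : Fin q × Fin q → ℝ) (x y : Fin q) :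
    centredForm q v x y =
      q * ∑ b, (∑ a, v (a, b) * centredIndicator q x a) * centredIndicator q y b := by
  rw [centredForm, Fintype.sum_prod_type_right]
  simp only [Finset.sum_mul, mul_assoc]

/-- Centring is a contraction in each of the two variables. Divided by `q²`, the left side is the
variance of `centredForm` at a uniform pair of labels, so a unit vector `v` gives variance at most
one. -/
theorem sum_sq_centredForm_le {q : ℕ} (hq : q ≠ 0) (v : Fin q × Fin q → ℝ) :
    ∑ x, ∑ y, centredForm q v x y ^ 2 ≤ (q : ℝ) ^ 2 * ∑ a, v a ^ 2 := by
  simp only [centredForm_eq, mul_pow, ← Finset.mul_sum]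
  refine mul_le_mul_of_nonneg_left ?_ (by positivity)
  refine (Finset.sum_le_sum fun x _ => sum_sq_centred_le hq _).trans ?_
  rw [Finset.sum_comm, Fintype.sum_prod_type_right]
  exact Finset.sum_le_sum fun b _ => sum_sq_centred_le hq _

theorem sum_centredForm {q : ℕ} (hq : q ≠ 0) (v : Fin q × Fin q → ℝ) :
    ∑ x, ∑ y, centredForm q v x y = 0 := by
  refine Finset.sum_eq_zero fun x _ => ?_
  simp only [centredForm_eq, ← Finset.mul_sum]
  rw [Finset.sum_comm]
  simp only [← Finset.mul_sum, sum_centredIndicator hq, mul_zero, Finset.sum_const_zero]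

theorem abs_centredForm_le {q : ℕ} (hq : q ≠ 0) {v : Fin q × Fin q → ℝ} (hv : ∑ a, v a ^ 2 ≤ 1)
    (x y : Fin q) : |centredForm q v x y| ≤ q := by
  refine abs_le_of_sq_le_sq ?_ (Nat.cast_nonneg q)
  have h1 : centredForm q v x y ^ 2 ≤ ∑ x, ∑ y, centredForm q v x y ^ 2 :=
    (Finset.single_le_sum (f := fun y => centredForm q v x y ^ 2) (fun _ _ => sq_nonneg _)
      (Finset.mem_univ y)).trans (Finset.single_le_sum
        (f := fun x => ∑ y, centredForm q v x y ^ 2)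
        (fun _ _ => Finset.sum_nonneg fun _ _ => sq_nonneg _) (Finset.mem_univ x))
  have h2 := sum_sq_centredForm_le hq v
  have h3 : (q : ℝ) ^ 2 * ∑ a, v a ^ 2 ≤ (q : ℝ) ^ 2 * 1 :=
    mul_le_mul_of_nonneg_left hv (by positivity)
  linarith

/-- In the quadratic bound for the exponential, mean zero removes the linear term and variance at
most one leaves `t² (1 + η) / 2`. Entries can be as large as `q`, which is why `|t| q ≤ η` is
required. -/
theorem sum_exp_centredForm_le {q : ℕ} (hq : q ≠ 0) {v : Fin q × Fin q → ℝ}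
    (hv : ∑ a, v a ^ 2 ≤ 1) {t η : ℝ} (hη : η ≤ 1) (ht : |t| * q ≤ η) :
    ∑ a : Fin q × Fin q, Real.exp (t * centredForm q v a.1 a.2) ≤
      (q : ℝ) ^ 2 * Real.exp (t ^ 2 * ((1 + η) / 2)) := by
  have hη0 : 0 ≤ η := le_trans (by positivity) ht
  have h1 : ∀ a : Fin q × Fin q, Real.exp (t * centredForm q v a.1 a.2) ≤
      1 + t * centredForm q v a.1 a.2 + t ^ 2 * ((1 + η) / 2) * centredForm q v a.1 a.2 ^ 2 := by
    intro a
    refine (exp_le_quadratic hη ?_).trans (le_of_eq (by ring))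
    rw [abs_mul]
    exact (mul_le_mul_of_nonneg_left (abs_centredForm_le hq hv _ _) (abs_nonneg t)).trans ht
  refine (Finset.sum_le_sum fun a _ => h1 a).trans ?_
  rw [Finset.sum_add_distrib, Finset.sum_add_distrib, ← Finset.mul_sum, ← Finset.mul_sum,
    Fintype.sum_prod_type, Fintype.sum_prod_type, Fintype.sum_prod_type, sum_centredForm hq]
  have h2 := (sum_sq_centredForm_le hq v).trans
    (mul_le_mul_of_nonneg_left hv (by positivity : (0 : ℝ) ≤ (q : ℝ) ^ 2))
  have h3 : 0 ≤ t ^ 2 * ((1 + η) / 2) := by positivity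
  have h4 := mul_le_mul_of_nonneg_left h2 h3
  have h5 := mul_le_mul_of_nonneg_left (Real.add_one_le_exp (t ^ 2 * ((1 + η) / 2)))
    (by positivity : (0 : ℝ) ≤ (q : ℝ) ^ 2)
  simp only [Finset.sum_const, Finset.card_univ, Fintype.card_fin, nsmul_eq_mul, mul_one, mul_zero]
  nlinarith

theorem uniformPair_nonneg {n q : ℕ} (s : (Fin n → Fin q) × (Fin n → Fin q)) :
    0 ≤ uniformPair n q s := by unfold uniformPair; positivity

/-- The `n` pairs of labels are independent and uniform on `[q]²`, so the moment generating function
factors. -/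
theorem expect_uniformPair_exp_le {n q : ℕ} (hq : q ≠ 0) {v : Fin q × Fin q → ℝ}
    (hv : ∑ a, v a ^ 2 ≤ 1) {t η : ℝ} (hη : η ≤ 1) (ht : |t| * q ≤ η) :
    expect (uniformPair n q)
      (fun s => Real.exp (t * ∑ i, centredForm q v (s.1 i) (s.2 i))) ≤
      Real.exp (n * (t ^ 2 * ((1 + η) / 2))) := by
  have hq' : (0 : ℝ) < q := by exact_mod_cast Nat.pos_of_ne_zero hq
  simp only [expect, uniformPair, ← Finset.mul_sum]
  have h1 : ∑ s : (Fin n → Fin q) × (Fin n → Fin q),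
      Real.exp (t * ∑ i, centredForm q v (s.1 i) (s.2 i)) =
      (∑ a : Fin q × Fin q, Real.exp (t * centredForm q v a.1 a.2)) ^ n := by
    have := Fintype.prod_sum (fun (_ : Fin n) (a : Fin q × Fin q) =>
      Real.exp (t * centredForm q v a.1 a.2))
    rw [Finset.prod_const, Finset.card_univ, Fintype.card_fin] at this
    rw [this]
    refine Fintype.sum_equiv (Equiv.arrowProdEquivProdArrow (Fin n) (fun _ => Fin q)
      (fun _ => Fin q)).symm _ _ fun s => ?_
    rw [Finset.mul_sum, Real.exp_sum]
    rfl
  rw [h1]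
  have h2 := pow_le_pow_left₀ (Finset.sum_nonneg fun a _ => (Real.exp_pos _).le)
    (sum_exp_centredForm_le hq hv hη ht) n
  rw [mul_pow, ← Real.exp_nat_mul] at h2
  rw [inv_pow, inv_mul_le_iff₀ (by positivity)]
  refine h2.trans (le_of_eq ?_)
  ring

/-- Moments of a one-dimensional projection of the overlap. -/
theorem expect_uniformPair_pow_le {n q k : ℕ} (hn : n ≠ 0) (hk : 1 ≤ k) (hq : q ≠ 0)
    {v : Fin q × Fin q → ℝ} (hv : ∑ a, v a ^ 2 ≤ 1) {η : ℝ} (hη0 : 0 ≤ η) (hη : η ≤ 1)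
    (ht : 2 * k * (q : ℝ) ^ 2 ≤ η ^ 2 * n) :
    expect (uniformPair n q) (fun s => (∑ i, centredForm q v (s.1 i) (s.2 i)) ^ (2 * k)) ≤
      2 * ((2 * k).factorial : ℝ) * (n / (2 * k)) ^ k * Real.exp (k * (1 + η)) := by
  have hn' : (0 : ℝ) < n := by exact_mod_cast Nat.pos_of_ne_zero hn
  have hk' : (0 : ℝ) < k := by exact_mod_cast hk
  -- Minimizes `t^(-2k) exp(n t² / 2)`; the hypothesis `ht` is what keeps `t q ≤ η`.
  set t : ℝ := √(2 * k / n) with htd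
  have ht0 : 0 < t := Real.sqrt_pos.2 (by positivity)
  have ht2 : t ^ 2 = 2 * k / n := Real.sq_sqrt (by positivity)
  have htq : t * q ≤ η := by
    refine le_of_sq_le_sq ?_ hη0
    rw [mul_pow, ht2, div_mul_eq_mul_div, div_le_iff₀ hn']
    exact ht
  have hpt : ∀ s : (Fin n → Fin q) × (Fin n → Fin q),
      (∑ i, centredForm q v (s.1 i) (s.2 i)) ^ (2 * k) ≤
      ((2 * k).factorial : ℝ) * (n / (2 * k)) ^ k *
        (Real.exp (t * ∑ i, centredForm q v (s.1 i) (s.2 i)) +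
          Real.exp (-t * ∑ i, centredForm q v (s.1 i) (s.2 i))) := by
    intro s
    have h := pow_even_le_exp_add_exp (t * ∑ i, centredForm q v (s.1 i) (s.2 i)) k
    rw [mul_pow, pow_mul, ht2, ← neg_mul] at h
    have h3 : (2 * (k : ℝ) / n) ^ k * (n / (2 * k)) ^ k = 1 := by
      rw [← mul_pow]
      have : 2 * (k : ℝ) / n * (n / (2 * k)) = 1 := by field_simp
      rw [this, one_pow]
    have h4 := mul_le_mul_of_nonneg_right h (by positivity : (0 : ℝ) ≤ ((n : ℝ) / (2 * k)) ^ k)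
    rw [mul_right_comm, h3, one_mul] at h4
    exact h4.trans (le_of_eq (by ring))
  calc _ ≤ expect (uniformPair n q) (fun s => ((2 * k).factorial : ℝ) * (n / (2 * k)) ^ k *
        (Real.exp (t * ∑ i, centredForm q v (s.1 i) (s.2 i)) +
          Real.exp (-t * ∑ i, centredForm q v (s.1 i) (s.2 i)))) :=
        Finset.sum_le_sum fun s _ => mul_le_mul_of_nonneg_left (hpt s) (uniformPair_nonneg s)
    _ = ((2 * k).factorial : ℝ) * (n / (2 * k)) ^ k *
        (expect (uniformPair n q) (fun s => Real.exp (t * ∑ i, centredForm q v (s.1 i) (s.2 i))) +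
        expect (uniformPair n q) (fun s =>
          Real.exp (-t * ∑ i, centredForm q v (s.1 i) (s.2 i)))) := by
        rw [expect_const_mul]
        simp only [expect, mul_add, Finset.sum_add_distrib]
    _ ≤ ((2 * k).factorial : ℝ) * (n / (2 * k)) ^ k *
        (Real.exp (k * (1 + η)) + Real.exp (k * (1 + η))) := by
        have e : (n : ℝ) * (t ^ 2 * ((1 + η) / 2)) = k * (1 + η) := by
          rw [ht2]; field_simp
        have h1 := expect_uniformPair_exp_le (n := n) hq hv hη (t := t)
          (by rwa [abs_of_pos ht0])
        have h2 := expect_uniformPair_exp_le (n := n) hq hv hη (t := -t)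
          (by rwa [abs_neg, abs_of_pos ht0])
        rw [neg_sq, e] at h2
        rw [e] at h1
        gcongr
    _ = _ := by ring

/-- The sum of the product kernel over all ordered pairs is a sum of squares. -/
theorem sum_communityKernel_mul_eq {n q : ℕ} (hq : q ≠ 0) (σ τ : Fin n → Fin q) :
    ∑ i, ∑ j, communityKernel q (σ i) (σ j) * communityKernel q (τ i) (τ j) =
      ∑ a : Fin q × Fin q,
        (∑ i, q * (centredIndicator q (σ i) a.1 * centredIndicator q (τ i) a.2)) ^ 2 := by
  have h1 : ∀ a : Fin q × Fin q,
      (∑ i, q * (centredIndicator q (σ i) a.1 * centredIndicator q (τ i) a.2)) ^ 2 =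
      ∑ i, ∑ j, (q * (centredIndicator q (σ i) a.1 * centredIndicator q (σ j) a.1)) *
        (q * (centredIndicator q (τ i) a.2 * centredIndicator q (τ j) a.2)) := by
    intro a
    rw [sq, Finset.sum_mul_sum]
    exact Finset.sum_congr rfl fun i _ => Finset.sum_congr rfl fun j _ => by ring
  simp only [h1]
  symm
  rw [Finset.sum_comm]
  refine Finset.sum_congr rfl fun i _ => ?_
  rw [Finset.sum_comm]
  refine Finset.sum_congr rfl fun j _ => ?_
  rw [Fintype.sum_prod_type]
  simp only [← Finset.mul_sum]
  rw [← Finset.sum_mul, ← Finset.mul_sum, sum_centredIndicator_sq hq, sum_centredIndicator_sq hq]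

theorem expect_mono {Ω : Type} [Fintype Ω] {μ f g : Ω → ℝ} (hμ : ∀ y, 0 ≤ μ y)
    (h : ∀ y, f y ≤ g y) : expect μ f ≤ expect μ g :=
  Finset.sum_le_sum fun y _ => mul_le_mul_of_nonneg_left (h y) (hμ y)

/-- Moments of the overlap statistic of two independent uniform labellings. -/
theorem expect_overlap_pow_le {n q k R : ℕ} (hn : n ≠ 0) (hk : 1 ≤ k) (hq : q ≠ 0) (hR : 0 < R)
    {η : ℝ} (hη0 : 0 ≤ η) (hη : η < 1) (hqR : (q : ℝ) ≤ η * R)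
    (ht : 2 * k * (q : ℝ) ^ 2 ≤ η ^ 2 * n) :
    (1 - η) ^ (2 * k) * expect (uniformPair n q) (fun s => (∑ i, ∑ j,
      communityKernel q (s.1 i) (s.1 j) * communityKernel q (s.2 i) (s.2 j)) ^ k) ≤
      ((2 * (R + 1)) ^ (q ^ 2) : ℝ) *
        (2 * ((2 * k).factorial : ℝ) * (n / (2 * k)) ^ k * Real.exp (k * (1 + η))) := by
  have hcard : (Fintype.card (Fin q × Fin q) : ℝ) ≤ (η * R) ^ 2 := by
    rw [Fintype.card_prod, Fintype.card_fin, ← sq]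
    push_cast
    exact pow_le_pow_left₀ (by positivity) hqR 2
  have hform : ∀ (s : (Fin n → Fin q) × (Fin n → Fin q)) (v : Fin q × Fin q → ℝ),
      ∑ a, v a * ∑ i, q * (centredIndicator q (s.1 i) a.1 * centredIndicator q (s.2 i) a.2) =
        ∑ i, centredForm q v (s.1 i) (s.2 i) := by
    intro s v
    simp only [Finset.mul_sum, centredForm]
    rw [Finset.sum_comm]
    exact Finset.sum_congr rfl fun i _ => Finset.sum_congr rfl fun a _ => by ring
  rw [← expect_const_mul]
  calc _ ≤ expect (uniformPair n q) (fun s =>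
        ∑ j : Fin q × Fin q → Bool × Fin (R + 1) with ∑ i, gridPoint R j i ^ 2 ≤ 1,
        (∑ i, centredForm q (gridPoint R j) (s.1 i) (s.2 i)) ^ (2 * k)) := by
        refine expect_mono uniformPair_nonneg fun s => ?_
        -- The overlap is now a squared norm in `ℝ^(q×q)`, controlled by projections on grid
        -- vectors.
        rw [sum_communityKernel_mul_eq hq]
        refine (sum_sq_pow_le_sum_grid hR hη0 hη.le hcard _ k).trans (le_of_eq ?_)
        exact Finset.sum_congr rfl fun j _ => by rw [hform]
    _ ≤ ∑ j : Fin q × Fin q → Bool × Fin (R + 1) with ∑ i, gridPoint R j i ^ 2 ≤ 1,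
        (2 * ((2 * k).factorial : ℝ) * (n / (2 * k)) ^ k * Real.exp (k * (1 + η))) := by
        rw [expect_sum]
        exact Finset.sum_le_sum fun j hj =>
          expect_uniformPair_pow_le hn hk hq (Finset.mem_filter.1 hj).2 hη0 hη.le ht
    _ ≤ ∑ j : Fin q × Fin q → Bool × Fin (R + 1),
        (2 * ((2 * k).factorial : ℝ) * (n / (2 * k)) ^ k * Real.exp (k * (1 + η))) :=
        Finset.sum_le_sum_of_subset_of_nonneg (Finset.filter_subset _ _)
          fun _ _ _ => by positivity
    _ = _ := by
        rw [Finset.sum_const, Finset.card_univ, nsmul_eq_mul]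
        congr 1
        simp [sq]

/-! ### The truncated likelihood ratio of the stochastic block model -/

theorem sum_pair_eq {n : ℕ} (f : Fin n × Fin n → ℝ) :
    ∑ e : Pair n, f e.1 = ∑ p : Fin n × Fin n with p.1 < p.2, f p :=
  (Finset.sum_subtype _ (fun p => by simp) f).symm

theorem sum_sum_eq_two_mul_sum_pair {n : ℕ} (K : Fin n → Fin n → ℝ) (hK : ∀ i j, K i j = K j i) :
    ∑ i, ∑ j, K i j = 2 * ∑ e : Pair n, K e.1.1 e.1.2 + ∑ i, K i i := by
  rw [sum_pair_eq fun p => K p.1 p.2]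
  have h1 : ∑ i, ∑ j, K i j = ∑ p : Fin n × Fin n, K p.1 p.2 := by
    rw [Fintype.sum_prod_type]
  have h2 : ∑ p : Fin n × Fin n with p.2 < p.1, K p.1 p.2 =
      ∑ p : Fin n × Fin n with p.1 < p.2, K p.1 p.2 := by
    refine Finset.sum_bij' (fun p _ => p.swap) (fun p _ => p.swap) ?_ ?_ ?_ ?_ ?_
    · simp
    · simp
    · simp
    · simp
    · intro p _
      exact hK _ _
  have h3 : ∑ p : Fin n × Fin n with p.1 = p.2, K p.1 p.2 = ∑ i, K i i := by
    refine Finset.sum_bij' (fun p _ => p.1) (fun i _ => (i, i)) ?_ ?_ ?_ ?_ ?_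
    · simp
    · simp
    · rintro ⟨a, b⟩ h
      have : a = b := by simpa using h
      simp [this]
    · simp
    · rintro ⟨a, b⟩ h
      have : a = b := by simpa using h
      simp [this]
  rw [h1, ← Finset.sum_filter_add_sum_filter_not Finset.univ (fun p : Fin n × Fin n => p.1 < p.2),
    ← Finset.sum_filter_add_sum_filter_not
      (Finset.univ.filter fun p : Fin n × Fin n => ¬ p.1 < p.2) (fun p => p.2 < p.1),
    Finset.filter_filter, Finset.filter_filter]
  have h4 : (Finset.univ.filter fun p : Fin n × Fin n => ¬ p.1 < p.2 ∧ p.2 < p.1) =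
      Finset.univ.filter fun p : Fin n × Fin n => p.2 < p.1 := by
    ext p
    simp only [Finset.mem_filter, Finset.mem_univ, true_and]
    exact ⟨fun h => h.2, fun h => ⟨h.le.not_gt, h⟩⟩
  have h5 : (Finset.univ.filter fun p : Fin n × Fin n => ¬ p.1 < p.2 ∧ ¬ p.2 < p.1) =
      Finset.univ.filter fun p : Fin n × Fin n => p.1 = p.2 := by
    ext p
    simp only [Finset.mem_filter, Finset.mem_univ, true_and, not_lt]
    exact ⟨fun h => le_antisymm h.2 h.1, fun h => ⟨h.ge, h.le⟩⟩
  rw [h4, h5, h2, h3]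
  ring

noncomputable section

/-- The community kernel evaluated at the ends of an edge. -/
def edgeKernel (n q : ℕ) (σ : Fin n → Fin q) (e : Pair n) : ℝ :=
  communityKernel q (σ e.1.1) (σ e.1.2)

end

theorem communityKernel_comm {q : ℕ} (x y : Fin q) :
    communityKernel q x y = communityKernel q y x := by
  simp only [communityKernel, eq_comm]

theorem communityKernel_self {q : ℕ} (x : Fin q) : communityKernel q x x = q - 1 := by
  simp [communityKernel]

theorem sbmEdgeProb_eq (n q : ℕ) (d lam : ℝ) (σ : Fin n → Fin q) (e : Pair n) :
    sbmEdgeProb n q d lam σ e = d / n + lam * d / n * edgeKernel n q σ e := by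
  unfold sbmEdgeProb edgeKernel communityKernel
  split_ifs <;> ring

theorem sbmSignal_eq (n q : ℕ) (d lam : ℝ) (σ : Fin n → Fin q) (e : Pair n) :
    sbmSignal n q d lam σ e = lam * d / n * edgeKernel n q σ e := by
  unfold sbmSignal edgeKernel communityKernel
  ring

theorem expect_sbmLaw {n q : ℕ} (d lam : ℝ) (f : (Pair n → Bool) → ℝ) :
    expect (sbmLaw n q d lam) f = ((q : ℝ) ^ n)⁻¹ * ∑ σ : Fin n → Fin q,
      expect (fun y => ∏ e, bernoulliMass (sbmEdgeProb n q d lam σ e) (y e)) f := by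
  simp only [expect, sbmLaw, sbmJoint, Finset.sum_mul, Finset.mul_sum]
  rw [Finset.sum_comm]
  simp only [mul_assoc]

theorem expect_prod_bernoulliMass_one {ι : Type} [Fintype ι] [DecidableEq ι] (r : ι → ℝ) :
    expect (fun y : ι → Bool => ∏ e, bernoulliMass (r e) (y e)) (fun _ => 1) = 1 := by
  simp only [expect, mul_one]
  rw [← Fintype.prod_sum (fun e b => bernoulliMass (r e) b)]
  simp only [sum_bernoulliMass, Finset.prod_const_one]

theorem expect_sbmLaw_one {n q : ℕ} (hq : q ≠ 0) (d lam : ℝ) :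
    expect (sbmLaw n q d lam) (fun _ => 1) = 1 := by
  rw [expect_sbmLaw]
  have hq' : (q : ℝ) ≠ 0 := by exact_mod_cast hq
  simp [expect_prod_bernoulliMass_one, hq']

/-- Given the labels the bits are independent, and a normalized bit has mean `λ d / n` times the
kernel, divided by the standard deviation. -/
theorem expect_sbmLaw_fourierChar {n q : ℕ} {d lam : ℝ}
    (hr0 : ∀ σ e, 0 ≤ sbmEdgeProb n q d lam σ e) (hr1 : ∀ σ e, sbmEdgeProb n q d lam σ e ≤ 1)
    (α : Finset (Pair n)) :
    expect (sbmLaw n q d lam) (fourierChar (d / n) α) =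
      (lam * d / n / √(d / n * (1 - d / n))) ^ α.card *
        (((q : ℝ) ^ n)⁻¹ * ∑ σ : Fin n → Fin q, ∏ e ∈ α, edgeKernel n q σ e) := by
  rw [expect_sbmLaw, mul_left_comm]
  congr 1
  rw [Finset.mul_sum]
  refine Finset.sum_congr rfl fun σ _ => ?_
  rw [expect_prod_fourierChar (d / n) (fun e => bernoulliMass (sbmEdgeProb n q d lam σ e)) α,
    ← Finset.prod_const, ← Finset.prod_mul_distrib,
    ← Finset.prod_filter_mul_prod_filter_not Finset.univ (fun e => e ∈ α)]
  rw [Finset.prod_eq_one (s := Finset.univ.filter fun e => ¬ e ∈ α), mul_one]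
  · rw [Finset.filter_univ_mem]
    refine Finset.prod_congr rfl fun e he => ?_
    simp only [he, if_true]
    rw [sum_bernoulliMass_mul_bitChar _ (hr0 σ e) (hr1 σ e), sbmEdgeProb_eq]
    ring
  · intro e he
    simp only [(Finset.mem_filter.1 he).2, if_false, mul_one, sum_bernoulliMass]

/-- Two independent replicas of the labelling turn the square of an average into an average. In
particular all mixed moments of the edge overlaps are nonnegative, as the moment comparison
requires. -/
theorem sq_avg_prod_edgeKernel {n q : ℕ} (α : Finset (Pair n)) (m : Pair n → ℕ) :
    (((q : ℝ) ^ n)⁻¹ * ∑ σ : Fin n → Fin q, ∏ e ∈ α, edgeKernel n q σ e ^ m e) ^ 2 =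
      expect (uniformPair n q) fun s =>
        ∏ e ∈ α, (edgeKernel n q s.1 e * edgeKernel n q s.2 e) ^ m e := by
  simp only [expect, uniformPair, ← Finset.mul_sum, mul_pow, Finset.prod_mul_distrib]
  rw [Fintype.sum_prod_type, sq (∑ σ : Fin n → Fin q, _), Finset.sum_mul_sum]

theorem overlap_moment_nonneg {n q : ℕ} (m : Pair n → ℕ) :
    0 ≤ expect (uniformPair n q) fun s =>
        ∏ e, (edgeKernel n q s.1 e * edgeKernel n q s.2 e) ^ m e := by
  rw [← sq_avg_prod_edgeKernel Finset.univ m]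
  positivity

/-- The double sum is twice the edge sum plus a diagonal, and the diagonal is the nonnegative
constant `n (q - 1)²`. -/
theorem expect_edgeOverlap_pow_le {n q : ℕ} (k : ℕ) :
    2 ^ k * expect (uniformPair n q)
      (fun s => (∑ e, edgeKernel n q s.1 e * edgeKernel n q s.2 e) ^ k) ≤
    expect (uniformPair n q) (fun s => (∑ i, ∑ j,
      communityKernel q (s.1 i) (s.1 j) * communityKernel q (s.2 i) (s.2 j)) ^ k) := by
  have h := expect_pow_le_expect_add_pow (uniformPair n q)
    (fun s => 2 * ∑ e, edgeKernel n q s.1 e * edgeKernel n q s.2 e) (fun k => by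
      simp only [mul_pow, expect_const_mul]
      exact mul_nonneg (by positivity) (expect_pow_nonneg _
        (fun e (s : (Fin n → Fin q) × (Fin n → Fin q)) =>
          edgeKernel n q s.1 e * edgeKernel n q s.2 e) overlap_moment_nonneg k))
    (c := n * ((q : ℝ) - 1) ^ 2) (by positivity) k
  simp only [mul_pow, expect_const_mul] at h
  refine h.trans (le_of_eq ?_)
  congr 1
  funext s
  congr 1
  rw [sum_sum_eq_two_mul_sum_pair (fun i j =>
    communityKernel q (s.1 i) (s.1 j) * communityKernel q (s.2 i) (s.2 j))
    (fun i j => by rw [communityKernel_comm, communityKernel_comm (s.2 i)])]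
  congr 1
  simp only [communityKernel_self, Finset.sum_const, Finset.card_univ, Fintype.card_fin,
    nsmul_eq_mul]
  ring

/-- With `s = d λ² / (1 - d / n)`, degree `k` contributes at most `(s / n)^k / k!` times the `k`-th
moment of the edge overlap. After inserting the moment bound and Stirling's bound, all powers `k`
combine into `(s e^η / (1 - η)²)^k ≤ 1`. What is left is the size of the net and a factor linear in
`k`. -/
theorem sum_sq_sbm_card_eq_le {n q k R : ℕ} {d lam η : ℝ} (hn : n ≠ 0) (hk : 1 ≤ k) (hq : q ≠ 0)
    (hR : 0 < R) (hd0 : 0 < d / n) (hd1 : d / n < 1)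
    (hr0 : ∀ σ e, 0 ≤ sbmEdgeProb n q d lam σ e) (hr1 : ∀ σ e, sbmEdgeProb n q d lam σ e ≤ 1)
    (hη0 : 0 ≤ η) (hη : η < 1) (hqR : (q : ℝ) ≤ η * R)
    (ht : 2 * k * (q : ℝ) ^ 2 ≤ η ^ 2 * n)
    (hs : d * lam ^ 2 / (1 - d / n) * Real.exp η ≤ (1 - η) ^ 2) :
    ∑ α : Finset (Pair n) with α.card = k,
      expect (sbmLaw n q d lam) (fourierChar (d / n) α) ^ 2 ≤
      ((2 * (R + 1)) ^ (q ^ 2) : ℝ) * (2 * Real.exp 1 * k) := by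
  have hn' : (0 : ℝ) < n := by exact_mod_cast Nat.pos_of_ne_zero hn
  have hk' : (0 : ℝ) < k := by exact_mod_cast hk
  set s : ℝ := d * lam ^ 2 / (1 - d / n) with hsdef
  have hd1' : 0 < 1 - d / n := by linarith
  have hd : 0 < d := by rwa [div_pos_iff_of_pos_right hn'] at hd0
  have hs0 : 0 ≤ s := by positivity
  have hγ : (lam * d / n / √(d / n * (1 - d / n))) ^ 2 = s / n := by
    rw [div_pow, Real.sq_sqrt (by positivity), hsdef]
    field_simp
  set V := expect (uniformPair n q)
    (fun s => (∑ e, edgeKernel n q s.1 e * edgeKernel n q s.2 e) ^ k) with hV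
  set U := expect (uniformPair n q) (fun s => (∑ i, ∑ j,
      communityKernel q (s.1 i) (s.1 j) * communityKernel q (s.2 i) (s.2 j)) ^ k) with hU
  have h1 : ∑ α : Finset (Pair n) with α.card = k,
      expect (sbmLaw n q d lam) (fourierChar (d / n) α) ^ 2 =
      (s / n) ^ k * ∑ α : Finset (Pair n) with α.card = k, expect (uniformPair n q)
        (fun s => ∏ e ∈ α, (edgeKernel n q s.1 e * edgeKernel n q s.2 e)) := by
    rw [Finset.mul_sum]
    refine Finset.sum_congr rfl fun α hα => ?_
    rw [expect_sbmLaw_fourierChar hr0 hr1, mul_pow, ← pow_mul, mul_comm _ 2, pow_mul, hγ,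
      (Finset.mem_filter.1 hα).2]
    congr 1
    have := sq_avg_prod_edgeKernel (q := q) α (fun _ => 1)
    simpa only [pow_one] using this
  have h2 := factorial_mul_sum_expect_prod_le (uniformPair n q)
    (fun e (s : (Fin n → Fin q) × (Fin n → Fin q)) =>
      edgeKernel n q s.1 e * edgeKernel n q s.2 e) overlap_moment_nonneg k
  rw [← hV] at h2
  have h3 : 2 ^ k * V ≤ U := expect_edgeOverlap_pow_le k
  have h4 := expect_overlap_pow_le hn hk hq hR hη0 hη hqR ht
  rw [← hU] at h4
  set B : ℝ := (2 * (R + 1)) ^ (q ^ 2) with hB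
  have hB0 : 0 ≤ B := by positivity
  rw [h1]
  set A := ∑ α : Finset (Pair n) with α.card = k, expect (uniformPair n q)
        (fun s => ∏ e ∈ α, (edgeKernel n q s.1 e * edgeKernel n q s.2 e)) with hA
  have hη1 : 0 < 1 - η := by linarith
  -- The central binomial coefficient is at most `4^k`, which is sharp on the exponential scale.
  have hfac : ((2 * k).factorial : ℝ) ≤ 4 ^ k * (k.factorial : ℝ) ^ 2 := by
    have e1 := Nat.choose_mul_factorial_mul_factorial (Nat.le_mul_of_pos_left k (by norm_num : 0 < 2))
    have e2 : (2 * k).choose k ≤ 4 ^ k := by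
      have := Nat.choose_le_two_pow (2 * k) k
      rwa [pow_mul] at this
    have e3 : 2 * k - k = k := by omega
    rw [e3] at e1
    rw [← e1]
    push_cast
    rw [mul_assoc, ← sq]
    exact mul_le_mul_of_nonneg_right (by exact_mod_cast e2) (by positivity)
  have hkf := factorial_le_mul_div_exp_pow k hk
  have hkf0 : (0 : ℝ) < k.factorial := by positivity
  have h5 : (1 - η) ^ (2 * k) * (2 ^ k * ((k.factorial : ℝ) * A)) ≤
      B * (2 * (4 ^ k * (k.factorial : ℝ) ^ 2) * (n / (2 * k)) ^ k * Real.exp (k * (1 + η))) := by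
    calc _ ≤ (1 - η) ^ (2 * k) * U := by
          refine mul_le_mul_of_nonneg_left (le_trans ?_ h3) (by positivity)
          exact mul_le_mul_of_nonneg_left h2 (by positivity)
      _ ≤ _ := h4
      _ ≤ _ := by gcongr
  have h6 : (1 - η) ^ (2 * k) * A ≤ B * (2 * (k.factorial : ℝ) * (n / k) ^ k *
      Real.exp (k * (1 + η))) := by
    have e1 : B * (2 * (4 ^ k * (k.factorial : ℝ) ^ 2) * (n / (2 * k)) ^ k *
        Real.exp (k * (1 + η))) = (2 ^ k * (k.factorial : ℝ)) * (B * (2 * (k.factorial : ℝ) *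
          (n / k) ^ k * Real.exp (k * (1 + η)))) := by
      have : (4 : ℝ) ^ k * (n / (2 * k)) ^ k = 2 ^ k * (n / k) ^ k := by
        rw [← mul_pow, ← mul_pow]
        congr 1
        field_simp
        norm_num
      linear_combination (B * 2 * (k.factorial : ℝ) ^ 2 * Real.exp (k * (1 + η))) * this
    rw [e1] at h5
    refine le_of_mul_le_mul_left (le_trans (le_of_eq ?_) h5)
      (by positivity : (0 : ℝ) < 2 ^ k * (k.factorial : ℝ))
    ring
  -- The Kesten–Stigum condition, in the form `hs`, enters here.
  have h7 : (s / n) ^ k * ((n / k) ^ k * Real.exp (k * (1 + η))) ≤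
      (1 - η) ^ (2 * k) * (Real.exp 1 / k) ^ k := by
    have e1 : Real.exp (k * (1 + η)) = (Real.exp 1 * Real.exp η) ^ k := by
      rw [← Real.exp_add, ← Real.exp_nat_mul]
    rw [e1, pow_mul, ← mul_pow, ← mul_pow, ← mul_pow]
    refine pow_le_pow_left₀ (by positivity) ?_ k
    have e2 : s / n * (n / k * (Real.exp 1 * Real.exp η)) = s * Real.exp η * (Real.exp 1 / k) := by
      field_simp
    rw [e2]
    exact mul_le_mul_of_nonneg_right hs (by positivity)
  have h8 : (k.factorial : ℝ) * (Real.exp 1 / k) ^ k ≤ Real.exp 1 * k := by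
    calc _ ≤ Real.exp 1 * k * (k / Real.exp 1) ^ k * (Real.exp 1 / k) ^ k := by gcongr
      _ = Real.exp 1 * k := by
        rw [mul_assoc, ← mul_pow]
        have : (k : ℝ) / Real.exp 1 * (Real.exp 1 / k) = 1 := by field_simp
        rw [this, one_pow, mul_one]
  refine le_of_mul_le_mul_left (?_ : (1 - η) ^ (2 * k) * _ ≤ (1 - η) ^ (2 * k) * _)
    (by positivity : (0 : ℝ) < (1 - η) ^ (2 * k))
  calc (1 - η) ^ (2 * k) * ((s / n) ^ k * A) = (s / n) ^ k * ((1 - η) ^ (2 * k) * A) := by ring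
    _ ≤ (s / n) ^ k * (B * (2 * (k.factorial : ℝ) * (n / k) ^ k * Real.exp (k * (1 + η)))) := by
        gcongr
    _ = B * (2 * (k.factorial : ℝ)) * ((s / n) ^ k * ((n / k) ^ k * Real.exp (k * (1 + η)))) := by
        ring
    _ ≤ B * (2 * (k.factorial : ℝ)) * ((1 - η) ^ (2 * k) * (Real.exp 1 / k) ^ k) := by gcongr
    _ = (1 - η) ^ (2 * k) * (B * (2 * ((k.factorial : ℝ) * (Real.exp 1 / k) ^ k))) := by ring
    _ ≤ (1 - η) ^ (2 * k) * (B * (2 * (Real.exp 1 * k))) := by gcongr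
    _ = _ := by ring

/-- Below the Kesten-Stigum threshold, the truncated likelihood ratio of the block model is at most
exponential in `q ^ 2` up to logarithms. -/
theorem sum_sq_sbm_le {n q D R : ℕ} {d lam η : ℝ} (hn : n ≠ 0) (hq : q ≠ 0)
    (hR : 0 < R) (hd0 : 0 < d / n) (hd1 : d / n < 1)
    (hr0 : ∀ σ e, 0 ≤ sbmEdgeProb n q d lam σ e) (hr1 : ∀ σ e, sbmEdgeProb n q d lam σ e ≤ 1)
    (hη0 : 0 ≤ η) (hη : η < 1) (hqR : (q : ℝ) ≤ η * R)
    (ht : 2 * D * (q : ℝ) ^ 2 ≤ η ^ 2 * n)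
    (hs : d * lam ^ 2 / (1 - d / n) * Real.exp η ≤ (1 - η) ^ 2) :
    ∑ α : Finset (Pair n) with α ≠ ∅ ∧ α.card ≤ D,
      expect (sbmLaw n q d lam) (fourierChar (d / n) α) ^ 2 ≤
      ((2 * (R + 1)) ^ (q ^ 2) : ℝ) * (2 * Real.exp 1 * D ^ 2) := by
  rw [← Finset.sum_fiberwise_of_maps_to (t := Finset.Icc 1 D) (g := Finset.card)]
  · calc _ ≤ ∑ k ∈ Finset.Icc 1 D, ((2 * (R + 1)) ^ (q ^ 2) : ℝ) * (2 * Real.exp 1 * D) := by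
          refine Finset.sum_le_sum fun k hk => ?_
          obtain ⟨hk1, hk2⟩ := Finset.mem_Icc.1 hk
          have hkD : (k : ℝ) ≤ D := by exact_mod_cast hk2
          refine le_trans (Finset.sum_le_sum_of_subset_of_nonneg ?_ fun _ _ _ => sq_nonneg _)
            ((sum_sq_sbm_card_eq_le hn hk1 hq hR hd0 hd1 hr0 hr1 hη0 hη hqR ?_ hs).trans ?_)
          · intro α hα
            rw [Finset.mem_filter] at hα ⊢
            exact ⟨Finset.mem_univ _, hα.2⟩
          · refine le_trans ?_ ht
            gcongr
          · gcongr
      _ = _ := by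
          rw [Finset.sum_const, Nat.card_Icc, nsmul_eq_mul]
          simp only [Nat.add_sub_cancel]
          ring
  · intro α hα
    rw [Finset.mem_filter] at hα
    exact Finset.mem_Icc.2 ⟨Finset.card_pos.2 (Finset.nonempty_iff_ne_empty.2 hα.2.1), hα.2.2⟩

/-! ### Composition of straight-line programs -/

/-- Execute a list of instructions starting from the memory `mem`. -/
def runFrom {ι : Type} (y : ι → Bool) (mem : List Bool) (c : List (BoolInstr ι)) : List Bool :=
  c.foldl (fun mem s => mem ++ [s.value y mem]) mem

/-- Some memory cell holds the value of `f` after executing `c`. -/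
def Computes {ι : Type} (c : List (BoolInstr ι)) (f : (ι → Bool) → Bool) : Prop :=
  ∃ i, i < c.length ∧ ∀ y, (runFrom y [] c).getD i false = f y

/-- Every program extending `c` can be extended by at most `s` instructions so as to compute
`f`. -/
def ComputableWithin {ι : Type} (c : List (BoolInstr ι)) (s : ℕ) (f : (ι → Bool) → Bool) : Prop :=
  ∀ c₀, c <+: c₀ → ∃ c₁, c₀ <+: c₁ ∧ c₁.length ≤ c₀.length + s ∧ Computes c₁ f

section Programs

variable {ι : Type} {c c' : List (BoolInstr ι)} {f g : (ι → Bool) → Bool} {s t : ℕ}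

theorem runFrom_append (y : ι → Bool) (mem : List Bool) (c c' : List (BoolInstr ι)) :
    runFrom y mem (c ++ c') = runFrom y (runFrom y mem c) c' :=
  List.foldl_append

theorem length_runFrom (y : ι → Bool) (mem : List Bool) (c : List (BoolInstr ι)) :
    (runFrom y mem c).length = mem.length + c.length := by
  induction c generalizing mem with
  | nil => rfl
  | cons a c ih =>
    change (runFrom y (mem ++ [a.value y mem]) c).length = _
    rw [ih]
    simp
    omega

theorem prefix_runFrom (y : ι → Bool) (mem : List Bool) (c : List (BoolInstr ι)) :
    mem <+: runFrom y mem c := by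
  induction c generalizing mem with
  | nil => exact List.prefix_rfl
  | cons a c ih => exact (List.prefix_append _ _).trans (ih _)

theorem getD_eq_of_prefix {l l' : List Bool} (h : l <+: l') {i : ℕ} (hi : i < l.length) :
    l'.getD i false = l.getD i false := by
  obtain ⟨r, rfl⟩ := h
  exact List.getD_append _ _ _ _ hi

/-- Memory is append-only, so a computed cell is never overwritten. -/
theorem Computes.of_prefix (h : Computes c f) (hc : c <+: c') : Computes c' f := by
  obtain ⟨i, hi, hf⟩ := h
  obtain ⟨r, rfl⟩ := hc
  refine ⟨i, by simp; omega, fun y => ?_⟩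
  rw [runFrom_append, getD_eq_of_prefix (prefix_runFrom _ _ _), hf]
  rw [length_runFrom]
  simpa using hi

theorem computes_append_singleton (c : List (BoolInstr ι)) (a : BoolInstr ι)
    (h : ∀ y, a.value y (runFrom y [] c) = f y) : Computes (c ++ [a]) f := by
  refine ⟨c.length, by simp, fun y => ?_⟩
  rw [runFrom_append]
  change (runFrom y [] c ++ [a.value y (runFrom y [] c)]).getD c.length false = f y
  rw [h]
  have : (runFrom y [] c).length = c.length := by simp [length_runFrom]
  simp [this]

theorem Computes.within (h : Computes c f) : ComputableWithin c 0 f :=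
  fun c₀ hc => ⟨c₀, List.prefix_rfl, le_rfl, h.of_prefix hc⟩

theorem ComputableWithin.of_prefix (h : ComputableWithin c s f) (hc : c <+: c') :
    ComputableWithin c' s f :=
  fun c₀ hc₀ => h c₀ (hc.trans hc₀)

theorem ComputableWithin.mono (h : ComputableWithin c s f) (hst : s ≤ t) :
    ComputableWithin c t f := fun c₀ hc₀ => by
  obtain ⟨c₁, h1, h2, h3⟩ := h c₀ hc₀
  exact ⟨c₁, h1, by omega, h3⟩

theorem computableWithin_input (c : List (BoolInstr ι)) (e : ι) :
    ComputableWithin c 1 fun y => y e := fun c₀ _ =>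
  ⟨c₀ ++ [.input e], List.prefix_append _ _, by simp,
    computes_append_singleton _ _ fun _ => rfl⟩

theorem computableWithin_const (c : List (BoolInstr ι)) (b : Bool) :
    ComputableWithin c 1 fun _ => b := fun c₀ _ =>
  ⟨c₀ ++ [.const b], List.prefix_append _ _, by simp,
    computes_append_singleton _ _ fun _ => rfl⟩

theorem ComputableWithin.nand (hf : ComputableWithin c s f) (hg : ComputableWithin c t g) :
    ComputableWithin c (s + t + 1) fun y => !(f y && g y) := fun c₀ hc₀ => by
  obtain ⟨c₁, h1, h2, h3⟩ := hf c₀ hc₀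
  obtain ⟨c₂, k1, k2, k3⟩ := hg c₁ (hc₀.trans h1)
  obtain ⟨i, -, hi⟩ := h3.of_prefix k1
  obtain ⟨j, -, hj⟩ := k3
  refine ⟨c₂ ++ [.nand i j], h1.trans (k1.trans (List.prefix_append _ _)), by simp; omega,
    computes_append_singleton _ _ fun y => ?_⟩
  simp only [BoolInstr.value, hi, hj]

theorem ComputableWithin.not (hf : ComputableWithin c s f) :
    ComputableWithin c (s + 1) fun y => !(f y) := fun c₀ hc₀ => by
  obtain ⟨c₁, h1, h2, i, hi, hfi⟩ := hf c₀ hc₀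
  refine ⟨c₁ ++ [.nand i i], h1.trans (List.prefix_append _ _), by simp; omega,
    computes_append_singleton _ _ fun y => ?_⟩
  simp only [BoolInstr.value, hfi, Bool.and_self]

theorem ComputableWithin.and (hf : ComputableWithin c s f) (hg : ComputableWithin c t g) :
    ComputableWithin c (s + t + 2) fun y => f y && g y := by
  simpa using (hf.nand hg).not

theorem ComputableWithin.or (hf : ComputableWithin c s f) (hg : ComputableWithin c t g) :
    ComputableWithin c (s + t + 3) fun y => f y || g y := by
  have := hf.not.nand hg.not
  simp only [← Bool.not_or, Bool.not_not] at this
  exact this.mono (by omega)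

theorem ComputableWithin.congr (hf : ComputableWithin c s f) (h : ∀ y, f y = g y) :
    ComputableWithin c s g := (funext h : f = g) ▸ hf

theorem computableWithin_exists {κ : Type} [DecidableEq κ] (S : Finset κ)
    {F : κ → (ι → Bool) → Bool} (hF : ∀ i ∈ S, ComputableWithin c s (F i)) :
    ComputableWithin c (S.card * (s + 3) + 1) fun y => decide (∃ i ∈ S, F i y = true) := by
  induction S using Finset.induction_on with
  | empty =>
    refine ((computableWithin_const c false).congr fun y => ?_).mono (by simp)
    simp
  | insert a S ha ih =>
    have h1 := (hF a (Finset.mem_insert_self a S)).or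
      (ih fun i hi => hF i (Finset.mem_insert_of_mem hi))
    refine (h1.congr fun y => ?_).mono ?_
    · simp only [Finset.exists_mem_insert, Bool.decide_or, Bool.decide_eq_true]
    · rw [Finset.card_insert_of_notMem ha]
      ring_nf
      omega

/-- Computing a family of functions. -/
theorem exists_computes_family {κ : Type} [DecidableEq κ] (S : Finset κ)
    {F : κ → (ι → Bool) → Bool} (hF : ∀ i ∈ S, ComputableWithin c s (F i)) :
    ∃ c₁, c <+: c₁ ∧ c₁.length ≤ c.length + S.card * s ∧ ∀ i ∈ S, Computes c₁ (F i) := by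
  induction S using Finset.induction_on with
  | empty => exact ⟨c, List.prefix_rfl, by simp, by simp⟩
  | insert a S ha ih =>
    obtain ⟨c₁, h1, h2, h3⟩ := ih fun i hi => hF i (Finset.mem_insert_of_mem hi)
    obtain ⟨c₂, k1, k2, k3⟩ := hF a (Finset.mem_insert_self a S) c₁ h1
    refine ⟨c₂, h1.trans k1, ?_, fun i hi => ?_⟩
    · rw [Finset.card_insert_of_notMem ha]
      ring_nf at *
      omega
    · rcases Finset.mem_insert.1 hi with rfl | hi
      · exact k3
      · exact (h3 i hi).of_prefix k1

/-- Counting: the indicators of all values of the number of true bits in a family. -/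
theorem exists_computes_count {κ : Type} [DecidableEq κ] (S : Finset κ) (V : ℕ)
    {F : κ → (ι → Bool) → Bool} (hF : ∀ i ∈ S, ComputableWithin c s (F i)) :
    ∃ c₁, c <+: c₁ ∧ c₁.length ≤ c.length + (S.card + 1) * ((V + 1) * (2 * s + 8)) ∧
      ∀ v ∈ Finset.range (V + 1),
        Computes c₁ fun y => decide ((S.filter fun i => F i y = true).card = v) := by
  induction S using Finset.induction_on with
  | empty =>
    obtain ⟨c₁, h1, h2, h3⟩ := exists_computes_family (c := c) (s := 1) (Finset.range (V + 1))
      (F := fun v y => decide (0 = v)) (fun v _ => computableWithin_const c _)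
    refine ⟨c₁, h1, h2.trans ?_, fun v hv => by simpa using h3 v hv⟩
    rw [Finset.card_range, Finset.card_empty, zero_add, one_mul]
    gcongr
    omega
  | insert a S ha ih =>
    obtain ⟨c₁, h1, h2, h3⟩ := ih fun i hi => hF i (Finset.mem_insert_of_mem hi)
    have hFa := (hF a (Finset.mem_insert_self a S)).of_prefix h1
    have hstep : ∀ v ∈ Finset.range (V + 1), ComputableWithin c₁ (2 * s + 8)
        fun y => decide (((insert a S).filter fun i => F i y = true).card = v) := by
      intro v hv
      have hcard : ∀ y, ((insert a S).filter fun i => F i y = true).card =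
          (S.filter fun i => F i y = true).card + (if F a y then 1 else 0) := by
        intro y
        rw [Finset.filter_insert]
        split_ifs with h
        · rw [Finset.card_insert_of_notMem fun h => ha (Finset.mem_filter.1 h).1]
        · rfl
      -- The new count is `v` if the old one is `v` and the new bit is false, or if the old one is
      -- `v - 1` and the new bit is true.
      have hA := ((h3 v hv).within.and hFa.not)
      cases v with
      | zero =>
        refine (hA.mono (by omega)).congr fun y => ?_
        rw [hcard]
        cases F a y <;> simp
      | succ v =>
        have hB := ((h3 v (by rw [Finset.mem_range] at *; omega)).within.and hFa)
        refine ((hA.or hB).mono (by omega)).congr fun y => ?_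
        rw [hcard]
        cases F a y <;> simp
    obtain ⟨c₂, k1, k2, k3⟩ := exists_computes_family (Finset.range (V + 1)) hstep
    refine ⟨c₂, h1.trans k1, ?_, k3⟩
    rw [Finset.card_insert_of_notMem ha]
    rw [Finset.card_range] at k2
    have : (S.card + 1 + 1) * ((V + 1) * (2 * s + 8)) =
      (S.card + 1) * ((V + 1) * (2 * s + 8)) + (V + 1) * (2 * s + 8) := by ring
    omega

/-- An arbitrary predicate of the numbers of true bits in two families. -/
theorem computableWithin_two_counts {κ : Type} [Fintype κ] [DecidableEq κ]
    {F G : κ → (ι → Bool) → Bool} (hF : ∀ i, ComputableWithin c s (F i))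
    (hG : ∀ i, ComputableWithin c s (G i)) (P : ℕ → ℕ → Bool) :
    ComputableWithin c ((Fintype.card κ + 1) ^ 2 * (4 * s + 22))
      fun y => P (Finset.univ.filter fun i => F i y = true).card
        (Finset.univ.filter fun i => G i y = true).card := fun c₀ hc₀ => by
  set V := Fintype.card κ with hV
  obtain ⟨c₁, h1, h2, h3⟩ := exists_computes_count Finset.univ V
    fun i _ => (hF i).of_prefix hc₀
  obtain ⟨c₂, k1, k2, k3⟩ := exists_computes_count Finset.univ V
    fun i _ => (hG i).of_prefix (hc₀.trans h1)
  -- Table lookup: a disjunction over all pairs of values accepted by `P`. No arithmetic is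
  -- performed, so `P` may involve arbitrary real thresholds.
  have hW := computableWithin_exists (c := c₂) (s := 2)
    ((Finset.range (V + 1) ×ˢ Finset.range (V + 1)).filter fun p => P p.1 p.2 = true)
    (F := fun p y => decide ((Finset.univ.filter fun i => F i y = true).card = p.1) &&
      decide ((Finset.univ.filter fun i => G i y = true).card = p.2)) (by
      intro p hp
      obtain ⟨hp1, hp2⟩ := Finset.mem_product.1 (Finset.mem_filter.1 hp).1
      exact ((h3 p.1 hp1).of_prefix k1).within.and (k3 p.2 hp2).within)
  obtain ⟨c₃, m1, m2, m3⟩ := hW c₂ List.prefix_rfl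
  refine ⟨c₃, h1.trans (k1.trans m1), ?_, ?_⟩
  · have hcard : ((Finset.range (V + 1) ×ˢ Finset.range (V + 1)).filter
        fun p => P p.1 p.2 = true).card ≤ (V + 1) ^ 2 := by
      refine (Finset.card_filter_le _ _).trans (le_of_eq ?_)
      rw [Finset.card_product, Finset.card_range, sq]
    rw [Finset.card_univ, ← hV] at h2 k2
    have e1 : (V + 1) * ((V + 1) * (2 * s + 8)) = (V + 1) ^ 2 * (2 * s + 8) := by ring
    have e2 : 1 ≤ (V + 1) ^ 2 := Nat.one_le_pow _ _ (by omega)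
    have e3 : (V + 1) ^ 2 * (4 * s + 22) = 2 * ((V + 1) ^ 2 * (2 * s + 8)) + 6 * (V + 1) ^ 2 := by
      ring
    rw [e1] at h2 k2
    omega
  · convert m3 using 1
    funext y
    rw [Bool.eq_iff_iff, decide_eq_true_iff]
    constructor
    · intro h
      refine ⟨((Finset.univ.filter fun i => F i y = true).card,
        (Finset.univ.filter fun i => G i y = true).card),
        Finset.mem_filter.2 ⟨Finset.mem_product.2
        ⟨Finset.mem_range.2 (Nat.lt_succ_of_le (Finset.card_le_univ _)),
          Finset.mem_range.2 (Nat.lt_succ_of_le (Finset.card_le_univ _))⟩, h⟩, ?_⟩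
      simp
    · rintro ⟨⟨u, v⟩, hp, h⟩
      simp only [Bool.and_eq_true, decide_eq_true_eq] at h
      rw [h.1, h.2]
      exact (Finset.mem_filter.1 hp).2

end Programs

/-! ### Relocating a program -/

/-- Replace the inputs of an instruction and shift its memory references. -/
def BoolInstr.relocate {ι κ : Type} (r : ι → BoolInstr κ) (k : ℕ) : BoolInstr ι → BoolInstr κ
  | .input e => r e
  | .const b => .const b
  | .nand i j => .nand (k + i) (k + j)

theorem runFrom_relocate {ι κ : Type} {r : ι → BoolInstr κ} {y : κ → Bool} {z : ι → Bool}
    (hr : ∀ e mem, (r e).value y mem = z e) (pre mem : List Bool) (c : List (BoolInstr ι)) :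
    runFrom y (pre ++ mem) (c.map (BoolInstr.relocate r pre.length)) =
      pre ++ runFrom z mem c := by
  induction c generalizing mem with
  | nil => rfl
  | cons a c ih =>
    have h : (a.relocate r pre.length).value y (pre ++ mem) = a.value z mem := by
      cases a with
      | input e => exact hr e _
      | const b => rfl
      | nand i j =>
        simp only [BoolInstr.relocate, BoolInstr.value]
        -- References past the end of `mem` stay past the end after the shift, so unwritten cells
        -- read `false` in both runs.
        rw [List.getD_append_right _ _ _ _ (by omega), List.getD_append_right _ _ _ _ (by omega),
          Nat.add_sub_cancel_left, Nat.add_sub_cancel_left]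
    change runFrom y (pre ++ mem ++ [_]) (c.map _) = pre ++ runFrom z (mem ++ [_]) c
    rw [h, List.append_assoc, ih]

/-- After a relocated copy of a program, every cell of its memory is available. -/
theorem computableWithin_memory {ι κ o : Type} (A : BoolProgram ι o) {r : ι → BoolInstr κ}
    {z : (κ → Bool) → ι → Bool} (hr : ∀ y e mem, (r e).value y mem = z y e)
    (c : List (BoolInstr κ)) (i : ℕ) :
    ComputableWithin (c ++ A.code.map (BoolInstr.relocate r c.length)) 1
      fun y => (A.memory (z y)).getD i false := by
  have hrun : ∀ y, runFrom y [] (c ++ A.code.map (BoolInstr.relocate r c.length)) =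
      runFrom y [] c ++ A.memory (z y) := by
    intro y
    have hl : (runFrom y [] c).length = c.length := by simp [length_runFrom]
    have := runFrom_relocate (hr y) (runFrom y [] c) [] A.code
    rw [hl, List.append_nil] at this
    rw [runFrom_append, this]
    rfl
  have hmem : ∀ y, (A.memory y).length = A.code.length := fun y => by
    have := length_runFrom y [] A.code
    rwa [List.length_nil, zero_add] at this
  by_cases hi : i < A.code.length
  · refine (Computes.within ⟨c.length + i, by simp; omega, fun y => ?_⟩).mono (Nat.zero_le 1)
    have hl : (runFrom y [] c).length = c.length := by simp [length_runFrom]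
    rw [hrun, List.getD_append_right _ _ _ _ (by omega), hl, Nat.add_sub_cancel_left]
  · refine (computableWithin_const _ false).congr fun y => ?_
    rw [List.getD_eq_default]
    rw [hmem]
    omega

/-! ### The detection program built from an estimator -/

section Detector

variable {ι : Type} [Fintype ι] [DecidableEq ι]

/-- The input of the estimator: bits are kept, or overwritten by constants, according to `f`. -/
def overwrite (f : ι → Option Bool) (y : ι → Bool) (e : ι) : Bool := (f e).getD (y e)

/-- Coordinate `e` of the estimate has sign bit `s` and digit `l` of its absolute value equal to
one, and `e` is not an edge of the input graph `z`. -/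
def selected (X : BoolProgram ι ι) (z : ι → Bool) (l : ℕ) (s : Bool) (e : ι) : Bool :=
  (((X.output z e).getD 0 false == s) && (X.output z e).getD (l + 1) false) && !z e

/-- For some digit and sign, the number of selected edges and the number of those present in `y`
satisfy `P`. -/
def detects (X : BoolProgram ι ι) (P : ℕ → ℕ → Bool) (z y : ι → Bool) : Bool :=
  decide (∃ a ∈ Finset.range X.time ×ˢ (Finset.univ : Finset Bool),
    P (Finset.univ.filter fun e => selected X z a.1 a.2 e = true).card
      (Finset.univ.filter fun e => (selected X z a.1 a.2 e && y e) = true).card = true)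

theorem computableWithin_detects (X : BoolProgram ι ι) (P : ℕ → ℕ → Bool)
    (f : ι → Option Bool) (M : ℕ) (j : Fin M) :
    ComputableWithin [] (X.time * (200 * (Fintype.card ι + 1) ^ 2 + 8) + 1)
      fun y : Fin M × ι → Bool => detects X P (overwrite f fun e => y (j, e))
        (fun e => y (j, e)) := fun c₀ hc₀ => by
  -- The rule `f` is hard-wired into the relocated copy: overwritten inputs become constants, so
  -- degrading a sample adds no instructions.
  set r : ι → BoolInstr (Fin M × ι) := fun e =>
    match f e with
    | none => .input (j, e)
    | some b => .const b with hrdef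
  have hr : ∀ (y : Fin M × ι → Bool) e mem, (r e).value y mem =
      overwrite f (fun e => y (j, e)) e := by
    intro y e mem
    simp only [hrdef, overwrite]
    cases f e <;> rfl
  set c₁ := c₀ ++ X.code.map (BoolInstr.relocate r c₀.length) with hc₁
  have hout : ∀ e l, ComputableWithin c₁ 1 fun y : Fin M × ι → Bool =>
      (X.output (overwrite f fun e => y (j, e)) e).getD l false := by
    intro e l
    by_cases hl : l < (X.out e).length
    · refine (computableWithin_memory X hr c₀ (X.out e)[l]).congr fun y => ?_
      simp [BoolProgram.output, hl]
    · refine (computableWithin_const _ false).congr fun y => ?_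
      rw [List.getD_eq_default]
      simpa [BoolProgram.output] using hl
  have hin : ∀ e, ComputableWithin c₁ 1 fun y : Fin M × ι → Bool =>
      overwrite f (fun e => y (j, e)) e := by
    intro e
    simp only [overwrite]
    cases f e with
    | none => exact computableWithin_input _ _
    | some b => exact computableWithin_const _ _
  have hsel : ∀ l s e, ComputableWithin c₁ 10 fun y : Fin M × ι → Bool =>
      selected X (overwrite f fun e => y (j, e)) l s e := by
    intro l s e
    have hsign : ComputableWithin c₁ 2 fun y : Fin M × ι → Bool =>
        ((X.output (overwrite f fun e => y (j, e)) e).getD 0 false == s) := by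
      cases s with
      | true => exact ((hout e 0).mono (by norm_num)).congr fun y => by simp
      | false => exact ((hout e 0).not).congr fun y => by simp
    exact ((hsign.and (hout e (l + 1))).and (hin e).not).mono (by norm_num)
  have hhit : ∀ l s e, ComputableWithin c₁ 13 fun y : Fin M × ι → Bool =>
      selected X (overwrite f fun e => y (j, e)) l s e && y (j, e) := fun l s e =>
    ((hsel l s e).and (computableWithin_input _ _))
  have hall := computableWithin_exists (Finset.range X.time ×ˢ (Finset.univ : Finset Bool))
    (fun a _ => computableWithin_two_counts (c := c₁) (s := 13)
      (fun e => (hsel a.1 a.2 e).mono (by norm_num)) (fun e => hhit a.1 a.2 e) P)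
  obtain ⟨c₂, h1, h2, h3⟩ := hall c₁ List.prefix_rfl
  have hlen : X.code.length ≤ X.time := Nat.le_add_right _ _
  refine ⟨c₂, (List.prefix_append _ _).trans h1, ?_, h3⟩
  refine h2.trans ?_
  rw [hc₁, Finset.card_product, Finset.card_range, Finset.card_univ, Fintype.card_bool,
    List.length_append, List.length_map]
  generalize (Fintype.card ι + 1) ^ 2 = W
  nlinarith

/-- The detector applied to each of `M` samples, as one program. -/
theorem exists_detector (X : BoolProgram ι ι) (P : ℕ → ℕ → Bool) (f : ι → Option Bool) (M : ℕ) :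
    ∃ A : BoolProgram (Fin M × ι) Unit,
      A.time ≤ M * (X.time * (200 * (Fintype.card ι + 1) ^ 2 + 8) + 4) + 2 ∧
      ∀ y, A.accepts y = decide (∃ j : Fin M,
        detects X P (overwrite f fun e => y (j, e)) (fun e => y (j, e)) = true) := by
  obtain ⟨c, -, h2, i, -, hi⟩ := computableWithin_exists Finset.univ
    (fun j _ => computableWithin_detects X P f M j) [] List.prefix_rfl
  refine ⟨⟨c, fun _ => [i]⟩, ?_, fun y => ?_⟩
  · change c.length + ∑ _ : Unit, 1 ≤ _
    rw [Finset.sum_const, Finset.card_univ, Fintype.card_unit, smul_eq_mul, mul_one]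
    rw [Finset.card_univ, Fintype.card_fin, List.length_nil, add_assoc _ 1 3,
      show 1 + 3 = 4 from rfl] at h2
    omega
  · have hm : (BoolProgram.memory ⟨c, fun _ : Unit => [i]⟩ y).getD i false = _ := hi y
    simp only [BoolProgram.accepts, BoolProgram.output, List.map_cons, List.map_nil, hm]
    simp

end Detector

/-! ### Binary digits of a correlated vector -/

/-- Both geometric sums are dominated by their term nearest to the cutoff `a`. -/
theorem sum_pow_two_le {T : ℕ} {a : ℝ} (ha : 0 < a) :
    ∑ l ∈ Finset.range T with ¬ a ≤ 2 ^ l, (2 : ℝ) ^ l ≤ 2 * a ∧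
    ∑ l ∈ Finset.range T with a ≤ 2 ^ l, ((1 : ℝ) / 2) ^ l ≤ 2 / a := by
  have hex : ∃ l : ℕ, a ≤ 2 ^ l := by
    obtain ⟨l, hl⟩ := pow_unbounded_of_one_lt a (one_lt_two)
    exact ⟨l, hl.le⟩
  classical
  set m := Nat.find hex with hm
  have hm1 : a ≤ 2 ^ m := Nat.find_spec hex
  have hm2 : ∀ l, a ≤ 2 ^ l → m ≤ l := fun l hl => Nat.find_min' hex hl
  constructor
  · calc _ ≤ ∑ l ∈ Finset.range m, (2 : ℝ) ^ l := by
          refine Finset.sum_le_sum_of_subset_of_nonneg ?_ fun _ _ _ => by positivity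
          intro l hl
          rw [Finset.mem_filter] at hl
          rw [Finset.mem_range]
          by_contra hc
          refine hl.2 (hm1.trans (pow_le_pow_right₀ (by norm_num) (not_lt.1 hc)))
      _ ≤ 2 * a := by
          rcases Nat.eq_zero_or_pos m with h0 | h0
          · rw [h0]; simp; exact ha.le
          · have h1 : ¬ a ≤ 2 ^ (m - 1) := fun h => by have := hm2 _ h; omega
            rw [geom_sum_eq (by norm_num)]
            have h2 : (2 : ℝ) ^ m = 2 * 2 ^ (m - 1) := by
              rw [← pow_succ']; congr 1; omega
            rw [h2]
            linarith [not_le.1 h1]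
  · calc _ ≤ ∑ l ∈ Finset.Ico m T, ((1 : ℝ) / 2) ^ l := by
          refine Finset.sum_le_sum_of_subset_of_nonneg ?_ fun _ _ _ => by positivity
          intro l hl
          rw [Finset.mem_filter, Finset.mem_range] at hl
          exact Finset.mem_Ico.2 ⟨hm2 l hl.2, hl.1⟩
      _ ≤ (1 / 2) ^ m / (1 - 1 / 2) := geom_sum_Ico_le_of_lt_one (by norm_num) (by norm_num)
      _ ≤ 2 / a := by
          rw [one_div_pow]
          have : 1 / (2 : ℝ) ^ m ≤ 1 / a := one_div_le_one_div_of_le ha hm1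
          calc _ = 2 * (1 / (2 : ℝ) ^ m) := by ring
            _ ≤ 2 * (1 / a) := by gcongr
            _ = _ := by ring

/-- If `x` correlates with a bounded vector `θ`, then so does one of its signed digit vectors. -/
theorem exists_digit_correlated {E : Type} [Fintype E] {T : ℕ} {x θ ε : E → ℝ} {δ : ℕ → E → ℝ}
    {c H : ℝ} (hε : ∀ e, |ε e| = 1) (hδ : ∀ l e, δ l e = 0 ∨ δ l e = 1)
    (hx : ∀ e, x e = ε e * ∑ l ∈ Finset.range T, 2 ^ l * δ l e) (hθ : ∀ e, |θ e| ≤ H)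
    (hc : 0 < c) (hcorr : c ≤ correlation x θ) :
    ∃ l < T, c ^ 2 * (∑ e, θ e ^ 2) / (32 * H) ≤ |∑ e, ε e * δ l e * θ e| := by
  set N := √(∑ e, x e ^ 2) with hN
  set R := √(∑ e, θ e ^ 2) with hR
  have hR2 : R ^ 2 = ∑ e, θ e ^ 2 := Real.sq_sqrt (Finset.sum_nonneg fun _ _ => sq_nonneg _)
  have hN2 : N ^ 2 = ∑ e, x e ^ 2 := Real.sq_sqrt (Finset.sum_nonneg fun _ _ => sq_nonneg _)
  have hcorr' : c ≤ (∑ e, x e * θ e) / (N * R) := hcorr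
  have hNR : N * R ≠ 0 := fun h => by rw [h, div_zero] at hcorr'; linarith
  have hNpos : 0 < N := lt_of_le_of_ne (Real.sqrt_nonneg _) fun h => hNR (by rw [← h, zero_mul])
  have hRpos : 0 < R := lt_of_le_of_ne (Real.sqrt_nonneg _) fun h => hNR (by rw [← h, mul_zero])
  rw [le_div_iff₀ (by positivity)] at hcorr'
  have hH : 0 < H := by
    by_contra hH
    have : ∑ e, θ e ^ 2 = 0 := Finset.sum_eq_zero fun e _ => by
      have h1 := hθ e
      have h2 : θ e = 0 := abs_nonpos_iff.1 (h1.trans (not_lt.1 hH))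
      simp [h2]
    rw [this] at hR2
    exact hRpos.ne' (by simpa using hR2)
  have hsum : ∑ e, x e * θ e = ∑ l ∈ Finset.range T, 2 ^ l * ∑ e, ε e * δ l e * θ e := by
    simp only [Finset.mul_sum]
    rw [Finset.sum_comm]
    refine Finset.sum_congr rfl fun e _ => ?_
    rw [hx, Finset.mul_sum, Finset.sum_mul]
    exact Finset.sum_congr rfl fun l _ => by ring
  have hδ0 : ∀ l e, 0 ≤ δ l e := fun l e => by rcases hδ l e with h | h <;> simp [h]
  -- A coordinate with digit `l` equal to one has `|x e| ≥ 2^l`, so there are at most `N² / 4^l` of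
  -- them.
  have hcount : ∀ l < T, ∑ e, δ l e * 4 ^ l ≤ N ^ 2 := by
    intro l hl
    rw [hN2]
    refine Finset.sum_le_sum fun e _ => ?_
    have h1 : 2 ^ l * δ l e ≤ ∑ l ∈ Finset.range T, 2 ^ l * δ l e :=
      Finset.single_le_sum (f := fun l => 2 ^ l * δ l e)
        (fun i _ => mul_nonneg (by positivity) (hδ0 i e)) (Finset.mem_range.2 hl)
    have h2 : x e ^ 2 = (∑ l ∈ Finset.range T, 2 ^ l * δ l e) ^ 2 := by
      rw [hx, mul_pow, ← sq_abs (ε e), hε, one_pow, one_mul]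
    rw [h2]
    refine le_trans (le_of_eq ?_) (pow_le_pow_left₀ (mul_nonneg (by positivity) (hδ0 l e)) h1 2)
    have h4 : (4 : ℝ) ^ l = (2 ^ l) ^ 2 := by rw [← pow_mul, mul_comm, pow_mul]; norm_num
    rw [h4]
    rcases hδ l e with h | h <;> rw [h] <;> ring
  have hupper : ∀ l < T, 2 ^ l * |∑ e, ε e * δ l e * θ e| ≤ H * N ^ 2 * (1 / 2) ^ l := by
    intro l hl
    have h1 : |∑ e, ε e * δ l e * θ e| ≤ H * ∑ e, δ l e := by
      rw [Finset.mul_sum]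
      refine (Finset.abs_sum_le_sum_abs _ _).trans (Finset.sum_le_sum fun e _ => ?_)
      rw [abs_mul, abs_mul, hε, one_mul, abs_of_nonneg (hδ0 l e), mul_comm]
      exact mul_le_mul_of_nonneg_right (hθ e) (hδ0 l e)
    have h2 := hcount l hl
    rw [← Finset.sum_mul] at h2
    have h4 : (4 : ℝ) ^ l = 2 ^ l * 2 ^ l := by rw [← mul_pow]; norm_num
    rw [h4] at h2
    have h5 : (2 : ℝ) ^ l * (1 / 2) ^ l = 1 := by rw [← mul_pow]; norm_num
    have h6 : 0 ≤ ((1 : ℝ) / 2) ^ l := by positivity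
    calc 2 ^ l * |∑ e, ε e * δ l e * θ e| ≤ 2 ^ l * (H * ∑ e, δ l e) := by gcongr
      _ = H * ((∑ e, δ l e) * (2 ^ l * 2 ^ l)) * (1 / 2) ^ l := by
          linear_combination (-(2 ^ l) * H * ∑ e, δ l e) * h5
      _ ≤ H * N ^ 2 * (1 / 2) ^ l := by gcongr
  by_contra hcon
  push Not at hcon
  rw [← hR2] at hcon
  set t := c ^ 2 * R ^ 2 / (32 * H) with ht
  -- Cutoff between low and high digits. High digits are sparse and contribute at most `c N R / 2`;
  -- if every digit correlated less than `t`, the low ones would contribute at most `c N R / 4`, and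
  -- the total would fall short of `c N R`.
  set a := 4 * N * H / (c * R) with ha
  have ha0 : 0 < a := by positivity
  obtain ⟨hlow, hhigh⟩ := sum_pow_two_le (T := T) ha0
  have ht0 : 0 ≤ t := by positivity
  have hfin : ∑ e, x e * θ e ≤ t * (2 * a) + H * N ^ 2 * (2 / a) := by
    rw [hsum, ← Finset.sum_filter_not_add_sum_filter (Finset.range T) (fun l => a ≤ 2 ^ l)]
    refine add_le_add ?_ ?_
    · refine le_trans ?_ (mul_le_mul_of_nonneg_left hlow ht0)
      rw [Finset.mul_sum]
      refine Finset.sum_le_sum fun l hl => ?_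
      rw [mul_comm]
      refine mul_le_mul_of_nonneg_right ((le_abs_self _).trans ?_) (by positivity)
      exact (hcon l (Finset.mem_range.1 (Finset.mem_filter.1 hl).1)).le
    · refine le_trans ?_ (mul_le_mul_of_nonneg_left hhigh (by positivity))
      rw [Finset.mul_sum]
      refine Finset.sum_le_sum fun l hl => ?_
      refine le_trans ?_ (hupper l (Finset.mem_range.1 (Finset.mem_filter.1 hl).1))
      exact mul_le_mul_of_nonneg_left (le_abs_self _) (by positivity)
  have e1 : t * (2 * a) = c * N * R / 4 := by
    rw [ht, ha]; field_simp; ring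
  have e2 : H * N ^ 2 * (2 / a) = c * N * R / 2 := by
    rw [ha]; field_simp; ring
  rw [e1, e2] at hfin
  have : 0 < c * N * R := by positivity
  linarith

theorem ofDigits_map_toNat (bs : List Bool) (T : ℕ) (hT : bs.length ≤ T) :
    ((Nat.ofDigits 2 (bs.map Bool.toNat) : ℕ) : ℝ) =
      ∑ l ∈ Finset.range T, 2 ^ l * (if bs.getD l false then 1 else 0 : ℝ) := by
  induction bs generalizing T with
  | nil => simp
  | cons b bs ih =>
    obtain ⟨T, rfl⟩ : ∃ T', T = T' + 1 := ⟨T - 1, by simp at hT; omega⟩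
    rw [List.map_cons, Nat.ofDigits_cons, Finset.sum_range_succ']
    rw [Nat.cast_add, Nat.cast_mul, ih T (by simpa using hT), Finset.mul_sum, add_comm]
    congr 1
    · refine Finset.sum_congr rfl fun l _ => ?_
      rw [List.getD_cons_succ, pow_succ]
      push_cast
      ring
    · cases b <;> simp

/-- Digit `l` sits at position `l + 1`, after the sign bit, hence the length bound `T + 1`. Missing
positions read as `false`, which also covers the empty string. -/
theorem decodeInt_eq_sum (L : List Bool) (T : ℕ) (hT : L.length ≤ T + 1) :
    (decodeInt L : ℝ) = (if L.getD 0 false then -1 else 1) *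
      ∑ l ∈ Finset.range T, 2 ^ l * (if L.getD (l + 1) false then 1 else 0 : ℝ) := by
  cases L with
  | nil => simp [decodeInt]
  | cons s bs =>
    have := ofDigits_map_toNat bs T (by simpa using hT)
    simp only [List.getD_cons_succ, List.getD_cons_zero]
    rw [← this]
    have h : Nat.ofDigits (2 : ℤ) (bs.map Bool.toNat) =
        ((Nat.ofDigits 2 (bs.map Bool.toNat) : ℕ) : ℤ) := by
      exact (Nat.coe_ofDigits ℤ 2 _).symm
    simp only [decodeInt, h, Int.cast_mul, Int.cast_natCast]
    cases s <;> simp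

/-! ### The edge kernel as a signal -/

theorem abs_edgeKernel_le {n q : ℕ} (hq : 2 ≤ q) (σ : Fin n → Fin q) (e : Pair n) :
    |edgeKernel n q σ e| ≤ q - 1 := by
  have : (2 : ℝ) ≤ q := by exact_mod_cast hq
  unfold edgeKernel communityKernel
  rw [abs_le]
  split_ifs <;> constructor <;> linarith

theorem sum_communityKernel_nonneg {n q : ℕ} (hq : q ≠ 0) (σ : Fin n → Fin q) :
    0 ≤ ∑ i, ∑ j, communityKernel q (σ i) (σ j) := by
  have : ∑ i, ∑ j, communityKernel q (σ i) (σ j) =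
      q * ∑ a, (∑ i, centredIndicator q (σ i) a) ^ 2 := by
    have hsq : ∀ a, (∑ i, centredIndicator q (σ i) a) ^ 2 =
        ∑ i, ∑ j, centredIndicator q (σ i) a * centredIndicator q (σ j) a := fun a => by
      rw [sq, Finset.sum_mul_sum]
    simp only [← sum_centredIndicator_sq hq, hsq, Finset.mul_sum]
    symm
    rw [Finset.sum_comm]
    refine Finset.sum_congr rfl fun i _ => ?_
    rw [Finset.sum_comm]
  rw [this]
  exact mul_nonneg (Nat.cast_nonneg q) (Finset.sum_nonneg fun _ _ => sq_nonneg _)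

theorem two_mul_card_pair (n : ℕ) : 2 * (Fintype.card (Pair n) : ℝ) = n * (n - 1) := by
  have := sum_sum_eq_two_mul_sum_pair (n := n) (fun _ _ => 1) (fun _ _ => rfl)
  simp only [Finset.sum_const, Finset.card_univ, Fintype.card_fin, nsmul_eq_mul, mul_one] at this
  linarith

theorem card_pair_le (n : ℕ) : (Fintype.card (Pair n) : ℝ) ≤ n ^ 2 := by
  have := two_mul_card_pair n
  have h : (0 : ℝ) ≤ n := Nat.cast_nonneg n
  nlinarith

/-- The kernel takes only the values `q - 1` and `-1`, so its square is an affine function of it.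
Positive semidefiniteness of the full kernel matrix bounds the edge sum from below by `-n (q - 1) /
2`, a lower-order loss when `2 q ≤ n`. -/
theorem sum_edgeKernel_sq_ge {n q : ℕ} (hq : 2 ≤ q) (hn : 2 * q ≤ n) (σ : Fin n → Fin q) :
    ((q : ℝ) - 1) * n ^ 2 / 4 ≤ ∑ e, edgeKernel n q σ e ^ 2 := by
  have hq' : (2 : ℝ) ≤ q := by exact_mod_cast hq
  have hn' : 2 * (q : ℝ) ≤ n := by exact_mod_cast hn
  have h1 : ∀ e, edgeKernel n q σ e ^ 2 = (q - 2) * edgeKernel n q σ e + (q - 1) := by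
    intro e
    unfold edgeKernel communityKernel
    split_ifs <;> ring
  have h2 := sum_communityKernel_nonneg (by omega : q ≠ 0) σ
  rw [sum_sum_eq_two_mul_sum_pair _ (fun i j => communityKernel_comm _ _)] at h2
  simp only [communityKernel_self, Finset.sum_const, Finset.card_univ, Fintype.card_fin,
    nsmul_eq_mul] at h2
  change 0 ≤ 2 * ∑ e, edgeKernel n q σ e + _ at h2
  simp only [h1, Finset.sum_add_distrib, ← Finset.mul_sum, Finset.sum_const, Finset.card_univ,
    nsmul_eq_mul]
  have h3 := two_mul_card_pair n
  set S := ∑ e, edgeKernel n q σ e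
  have h4 : ((q : ℝ) - 2) * (-(n * (q - 1))) ≤ (q - 2) * (2 * S) :=
    mul_le_mul_of_nonneg_left (by linarith) (by linarith)
  have h5 : 0 ≤ ((q : ℝ) - 1) * n * (n - 2 * q) :=
    mul_nonneg (mul_nonneg (by linarith) (by linarith)) (by linarith)
  have h6 : 0 ≤ ((q : ℝ) - 1) * n := mul_nonneg (by linarith) (by linarith)
  have h7 : 2 * ((Fintype.card (Pair n) : ℝ) * ((q : ℝ) - 1)) = n * (n - 1) * (q - 1) := by
    rw [← h3]; ring
  nlinarith

/-- The signed digit set of an estimate, without removing observed edges. -/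
def digitSet {ι : Type} (X : BoolProgram ι ι) (z : ι → Bool) (l : ℕ) (s : Bool) (e : ι) : Bool :=
  ((X.output z e).getD 0 false == s) && (X.output z e).getD (l + 1) false

theorem correlation_sbmSignal {n q : ℕ} {d lam : ℝ} (h : 0 < lam * d / n) (x : Pair n → ℝ)
    (σ : Fin n → Fin q) :
    correlation x (sbmSignal n q d lam σ) = correlation x (edgeKernel n q σ) := by
  unfold correlation
  simp only [sbmSignal_eq, mul_pow, ← Finset.mul_sum, mul_left_comm _ (lam * d / n)]
  rw [Real.sqrt_mul (by positivity), Real.sqrt_sq h.le, mul_left_comm (√_), mul_div_mul_left _ _ h.ne']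

/-- The test counts edges on a set, so the integer-valued estimate is replaced by a set of pairs.
The best digit has signed correlation at least `c² n² / 128`, and one of its two signs carries half
of it. -/
theorem exists_digitSet_large {n q : ℕ} (hq : 2 ≤ q) (hn : 2 * q ≤ n) {d lam c : ℝ}
    (h : 0 < lam * d / n) (hc : 0 < c) (X : BoolProgram (Pair n) (Pair n)) (z : Pair n → Bool)
    (σ : Fin n → Fin q) (hcorr : c ≤ correlation (X.vector z) (sbmSignal n q d lam σ)) :
    ∃ l < X.time, ∃ s : Bool, c ^ 2 * n ^ 2 / 256 ≤
      |∑ e, if digitSet X z l s e then edgeKernel n q σ e else 0| := by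
  rw [correlation_sbmSignal h] at hcorr
  have hq' : (2 : ℝ) ≤ q := by exact_mod_cast hq
  have hlen : ∀ e, (X.output z e).length ≤ X.time + 1 := by
    intro e
    have : (X.out e).length ≤ ∑ o, (X.out o).length :=
      Finset.single_le_sum (f := fun o => (X.out o).length) (fun _ _ => Nat.zero_le _)
        (Finset.mem_univ e)
    rw [BoolProgram.output, List.length_map, BoolProgram.time]
    omega
  obtain ⟨l, hl, hbig⟩ := exists_digit_correlated (T := X.time) (x := X.vector z)
    (θ := edgeKernel n q σ) (ε := fun e => if (X.output z e).getD 0 false then -1 else 1)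
    (δ := fun l e => if (X.output z e).getD (l + 1) false then 1 else 0) (c := c) (H := q - 1)
    (fun e => by split_ifs <;> simp)
    (fun l e => by split_ifs <;> simp)
    (fun e => decodeInt_eq_sum _ _ (hlen e)) (abs_edgeKernel_le hq σ) hc hcorr
  refine ⟨l, hl, ?_⟩
  have h1 := sum_edgeKernel_sq_ge hq hn σ
  have h2 : c ^ 2 * n ^ 2 / 128 ≤ c ^ 2 * (∑ e, edgeKernel n q σ e ^ 2) / (32 * (q - 1)) := by
    rw [le_div_iff₀ (by linarith)]
    have := mul_le_mul_of_nonneg_left h1 (sq_nonneg c)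
    nlinarith
  have h3 := h2.trans hbig
  have h4 : ∑ e, (if (X.output z e).getD 0 false then -1 else 1) *
      (if (X.output z e).getD (l + 1) false then 1 else 0) * edgeKernel n q σ e =
      (∑ e, if digitSet X z l false e then edgeKernel n q σ e else 0) -
      ∑ e, if digitSet X z l true e then edgeKernel n q σ e else 0 := by
    rw [← Finset.sum_sub_distrib]
    refine Finset.sum_congr rfl fun e _ => ?_
    unfold digitSet
    cases (X.output z e).getD 0 false <;> cases (X.output z e).getD (l + 1) false <;> simp
  rw [h4] at h3
  by_contra hcon
  push Not at hcon
  have h5 := hcon true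
  have h6 := hcon false
  have h7 := abs_sub (∑ e, if digitSet X z l false e then edgeKernel n q σ e else 0)
    (∑ e, if digitSet X z l true e then edgeKernel n q σ e else 0)
  linarith

/-! ### A random channel on bits, and exponential bounds for its posterior -/

noncomputable section

/-- The law of the overwriting rule: keep the bit with probability `a`, replace it by `true` with
probability `b`, and by `false` otherwise. -/
def ruleMass (a b : ℝ) : Option Bool → ℝ
  | none => a
  | some true => b
  | some false => 1 - a - b

/-- Transition probabilities of the channel that applies a random rule. -/
def channel (a b : ℝ) (y z : Bool) : ℝ :=
  if z then (if y then a + b else b) else 1 - (if y then a + b else b)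

/-- Joint law of a Bernoulli bit and its image under the channel. -/
def jointMass (a b r : ℝ) (z y : Bool) : ℝ := bernoulliMass r y * channel a b y z

/-- Probability that the input bit is `true` given that the output bit is `false`. -/
def posterior (a b r : ℝ) : ℝ := (1 - a - b) * r / (1 - b - a * r)

end

theorem ruleMass_nonneg {a b : ℝ} (ha : 0 ≤ a) (hb : 0 ≤ b) (hab : a + b ≤ 1) (o : Option Bool) :
    0 ≤ ruleMass a b o := by
  rcases o with _ | _ | _ <;> simp only [ruleMass] <;> linarith

theorem sum_ruleMass (a b : ℝ) : ∑ o, ruleMass a b o = 1 := by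
  rw [Fintype.sum_option, Fintype.sum_bool]
  simp only [ruleMass]
  ring

theorem channel_nonneg {a b : ℝ} (ha : 0 ≤ a) (hb : 0 ≤ b) (hab : a + b ≤ 1) (y z : Bool) :
    0 ≤ channel a b y z := by
  cases y <;> cases z <;> simp [channel] <;> linarith

theorem channel_eq_sum (a b : ℝ) (y z : Bool) :
    channel a b y z = ∑ o, ruleMass a b o * (if o.getD y = z then 1 else 0) := by
  rw [Fintype.sum_option, Fintype.sum_bool]
  cases y <;> cases z <;> simp [channel, ruleMass] <;> ring

/-- The randomness of the channel is moved into a rule drawn independently of `y`. Such a rule can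
later be fixed, since programs are deterministic but may depend on `k`. -/
theorem sum_rules_eq_sum_channel {ι : Type} [Fintype ι] [DecidableEq ι] (a b : ℝ)
    (y : ι → Bool) (G : (ι → Bool) → ℝ) :
    ∑ f : ι → Option Bool, (∏ e, ruleMass a b (f e)) * G (overwrite f y) =
      ∑ z : ι → Bool, (∏ e, channel a b (y e) (z e)) * G z := by
  have h1 : ∀ z : ι → Bool, ∏ e, channel a b (y e) (z e) =
      ∑ f : ι → Option Bool, (∏ e, ruleMass a b (f e)) * (if z = overwrite f y then 1 else 0) := by
    intro z
    simp only [channel_eq_sum]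
    rw [Fintype.prod_sum]
    refine Finset.sum_congr rfl fun f _ => ?_
    rw [Finset.prod_mul_distrib, Finset.prod_boole]
    congr 2
    refine propext ⟨fun h => funext fun e => (h e (Finset.mem_univ e)).symm, fun h e _ => ?_⟩
    rw [h]; rfl
  simp only [h1, Finset.sum_mul]
  rw [Finset.sum_comm]
  refine Finset.sum_congr rfl fun f _ => ?_
  simp only [mul_assoc, ← Finset.mul_sum, ite_mul, one_mul, zero_mul, Finset.sum_ite_eq',
    Finset.mem_univ, if_true]

theorem jointMass_nonneg {a b : ℝ} (ha : 0 ≤ a) (hb : 0 ≤ b) (hab : a + b ≤ 1) (r : ℝ)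
    (z y : Bool) : 0 ≤ jointMass a b r z y :=
  mul_nonneg (bernoulliMass_nonneg _ _) (channel_nonneg ha hb hab _ _)

theorem sum_jointMass {a b r : ℝ} (ha : 0 ≤ a) (hb : 0 ≤ b) (hab : a + b ≤ 1) (h0 : 0 ≤ r)
    (h1 : r ≤ 1) (z : Bool) : ∑ y, jointMass a b r z y = bernoulliMass (b + a * r) z := by
  have h2 : 0 ≤ b + a * r := by positivity
  have h3 : b + a * r ≤ 1 := by nlinarith
  rw [Fintype.sum_bool]
  cases z
  · simp only [jointMass, bernoulliMass_true h0 h1, bernoulliMass_false h0 h1, channel,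
      bernoulliMass_false h2 h3]
    simp
    ring
  · simp only [jointMass, bernoulliMass_true h0 h1, bernoulliMass_false h0 h1, channel,
      bernoulliMass_true h2 h3]
    simp
    ring

theorem posterior_denominator_ge {a b r : ℝ} (ha : 0 ≤ a) (h1 : r ≤ 1) :
    1 - a - b ≤ 1 - b - a * r := by nlinarith

theorem posterior_nonneg {a b r : ℝ} (ha : 0 ≤ a) (hab : a + b < 1) (h0 : 0 ≤ r)
    (h1 : r ≤ 1) : 0 ≤ posterior a b r :=
  div_nonneg (mul_nonneg (by linarith) h0)
    (by linarith [posterior_denominator_ge (b := b) ha h1])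

theorem posterior_le {a b r : ℝ} (ha : 0 ≤ a) (hab : a + b < 1) (h0 : 0 ≤ r)
    (h1 : r ≤ 1) : posterior a b r ≤ r := by
  have h := posterior_denominator_ge (b := b) ha h1
  rw [posterior, div_le_iff₀ (by linarith), mul_comm r]
  exact mul_le_mul_of_nonneg_right h h0

theorem posterior_mul {a b r : ℝ} (ha : 0 ≤ a) (hab : a + b < 1) (h0 : 0 ≤ r) (h1 : r ≤ 1) :
    posterior a b r * (jointMass a b r false true + jointMass a b r false false) =
      jointMass a b r false true := by
  have h := posterior_denominator_ge (b := b) ha h1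
  have h2 : 1 - b - a * r ≠ 0 := by linarith
  simp only [jointMass, bernoulliMass_true h0 h1, bernoulliMass_false h0 h1, channel]
  simp only [Bool.false_eq_true, if_false, if_true]
  have e : r * (1 - (a + b)) + (1 - r) * (1 - b) = 1 - b - a * r := by ring
  rw [e, posterior, div_mul_cancel₀ _ h2]
  ring

/-- The posterior depends almost linearly on the prior. -/
theorem abs_posterior_sub_le {a b κ r r₀ m : ℝ} (ha : 0 ≤ a) (hb : 0 ≤ b) (hκ : 0 < κ)
    (hab : a + b ≤ 1 - κ) (hr : 0 ≤ r) (hrm : r ≤ m) (hr₀ : 0 ≤ r₀) (hr₀m : r₀ ≤ m)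
    (hm : m ≤ 1) :
    |posterior a b r - posterior a b r₀ - (1 - a - b) / (1 - b) * (r - r₀)| ≤
      2 * m / κ * |r - r₀| := by
  have h1 := posterior_denominator_ge (b := b) ha (hrm.trans hm)
  have h2 := posterior_denominator_ge (b := b) ha (hr₀m.trans hm)
  set u := 1 - b - a * r with hu
  set v := 1 - b - a * r₀ with hv
  set k₁ := 1 - a - b with hk₁
  set k₀ := 1 - b with hk₀
  have hk1 : κ ≤ k₁ := by linarith
  have hk1p : 0 < k₁ := by linarith
  have hup : 0 < u := by linarith
  have hvp : 0 < v := by linarith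
  have hk0p : 0 < k₀ := by linarith
  -- `k₁ / k₀` is the derivative of the posterior at prior zero, and the remainder is quadratic in
  -- the priors.
  have key : posterior a b r - posterior a b r₀ - k₁ / k₀ * (r - r₀) =
      (k₁ * a * (k₀ * r + k₀ * r₀ - a * r * r₀) / (k₀ * u * v)) * (r - r₀) := by
    rw [posterior, posterior, ← hu, ← hv, ← hk₁]
    field_simp
    rw [hu, hv]
    ring
  rw [key, abs_mul]
  refine mul_le_mul_of_nonneg_right ?_ (abs_nonneg _)
  have hu0 : 0 ≤ k₀ * r + k₀ * r₀ - a * r * r₀ := by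
    have : a * r * r₀ ≤ k₀ * r₀ := by
      refine mul_le_mul_of_nonneg_right ?_ hr₀
      nlinarith
    nlinarith [mul_nonneg hk0p.le hr]
  rw [abs_of_nonneg (by positivity), div_le_div_iff₀ (by positivity) hκ]
  have hnum : k₀ * r + k₀ * r₀ - a * r * r₀ ≤ k₀ * (2 * m) := by
    have : 0 ≤ a * r * r₀ := by positivity
    nlinarith
  have ha1 : a ≤ 1 := by linarith
  have hden : k₁ * κ ≤ u * v := by
    have hv' : κ ≤ v := by linarith
    exact mul_le_mul h1 hv' hκ.le hup.le
  have hm0 : 0 ≤ m := hr.trans hrm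
  calc k₁ * a * (k₀ * r + k₀ * r₀ - a * r * r₀) * κ
      ≤ k₁ * 1 * (k₀ * (2 * m)) * κ := by gcongr
    _ = 2 * m * k₀ * (k₁ * κ) := by ring
    _ ≤ 2 * m * k₀ * (u * v) := by gcongr
    _ = 2 * m * (k₀ * u * v) := by ring

/-- If `s` and `t` are the masses of the values one and zero of a bit `Y` and `p` is the conditional
probability of one, the claim is that `exp(h (Y - p) - p h²)` has mean at most one. It follows from
`e^h ≤ 1 + h + h²` for `|h| ≤ 1`. The correction is proportional to `p`, as sparse graphs require.
-/
theorem exp_bound_bernoulli {s t p h : ℝ} (hs : 0 ≤ s) (ht : 0 ≤ t) (hp : 0 ≤ p)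
    (hps : p * (s + t) = s) (hh : |h| ≤ 1) :
    s * Real.exp (h * (1 - p) - p * h ^ 2) + t * Real.exp (h * (0 - p) - p * h ^ 2) ≤ s + t := by
  have h1 : Real.exp h - 1 - h ≤ h ^ 2 := (abs_le.1 (Real.abs_exp_sub_one_sub_id_le hh)).2
  have e1 : s * Real.exp (h * (1 - p) - p * h ^ 2) + t * Real.exp (h * (0 - p) - p * h ^ 2) =
      (s + t) * ((1 + p * (Real.exp h - 1)) * Real.exp (-(p * h) - p * h ^ 2)) := by
    have : h * (1 - p) - p * h ^ 2 = h + (-(p * h) - p * h ^ 2) := by ring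
    have h2 : h * (0 - p) - p * h ^ 2 = -(p * h) - p * h ^ 2 := by ring
    rw [this, h2, Real.exp_add]
    linear_combination (-(Real.exp h - 1) * Real.exp (-(p * h) - p * h ^ 2)) * hps
  rw [e1]
  refine mul_le_of_le_one_right (by linarith) ?_
  have h2 : 1 + p * (Real.exp h - 1) ≤ Real.exp (p * h + p * h ^ 2) := by
    have h3 := Real.add_one_le_exp (p * (Real.exp h - 1))
    have h4 : p * (Real.exp h - 1) ≤ p * h + p * h ^ 2 := by nlinarith
    linarith [Real.exp_le_exp.2 h4]
  calc _ ≤ Real.exp (p * h + p * h ^ 2) * Real.exp (-(p * h) - p * h ^ 2) := by gcongr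
    _ = 1 := by rw [← Real.exp_add]; simp

/-- Exponential Markov inequality for the input bits given the output bits of the channel. -/
theorem sum_jointMass_indicator_le {ι : Type} [Fintype ι] [DecidableEq ι] {a b : ℝ} {r : ι → ℝ}
    (ha : 0 ≤ a) (hb : 0 ≤ b) (hab : a + b < 1) (h0 : ∀ e, 0 ≤ r e) (h1 : ∀ e, r e ≤ 1)
    (z B : ι → Bool) (hB : ∀ e, B e = true → z e = false) {h K : ℝ} (hh : |h| ≤ 1)
    {S : (ι → Bool) → Prop} [DecidablePred S]
    (hS : ∀ y, S y → K ≤ ∑ e, if B e then h * ((if y e then 1 else 0) - posterior a b (r e)) -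
      posterior a b (r e) * h ^ 2 else 0) :
    ∑ y : ι → Bool, (∏ e, jointMass a b (r e) (z e) (y e)) * (if S y then 1 else 0) ≤
      Real.exp (-K) * ∏ e, bernoulliMass (b + a * r e) (z e) := by
  have hJ := jointMass_nonneg ha hb hab.le
  set g : ι → Bool → ℝ := fun e x => if B e then h * ((if x then 1 else 0) - posterior a b (r e)) -
      posterior a b (r e) * h ^ 2 else 0 with hg
  calc _ ≤ ∑ y : ι → Bool, Real.exp (-K) *
        ∏ e, (jointMass a b (r e) (z e) (y e) * Real.exp (g e (y e))) := by
        refine Finset.sum_le_sum fun y _ => ?_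
        rw [Finset.prod_mul_distrib, ← Real.exp_sum, mul_left_comm]
        refine mul_le_mul_of_nonneg_left ?_ (Finset.prod_nonneg fun e _ => hJ _ _ _)
        rw [← Real.exp_add]
        split_ifs with hy
        · rw [Real.one_le_exp_iff]
          have := hS y hy
          linarith
        · positivity
    _ = Real.exp (-K) * ∏ e, ∑ x, jointMass a b (r e) (z e) x * Real.exp (g e x) := by
        rw [← Finset.mul_sum, Fintype.prod_sum]
    _ ≤ _ := by
        refine mul_le_mul_of_nonneg_left (Finset.prod_le_prod (fun e _ =>
          Finset.sum_nonneg fun x _ => mul_nonneg (hJ _ _ _) (Real.exp_pos _).le)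
          fun e _ => ?_) (Real.exp_pos _).le
        rw [← sum_jointMass ha hb hab.le (h0 e) (h1 e), Fintype.sum_bool, Fintype.sum_bool]
        by_cases hBe : B e = true
        · rw [hB e hBe]
          simp only [hg, hBe, if_true, Bool.false_eq_true, if_false]
          exact exp_bound_bernoulli (hJ _ _ _) (hJ _ _ _) (posterior_nonneg ha hab (h0 e) (h1 e))
            (posterior_mul ha hab (h0 e) (h1 e)) hh
        · simp [hg, hBe]

/-! ### Error probabilities of the detector -/

noncomputable section

/-- Two-sided test for an atypical number `v` of hits among `u` Bernoulli bits of parameter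
`p`. -/
def tailTest (p h K : ℝ) (u v : ℕ) : Bool :=
  decide (K ≤ h * (v - p * u) - u * (p * h ^ 2) ∨ K ≤ -h * (v - p * u) - u * (p * h ^ 2))

end

theorem sum_selected_eq {ι : Type} [Fintype ι] (B y : ι → Bool) (h p : ℝ) :
    ∑ e, (if B e then h * ((if y e then 1 else 0) - p) - p * h ^ 2 else 0) =
      h * (((Finset.univ.filter fun e => (B e && y e) = true).card : ℝ) -
        p * (Finset.univ.filter fun e => B e = true).card) -
        (Finset.univ.filter fun e => B e = true).card * (p * h ^ 2) := by
  rw [Finset.natCast_card_filter, Finset.natCast_card_filter, Finset.mul_sum, Finset.sum_mul,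
    ← Finset.sum_sub_distrib, Finset.mul_sum, ← Finset.sum_sub_distrib]
  refine Finset.sum_congr rfl fun e _ => ?_
  cases B e <;> cases y e <;> simp

theorem selected_eq {ι : Type} (X : BoolProgram ι ι) (z : ι → Bool) (l : ℕ) (s : Bool) (e : ι) :
    selected X z l s e = (digitSet X z l s e && !z e) := rfl

theorem eq_false_of_selected {ι : Type} {X : BoolProgram ι ι} {z : ι → Bool} {l : ℕ} {s : Bool} {e : ι}
    (h : selected X z l s e = true) : z e = false := by
  rw [selected_eq] at h
  cases hz : z e
  · rfl
  · simp [hz] at h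

section Abstract

variable {ι : Type} [Fintype ι] [DecidableEq ι]

/-- Averaging over random overwriting rules. -/
theorem sum_rules_expect (a b : ℝ) (r : ι → ℝ) (G : (ι → Bool) → (ι → Bool) → ℝ) :
    ∑ f : ι → Option Bool, (∏ e, ruleMass a b (f e)) *
      expect (fun y => ∏ e, bernoulliMass (r e) (y e)) (fun y => G (overwrite f y) y) =
    ∑ z : ι → Bool, ∑ y : ι → Bool, (∏ e, jointMass a b (r e) (z e) (y e)) * G z y := by
  simp only [expect, Finset.mul_sum]
  rw [Finset.sum_comm]
  conv_rhs => rw [Finset.sum_comm]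
  refine Finset.sum_congr rfl fun y _ => ?_
  have h := sum_rules_eq_sum_channel a b y (fun z => G z y)
  calc _ = (∏ e, bernoulliMass (r e) (y e)) *
        ∑ f : ι → Option Bool, (∏ e, ruleMass a b (f e)) * G (overwrite f y) y := by
        rw [Finset.mul_sum]
        exact Finset.sum_congr rfl fun f _ => by ring
    _ = _ := by
        rw [h, Finset.mul_sum]
        refine Finset.sum_congr rfl fun z _ => ?_
        simp only [jointMass, Finset.prod_mul_distrib]
        ring

/-- False positives. -/
theorem sum_jointMass_detects_le {a b r h K : ℝ} (ha : 0 ≤ a) (hb : 0 ≤ b) (hab : a + b < 1)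
    (h0 : 0 ≤ r) (h1 : r ≤ 1) (hh : |h| ≤ 1) (X : BoolProgram ι ι) :
    ∑ z : ι → Bool, ∑ y : ι → Bool, (∏ e, jointMass a b r (z e) (y e)) *
      (if detects X (tailTest (posterior a b r) h K) z y then 1 else 0) ≤
      4 * X.time * Real.exp (-K) := by
  set p := posterior a b r with hp
  have hJ : ∀ z y : ι → Bool, 0 ≤ ∏ e, jointMass a b r (z e) (y e) := fun z y =>
    Finset.prod_nonneg fun e _ => jointMass_nonneg ha hb hab.le _ _ _
  have hz : ∀ z : ι → Bool, ∑ y : ι → Bool, (∏ e, jointMass a b r (z e) (y e)) *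
      (if detects X (tailTest p h K) z y then 1 else 0) ≤
      (4 * X.time * Real.exp (-K)) * ∏ e, bernoulliMass (b + a * r) (z e) := by
    intro z
    set S : ℕ × Bool → ℝ → (ι → Bool) → Prop := fun i t y =>
      K ≤ ∑ e, (if selected X z i.1 i.2 e then t * ((if y e then 1 else 0) - p) - p * t ^ 2
        else 0) with hS
    classical
    -- One exponential Markov bound for each digit, sign and tail, `4 * X.time` in all.
    have hone : ∀ i t, |t| ≤ 1 → ∑ y : ι → Bool, (∏ e, jointMass a b r (z e) (y e)) *
        (if S i t y then 1 else 0) ≤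
        Real.exp (-K) * ∏ e, bernoulliMass (b + a * r) (z e) := fun i t ht =>
      sum_jointMass_indicator_le (r := fun _ => r) ha hb hab (fun _ => h0) (fun _ => h1) z
        (selected X z i.1 i.2) (fun e he => eq_false_of_selected he) ht (fun y hy => hy)
    calc _ ≤ ∑ y : ι → Bool, (∏ e, jointMass a b r (z e) (y e)) *
          ∑ i ∈ Finset.range X.time ×ˢ (Finset.univ : Finset Bool),
            ((if S i h y then 1 else 0) + (if S i (-h) y then 1 else 0)) := by
          refine Finset.sum_le_sum fun y _ => mul_le_mul_of_nonneg_left ?_ (hJ z y)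
          have hnn : ∀ i, (0 : ℝ) ≤ (if S i h y then 1 else 0) + (if S i (-h) y then 1 else 0) :=
            fun i => by split_ifs <;> norm_num
          split_ifs with hd
          · rw [detects, decide_eq_true_iff] at hd
            obtain ⟨i, hi, hP⟩ := hd
            refine le_trans ?_ (Finset.single_le_sum (fun i _ => hnn i) hi)
            rw [tailTest, decide_eq_true_iff] at hP
            have hS' : S i h y ∨ S i (-h) y := by
              simp only [hS, sum_selected_eq, neg_sq]
              exact hP
            rcases hS' with h' | h'
            · rw [if_pos h']; split_ifs <;> norm_num
            · rw [if_pos h']; split_ifs <;> norm_num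
          · exact Finset.sum_nonneg fun i _ => hnn i
      _ = ∑ i ∈ Finset.range X.time ×ˢ (Finset.univ : Finset Bool),
          (∑ y : ι → Bool, (∏ e, jointMass a b r (z e) (y e)) * (if S i h y then 1 else 0) +
          ∑ y : ι → Bool, (∏ e, jointMass a b r (z e) (y e)) * (if S i (-h) y then 1 else 0)) := by
          simp only [Finset.mul_sum]
          rw [Finset.sum_comm]
          simp only [mul_add, Finset.sum_add_distrib]
      _ ≤ ∑ i ∈ Finset.range X.time ×ˢ (Finset.univ : Finset Bool),
          (Real.exp (-K) * ∏ e, bernoulliMass (b + a * r) (z e) +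
            Real.exp (-K) * ∏ e, bernoulliMass (b + a * r) (z e)) :=
          Finset.sum_le_sum fun i _ => add_le_add (hone i h hh) (hone i (-h) (by rwa [abs_neg]))
      _ = _ := by
          rw [Finset.sum_const, Finset.card_product, Finset.card_range, Finset.card_univ,
            Fintype.card_bool, nsmul_eq_mul]
          push_cast
          ring
  refine (Finset.sum_le_sum fun z _ => hz z).trans ?_
  rw [← Finset.mul_sum]
  have := expect_prod_bernoulliMass_one (fun _ : ι => b + a * r)
  simp only [expect, mul_one] at this
  rw [this, mul_one]

/-- False negatives, given the labels and the estimator's input. -/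
theorem sum_jointMass_not_detects_le {a b κ m r₀ ν g h K h' K₀ V : ℝ} {r w : ι → ℝ}
    (ha : 0 ≤ a) (hb : 0 ≤ b) (hκ : 0 < κ) (hab : a + b ≤ 1 - κ)
    (hr : ∀ e, r e = r₀ + ν * w e) (h0 : ∀ e, 0 ≤ r e) (hm : ∀ e, r e ≤ m) (hm1 : m ≤ 1)
    (hr₀ : 0 ≤ r₀) (hr₀m : r₀ ≤ m) (hν : 0 ≤ ν) (hg : 0 ≤ g) (hV : (Fintype.card ι : ℝ) ≤ V)
    (hh0 : 0 < h) (hh'0 : 0 ≤ h') (hh'1 : h' ≤ 1)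
    (hK : K ≤ h * (ν * (κ * g / 4)) - V * (r₀ * h ^ 2))
    (hK₀ : K₀ ≤ h' * (ν * (κ * g / 4)) - V * (m * h' ^ 2))
    (X : BoolProgram ι ι) (z : ι → Bool)
    (hlarge : ∃ l < X.time, ∃ s : Bool, g ≤ |∑ e, if digitSet X z l s e then w e else 0|)
    (hsmall : ∑ e, ((if z e then 1 else 0) + 2 * m / κ) * |w e| ≤ κ * g / 2) :
    ∑ y : ι → Bool, (∏ e, jointMass a b (r e) (z e) (y e)) *
      (if detects X (tailTest (posterior a b r₀) h K) z y then 0 else 1) ≤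
      Real.exp (-K₀) * ∏ e, bernoulliMass (b + a * r e) (z e) := by
  obtain ⟨l, hl, s, hls⟩ := hlarge
  have hab' : a + b < 1 := by linarith
  set p : ι → ℝ := fun e => posterior a b (r e) with hp
  set p₀ := posterior a b r₀ with hp₀
  set ρ := (1 - a - b) / (1 - b) with hρ
  have hρκ : κ ≤ ρ := by
    rw [hρ, le_div_iff₀ (by linarith)]
    nlinarith
  have hρ1 : ρ ≤ 1 := by
    rw [hρ, div_le_one (by linarith)]
    linarith
  have hρ0 : 0 ≤ ρ := hκ.le.trans hρκ
  set D : ι → ℝ := fun e => if selected X z l s e then p e - p₀ else 0 with hD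
  -- Two losses: pairs already visible in `z` are not selected, and the posterior is only
  -- approximately affine. The two terms of `hsmall` pay for them, and at least half of the ideal
  -- shift `ν κ g` remains.
  have hshift : |∑ e, D e - ρ * ν * ∑ e, (if digitSet X z l s e then w e else 0)| ≤
      ν * (κ * g / 2) := by
    rw [Finset.mul_sum, ← Finset.sum_sub_distrib]
    refine (Finset.abs_sum_le_sum_abs _ _).trans ?_
    refine le_trans ?_ (mul_le_mul_of_nonneg_left hsmall hν)
    rw [Finset.mul_sum]
    refine Finset.sum_le_sum fun e _ => ?_
    have hm0 : 0 ≤ m := (h0 e).trans (hm e)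
    have hpost := abs_posterior_sub_le ha hb hκ hab (h0 e) (hm e) hr₀ hr₀m hm1
    have e1 : r e - r₀ = ν * w e := by rw [hr]; ring
    rw [e1, abs_mul, abs_of_nonneg hν] at hpost
    have hnn : 0 ≤ 2 * m / κ * (ν * |w e|) := by positivity
    simp only [hD, selected_eq]
    by_cases hd : digitSet X z l s e = true
    swap
    · rw [Bool.not_eq_true] at hd
      simp only [hd, Bool.false_and, Bool.false_eq_true, if_false, mul_zero, sub_zero, abs_zero]
      split_ifs <;> positivity
    · by_cases hz : z e = true
      swap
      · rw [Bool.not_eq_true] at hz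
        simp only [hd, hz, Bool.not_false, Bool.and_self, if_true, Bool.false_eq_true, if_false, zero_add]
        calc _ = |posterior a b (r e) - posterior a b r₀ - ρ * (ν * w e)| := by
              congr 1; ring
          _ ≤ _ := hpost
          _ = _ := by ring
      · simp only [hd, hz, Bool.not_true, Bool.and_false, Bool.false_eq_true, if_false, if_true,
          zero_sub, abs_neg]
        rw [abs_mul, abs_of_nonneg (by positivity : 0 ≤ ρ * ν)]
        have : ρ * ν * |w e| ≤ 1 * ν * |w e| := by gcongr
        nlinarith
  have hbig : ν * (κ * g / 2) ≤ |∑ e, D e| := by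
    have h1 : ν * (κ * g) ≤ |ρ * ν * ∑ e, (if digitSet X z l s e then w e else 0)| := by
      rw [abs_mul, abs_of_nonneg (mul_nonneg hρ0 hν)]
      calc ν * (κ * g) = κ * ν * g := by ring
        _ ≤ ρ * ν * _ := by gcongr
    have h2 := abs_sub_abs_le_abs_sub
      (ρ * ν * ∑ e, (if digitSet X z l s e then w e else 0)) (∑ e, D e)
    rw [abs_sub_comm] at h2
    linarith
  -- `t` is the direction of the shift; the estimate may be anticorrelated on the selected set,
  -- which is why the test is two-sided.
  obtain ⟨t, ht, htD⟩ : ∃ t : ℝ, (t = 1 ∨ t = -1) ∧ t * ∑ e, D e = |∑ e, D e| := by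
    rcases abs_cases (∑ e, D e) with ⟨h1, _⟩ | ⟨h1, _⟩
    · exact ⟨1, Or.inl rfl, by rw [h1, one_mul]⟩
    · exact ⟨-1, Or.inr rfl, by rw [h1]; ring⟩
  have ht2 : t ^ 2 = 1 := by rcases ht with rfl | rfl <;> norm_num
  have hcount : ∀ (P : ι → Prop) [DecidablePred P], ((Finset.univ.filter P).card : ℝ) ≤ V :=
    fun P _ => le_trans (by exact_mod_cast Finset.card_le_univ _) hV
  have hp₀0 : 0 ≤ p₀ := posterior_nonneg ha hab' hr₀ (hr₀m.trans hm1)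
  have hp₀r : p₀ ≤ r₀ := posterior_le ha hab' hr₀ (hr₀m.trans hm1)
  have hV0 : 0 ≤ V := le_trans (Nat.cast_nonneg _) hV
  have hconv : ∀ y : ι → Bool, (if detects X (tailTest p₀ h K) z y then (0 : ℝ) else 1) =
      if ¬ detects X (tailTest p₀ h K) z y = true then 1 else 0 := fun y => by
    split_ifs <;> simp_all
  simp only [hconv]
  refine sum_jointMass_indicator_le ha hb hab' h0 (fun e => (hm e).trans hm1) z
    (selected X z l s) (fun e he => eq_false_of_selected he) (h := -t * h') ?_ fun y hy => ?_
  · rw [abs_mul, abs_neg, abs_of_nonneg hh'0]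
    have : |t| = 1 := by rcases ht with rfl | rfl <;> simp
    rw [this, one_mul]
    exact hh'1
  · have hnot : ¬ (K ≤ ∑ e, (if selected X z l s e then
        (t * h) * ((if y e then 1 else 0) - p₀) - p₀ * (t * h) ^ 2 else 0)) := by
      intro hc
      apply hy
      rw [detects, decide_eq_true_iff]
      refine ⟨(l, s), Finset.mem_product.2 ⟨Finset.mem_range.2 hl, Finset.mem_univ _⟩, ?_⟩
      rw [sum_selected_eq, mul_pow, ht2, one_mul] at hc
      rw [tailTest, decide_eq_true_iff]
      rcases ht with rfl | rfl
      · left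
        rwa [one_mul] at hc
      · right
        rwa [neg_one_mul] at hc
    rw [not_le, sum_selected_eq, mul_pow, ht2, one_mul] at hnot
    set u : ℝ := ((Finset.univ.filter fun e => selected X z l s e = true).card : ℝ) with hu
    set v : ℝ := ((Finset.univ.filter fun e => (selected X z l s e && y e) = true).card : ℝ)
      with hv
    have hu1 : u * (p₀ * h ^ 2) ≤ V * (r₀ * h ^ 2) := by
      have := hcount (fun e => selected X z l s e = true)
      gcongr
    -- Without detection, the deviation from the null mean is below half of the guaranteed shift.
    -- The deviation from the true conditional means is then at least as large in the opposite
    -- direction, which the exponential bound makes unlikely.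
    have hlt : t * (v - p₀ * u) < ν * (κ * g / 4) := by
      have : h * (t * (v - p₀ * u)) < h * (ν * (κ * g / 4)) := by nlinarith
      exact lt_of_mul_lt_mul_left this hh0.le
    have hsplit : v - p₀ * u = ∑ e, (if selected X z l s e then
        ((if y e then 1 else 0) - p e) else 0) + ∑ e, D e := by
      have h2 : v - p₀ * u = ∑ e, (if selected X z l s e then
          ((if y e then 1 else 0) - p₀) else 0) := by
        rw [hv, hu, Finset.natCast_card_filter, Finset.natCast_card_filter, Finset.mul_sum,
          ← Finset.sum_sub_distrib]
        refine Finset.sum_congr rfl fun e _ => ?_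
        cases selected X z l s e <;> cases y e <;> simp
      rw [h2, ← Finset.sum_add_distrib]
      refine Finset.sum_congr rfl fun e _ => ?_
      simp only [hD]
      split_ifs <;> ring
    rw [hsplit, mul_add, htD] at hlt
    have hneg : ν * (κ * g / 4) ≤ -t * ∑ e, (if selected X z l s e then
        ((if y e then 1 else 0) - p e) else 0) := by
      have : ν * (κ * g / 2) = 2 * (ν * (κ * g / 4)) := by ring
      linarith
    refine hK₀.trans ?_
    have hvar : ∑ e, (if selected X z l s e then p e else 0) ≤ V * m := by
      have h1 : ∑ e, (if selected X z l s e then p e else 0) ≤ ∑ _e : ι, m :=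
        Finset.sum_le_sum fun e _ => by
          have h2 := posterior_le ha hab' (h0 e) ((hm e).trans hm1)
          split_ifs
          · exact h2.trans (hm e)
          · exact (h0 e).trans (hm e)
      rw [Finset.sum_const, nsmul_eq_mul, Finset.card_univ] at h1
      exact h1.trans (mul_le_mul_of_nonneg_right hV (hr₀.trans hr₀m))
    have hfin : ∑ e, (if selected X z l s e then -t * h' * ((if y e then 1 else 0) - p e) -
        p e * (-t * h') ^ 2 else 0) = h' * (-t * ∑ e, (if selected X z l s e then
        ((if y e then 1 else 0) - p e) else 0)) -
        (∑ e, (if selected X z l s e then p e else 0)) * h' ^ 2 := by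
      rw [Finset.mul_sum, Finset.mul_sum, Finset.sum_mul, ← Finset.sum_sub_distrib]
      refine Finset.sum_congr rfl fun e _ => ?_
      have : (-t * h') ^ 2 = h' ^ 2 := by rw [mul_pow, neg_sq, ht2, one_mul]
      rw [this]
      split_ifs <;> ring
    refine le_trans ?_ (le_of_eq hfin.symm)
    have e1 := mul_le_mul_of_nonneg_left hneg hh'0
    have e2 := mul_le_mul_of_nonneg_right hvar (sq_nonneg h')
    linarith

theorem expect_bit {r : ι → ℝ} (e : ι) (h0 : 0 ≤ r e) (h1 : r e ≤ 1) :
    expect (fun z : ι → Bool => ∏ e, bernoulliMass (r e) (z e))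
      (fun z => if z e then 1 else 0) = r e := by
  have h := Fintype.prod_sum (fun i (x : Bool) =>
    bernoulliMass (r i) x * (if i = e then (if x then 1 else 0) else 1 : ℝ))
  have h2 : ∏ i, ∑ x : Bool, bernoulliMass (r i) x *
      (if i = e then (if x then 1 else 0) else 1 : ℝ) = r e := by
    rw [Finset.prod_eq_single e]
    · simp [bernoulliMass_true h0 h1]
    · intro i _ hi
      simp only [hi, if_false, mul_one, sum_bernoulliMass]
    · simp
  rw [← h2, h]
  refine Finset.sum_congr rfl fun z _ => ?_
  dsimp only
  rw [Finset.prod_mul_distrib, Finset.prod_ite_eq' Finset.univ e]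
  simp

/-- Some overwriting rule does at least as well as the average. -/
theorem exists_rule_le {a b : ℝ} (ha : 0 ≤ a) (hb : 0 ≤ b) (hab : a + b ≤ 1)
    (F : (ι → Option Bool) → ℝ) {v : ℝ}
    (h : ∑ f : ι → Option Bool, (∏ e, ruleMass a b (f e)) * F f ≤ v) : ∃ f, F f ≤ v := by
  by_contra hcon
  push Not at hcon
  have hnn : ∀ f : ι → Option Bool, 0 ≤ ∏ e, ruleMass a b (f e) := fun f =>
    Finset.prod_nonneg fun e _ => ruleMass_nonneg ha hb hab _
  have hsum : ∑ f : ι → Option Bool, ∏ e, ruleMass a b (f e) = 1 := by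
    rw [← Fintype.prod_sum (fun (_ : ι) o => ruleMass a b o)]
    simp only [sum_ruleMass, Finset.prod_const_one]
  obtain ⟨f, -, hf⟩ : ∃ f ∈ (Finset.univ : Finset (ι → Option Bool)), 0 < ∏ e, ruleMass a b (f e) :=
    (Finset.sum_pos_iff_of_nonneg fun f _ => hnn f).1 (by rw [hsum]; norm_num)
  have : ∑ f : ι → Option Bool, (∏ e, ruleMass a b (f e)) * v <
      ∑ f : ι → Option Bool, (∏ e, ruleMass a b (f e)) * F f :=
    Finset.sum_lt_sum (fun f _ => mul_le_mul_of_nonneg_left (hcon f).le (hnn f))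
      ⟨f, Finset.mem_univ f, mul_lt_mul_of_pos_left (hcon f) hf⟩
  rw [← Finset.sum_mul, hsum, one_mul] at this
  linarith

end Abstract

theorem correlation_le_one {κ : Type} [Fintype κ] (x θ : κ → ℝ) : correlation x θ ≤ 1 :=
  div_le_one_of_le₀ (Real.sum_mul_le_sqrt_mul_sqrt _ _ _) (by positivity)

/-! ### Averages over the block model -/

/-- The endpoints of an edge are distinct, so their labels are independent and each centred
indicator averages to zero. -/
theorem sum_edgeKernel_labels {n q : ℕ} (hq : q ≠ 0) (e : Pair n) :
    ∑ σ : Fin n → Fin q, edgeKernel n q σ e = 0 := by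
  have hne : e.1.1 ≠ e.1.2 := e.2.ne
  simp only [edgeKernel, ← sum_centredIndicator_sq hq, ← Finset.mul_sum]
  rw [Finset.sum_comm, Finset.sum_eq_zero, mul_zero]
  intro a _
  have h := Fintype.prod_sum (fun (i : Fin n) (x : Fin q) =>
    if i ∈ ({e.1.1, e.1.2} : Finset (Fin n)) then centredIndicator q x a else 1)
  have h2 : ∀ σ : Fin n → Fin q, (∏ i, if i ∈ ({e.1.1, e.1.2} : Finset (Fin n)) then
      centredIndicator q (σ i) a else 1) =
      centredIndicator q (σ e.1.1) a * centredIndicator q (σ e.1.2) a := by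
    intro σ
    rw [Finset.prod_ite_mem, Finset.univ_inter, Finset.prod_pair hne]
  simp only [h2] at h
  rw [← h]
  refine Finset.prod_eq_zero (Finset.mem_univ e.1.1) ?_
  simp only [Finset.mem_insert, true_or, if_true]
  exact sum_centredIndicator hq a

/-- The kernel is at least `-1`. Since its mean is zero, its mean absolute value is then at most
two, uniformly in `q`. -/
theorem abs_edgeKernel_le_add_two {n q : ℕ} (hq : 2 ≤ q) (σ : Fin n → Fin q) (e : Pair n) :
    |edgeKernel n q σ e| ≤ edgeKernel n q σ e + 2 := by
  have : (2 : ℝ) ≤ q := by exact_mod_cast hq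
  unfold edgeKernel communityKernel
  rw [abs_le]
  split_ifs <;> constructor <;> linarith

theorem sum_abs_edgeKernel_labels_le {n q : ℕ} (hq : 2 ≤ q) (e : Pair n) :
    ((q : ℝ) ^ n)⁻¹ * ∑ σ : Fin n → Fin q, |edgeKernel n q σ e| ≤ 2 := by
  have hq' : (0 : ℝ) < q := by exact_mod_cast (by omega : 0 < q)
  rw [inv_mul_le_iff₀ (by positivity)]
  refine (Finset.sum_le_sum fun σ _ => abs_edgeKernel_le_add_two hq σ e).trans ?_
  rw [Finset.sum_add_distrib, sum_edgeKernel_labels (by omega)]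
  simp

theorem expect_sbmJoint {n q : ℕ} (d lam : ℝ) (σ : Fin n → Fin q) (f : (Pair n → Bool) → ℝ) :
    expect (sbmJoint n q d lam σ) f = ((q : ℝ) ^ n)⁻¹ *
      expect (fun y => ∏ e, bernoulliMass (sbmEdgeProb n q d lam σ e) (y e)) f := by
  simp only [expect, sbmJoint, Finset.mul_sum, mul_assoc]

theorem sum_expect_sbmJoint_one {n q : ℕ} (hq : q ≠ 0) (d lam : ℝ) :
    ∑ σ : Fin n → Fin q, expect (sbmJoint n q d lam σ) (fun _ => 1) = 1 := by
  simp only [expect_sbmJoint, expect_prod_bernoulliMass_one, mul_one]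
  have hq' : (q : ℝ) ≠ 0 := by exact_mod_cast hq
  simp [hq']

theorem sbmJoint_nonneg {n q : ℕ} (d lam : ℝ) (σ : Fin n → Fin q) (y : Pair n → Bool) :
    0 ≤ sbmJoint n q d lam σ y :=
  mul_nonneg (by positivity) (Finset.prod_nonneg fun _ _ => bernoulliMass_nonneg _ _)

/-- The weight of the signal on the observed edges, plus a small multiple of its total weight, is
small on average. -/
theorem sum_expect_observed_signal_le {n q : ℕ} (hq : 2 ≤ q) {d lam m ε : ℝ} (hm : m ≤ 1)
    (hε : 0 ≤ ε) (h0 : ∀ σ e, 0 ≤ sbmEdgeProb n q d lam σ e)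
    (h1 : ∀ σ e, sbmEdgeProb n q d lam σ e ≤ m) (hm0 : 0 ≤ m) :
    ∑ σ : Fin n → Fin q, expect (sbmJoint n q d lam σ)
      (fun z => ∑ e, ((if z e then 1 else 0) + ε) * |edgeKernel n q σ e|) ≤
      2 * n ^ 2 * (m + ε) := by
  have hσ : ∀ σ : Fin n → Fin q, expect (sbmJoint n q d lam σ)
      (fun z => ∑ e, ((if z e then 1 else 0) + ε) * |edgeKernel n q σ e|) ≤
      ((q : ℝ) ^ n)⁻¹ * ∑ e, (m + ε) * |edgeKernel n q σ e| := by
    intro σ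
    rw [expect_sbmJoint, expect_sum]
    refine mul_le_mul_of_nonneg_left (Finset.sum_le_sum fun e _ => ?_) (by positivity)
    have e1 : ∀ z : Pair n → Bool, ((if z e then 1 else 0) + ε) * |edgeKernel n q σ e| =
        |edgeKernel n q σ e| * ((if z e then 1 else 0) + ε * 1) := fun z => by ring
    simp only [e1, expect_const_mul]
    rw [mul_comm]
    refine mul_le_mul_of_nonneg_right ?_ (abs_nonneg _)
    have e2 : expect (fun y : Pair n → Bool =>
        ∏ e, bernoulliMass (sbmEdgeProb n q d lam σ e) (y e))
        (fun z => (if z e then 1 else 0) + ε * 1) = sbmEdgeProb n q d lam σ e + ε := by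
      have := expect_bit (r := fun e => sbmEdgeProb n q d lam σ e) e (h0 σ e)
        ((h1 σ e).trans hm)
      have h3 := expect_prod_bernoulliMass_one (fun e => sbmEdgeProb n q d lam σ e)
      rw [← this]
      have h4 : expect (fun y : Pair n → Bool =>
          ∏ e, bernoulliMass (sbmEdgeProb n q d lam σ e) (y e)) (fun _ => ε * 1) = ε := by
        rw [expect_const_mul, h3, mul_one]
      conv_rhs => rw [← h4]
      simp only [expect, mul_add, Finset.sum_add_distrib]
    rw [e2]
    linarith [h1 σ e]
  refine (Finset.sum_le_sum fun σ _ => hσ σ).trans ?_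
  rw [← Finset.mul_sum, Finset.sum_comm, Finset.mul_sum]
  have he : ∀ e : Pair n, ((q : ℝ) ^ n)⁻¹ * ∑ σ : Fin n → Fin q,
      (m + ε) * |edgeKernel n q σ e| ≤ 2 * (m + ε) := by
    intro e
    have := mul_le_mul_of_nonneg_left (sum_abs_edgeKernel_labels_le hq e)
      (add_nonneg hm0 hε)
    rw [← Finset.mul_sum]
    linarith
  refine (Finset.sum_le_sum fun e _ => he e).trans ?_
  rw [Finset.sum_const, nsmul_eq_mul, Finset.card_univ]
  have := mul_le_mul_of_nonneg_right (card_pair_le n) (by positivity : 0 ≤ 2 * (m + ε))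
  linarith

/-- From an estimator of the signal at parameters `(d, lam)` to a test of one sample at parameters
`(d', lam')`. -/
theorem exists_rule_errors_le {n q M : ℕ} {d lam d' lam' a b κ m c h K h' K₀ : ℝ}
    (X : BoolProgram (Pair n) (Pair n)) (hq : 2 ≤ q) (hn : 2 * q ≤ n) (hsig : 0 < lam * d / n)
    (hc : 0 < c) (ha : 0 ≤ a) (hb : 0 ≤ b) (hκ : 0 < κ) (hab : a + b ≤ 1 - κ)
    (hmatch : ∀ σ e, b + a * sbmEdgeProb n q d' lam' σ e = sbmEdgeProb n q d lam σ e)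
    (h0 : ∀ σ e, 0 ≤ sbmEdgeProb n q d' lam' σ e) (hm : ∀ σ e, sbmEdgeProb n q d' lam' σ e ≤ m)
    (hm1 : m ≤ 1) (hd0 : 0 ≤ d' / n) (hdm : d' / n ≤ m)
    (hp : ∀ σ e, sbmEdgeProb n q d lam σ e ≤ m) (hν : 0 ≤ lam' * d' / n)
    (hcorr : 2 * c ≤ ∑ σ : Fin n → Fin q, expect (sbmJoint n q d lam σ)
      fun y => correlation (X.vector y) (sbmSignal n q d lam σ))
    (hh0 : 0 < h) (hh1 : h ≤ 1) (hh'0 : 0 ≤ h') (hh'1 : h' ≤ 1)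
    (hK : K ≤ h * (lam' * d' / n * (κ * (c ^ 2 * n ^ 2 / 256) / 4)) - n ^ 2 * (d' / n * h ^ 2))
    (hK₀ : K₀ ≤ h' * (lam' * d' / n * (κ * (c ^ 2 * n ^ 2 / 256) / 4)) - n ^ 2 * (m * h' ^ 2)) :
    ∃ (f : Pair n → Option Bool) (P : ℕ → ℕ → Bool),
      M * prob (erdosRenyiLaw n d') (fun y => detects X P (overwrite f y) y) +
        prob (sbmLaw n q d' lam') (fun y => !detects X P (overwrite f y) y) ≤
      M * (4 * X.time * Real.exp (-K)) + (Real.exp (-K₀) + (1 - c) +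
        2 * n ^ 2 * (m + 2 * m / κ) / (κ * (c ^ 2 * n ^ 2 / 256) / 2)) := by
  have hq0 : q ≠ 0 := by omega
  have hn0 : (0 : ℝ) < n := by exact_mod_cast (by omega : 0 < n)
  have hm0 : 0 ≤ m := hd0.trans hdm
  have hab1 : a + b < 1 := by linarith
  set P := tailTest (posterior a b (d' / n)) h K with hP
  set g : ℝ := c ^ 2 * n ^ 2 / 256 with hg
  have hg0 : 0 < g := by positivity
  suffices hs : ∃ f : Pair n → Option Bool,
      M * prob (erdosRenyiLaw n d') (fun y => detects X P (overwrite f y) y) +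
        prob (sbmLaw n q d' lam') (fun y => !detects X P (overwrite f y) y) ≤
      M * (4 * X.time * Real.exp (-K)) + (Real.exp (-K₀) + (1 - c) +
        2 * n ^ 2 * (m + 2 * m / κ) / (κ * g / 2)) from
    let ⟨f, hf⟩ := hs; ⟨f, P, hf⟩
  -- Both errors are averaged in one functional, so a single fixed rule is good for both.
  refine exists_rule_le ha hb hab1.le _ ?_
  simp only [mul_add, Finset.sum_add_distrib]
  refine add_le_add ?_ ?_
  · have h1 := sum_jointMass_detects_le (ι := Pair n) (K := K) ha hb hab1 hd0 (hdm.trans hm1)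
      (by rwa [abs_of_pos hh0] : |h| ≤ 1) X
    rw [← sum_rules_expect a b (fun _ => d' / n)
      (fun z y => if detects X P z y then 1 else 0)] at h1
    refine le_trans (le_of_eq ?_) (mul_le_mul_of_nonneg_left h1 (Nat.cast_nonneg M))
    rw [Finset.mul_sum]
    refine Finset.sum_congr rfl fun f _ => ?_
    rw [mul_left_comm]
    rfl
  · set ε := 2 * m / κ with hε
    have hε0 : 0 ≤ ε := by positivity
    set W : (Fin n → Fin q) → (Pair n → Bool) → ℝ := fun σ z =>
      ∑ e, ((if z e then 1 else 0) + ε) * |edgeKernel n q σ e| with hW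
    have hW0 : ∀ σ z, 0 ≤ W σ z := fun σ z => Finset.sum_nonneg fun e _ =>
      mul_nonneg (by split_ifs <;> linarith) (abs_nonneg _)
    -- Each term covers one case: the exponential bound when estimate and input are both good, `1 +
    -- c - correlation ≥ 1` when the correlation is below `c`, and Markov's inequality when the
    -- visible signal is too large. Averaging the middle term with mean correlation at least `2 c`
    -- gives `1 - c`.
    have hσ : ∀ σ : Fin n → Fin q, ∑ z : Pair n → Bool, ∑ y : Pair n → Bool,
        (∏ e, jointMass a b (sbmEdgeProb n q d' lam' σ e) (z e) (y e)) *
        (if detects X P z y then 0 else 1) ≤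
        expect (fun z => ∏ e, bernoulliMass (sbmEdgeProb n q d lam σ e) (z e)) (fun z =>
          Real.exp (-K₀) + (1 + c - correlation (X.vector z) (sbmSignal n q d lam σ)) +
            W σ z / (κ * g / 2)) := by
      intro σ
      refine Finset.sum_le_sum fun z _ => ?_
      have hnn : 0 ≤ ∏ e, bernoulliMass (sbmEdgeProb n q d lam σ e) (z e) :=
        Finset.prod_nonneg fun _ _ => bernoulliMass_nonneg _ _
      have hmarg : ∏ e, bernoulliMass (b + a * sbmEdgeProb n q d' lam' σ e) (z e) =
          ∏ e, bernoulliMass (sbmEdgeProb n q d lam σ e) (z e) := by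
        simp only [hmatch]
      have hc1 := correlation_le_one (X.vector z) (sbmSignal n q d lam σ)
      have hWt : 0 ≤ W σ z / (κ * g / 2) := div_nonneg (hW0 σ z) (by positivity)
      have hexp := Real.exp_pos (-K₀)
      by_cases hgood : c ≤ correlation (X.vector z) (sbmSignal n q d lam σ) ∧
          W σ z ≤ κ * g / 2
      · have h1 := sum_jointMass_not_detects_le (K₀ := K₀) (r₀ := d' / n) (ν := lam' * d' / n)
          (w := edgeKernel n q σ) (V := n ^ 2) ha hb hκ hab
          (fun e => sbmEdgeProb_eq n q d' lam' σ e) (h0 σ) (hm σ) hm1 hd0 hdm hν hg0.le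
          (card_pair_le n) hh0 hh'0 hh'1 hK hK₀ X z
          (exists_digitSet_large hq hn hsig hc X z σ hgood.1) hgood.2
        rw [hmarg] at h1
        refine h1.trans ?_
        rw [mul_comm]
        refine mul_le_mul_of_nonneg_left ?_ hnn
        linarith
      · have h1 : ∑ y : Pair n → Bool,
            (∏ e, jointMass a b (sbmEdgeProb n q d' lam' σ e) (z e) (y e)) *
            (if detects X P z y then 0 else 1) ≤
            ∏ e, bernoulliMass (sbmEdgeProb n q d lam σ e) (z e) := by
          rw [← hmarg]
          have : ∀ e, bernoulliMass (b + a * sbmEdgeProb n q d' lam' σ e) (z e) =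
              ∑ y, jointMass a b (sbmEdgeProb n q d' lam' σ e) (z e) y := fun e =>
            (sum_jointMass ha hb hab1.le (h0 σ e) ((hm σ e).trans hm1) (z e)).symm
          simp only [this]
          rw [Fintype.prod_sum]
          refine Finset.sum_le_sum fun y _ => mul_le_of_le_one_right
            (Finset.prod_nonneg fun e _ => jointMass_nonneg ha hb hab1.le _ _ _) ?_
          split_ifs <;> norm_num
        refine h1.trans (le_mul_of_one_le_right hnn ?_)
        rw [not_and_or, not_le, not_le] at hgood
        rcases hgood with h2 | h2
        · linarith
        · have h3 : 1 ≤ W σ z / (κ * g / 2) := (one_le_div (by positivity)).2 h2.le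
          linarith
    have hsum : ∑ f : Pair n → Option Bool, (∏ e, ruleMass a b (f e)) *
        prob (sbmLaw n q d' lam') (fun y => !detects X P (overwrite f y) y) =
        ((q : ℝ) ^ n)⁻¹ * ∑ σ : Fin n → Fin q, ∑ z : Pair n → Bool, ∑ y : Pair n → Bool,
        (∏ e, jointMass a b (sbmEdgeProb n q d' lam' σ e) (z e) (y e)) *
        (if detects X P z y then 0 else 1) := by
      have e1 : ∀ f : Pair n → Option Bool,
          (fun y => if !detects X P (overwrite f y) y then (1 : ℝ) else 0) =
          fun y => if detects X P (overwrite f y) y then 0 else 1 := fun f => by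
        funext y
        cases detects X P (overwrite f y) y <;> rfl
      have e2 : ∀ σ : Fin n → Fin q, ∑ z : Pair n → Bool, ∑ y : Pair n → Bool,
        (∏ e, jointMass a b (sbmEdgeProb n q d' lam' σ e) (z e) (y e)) *
        (if detects X P z y then (0 : ℝ) else 1) = _ := fun σ =>
        (sum_rules_expect a b (sbmEdgeProb n q d' lam' σ)
          (fun z y => if detects X P z y then 0 else 1)).symm
      simp only [prob, expect_sbmLaw, e1, e2]
      rw [Finset.sum_comm, Finset.mul_sum]
      refine Finset.sum_congr rfl fun f _ => ?_
      rw [mul_left_comm]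
      refine congrArg _ ?_
      rw [Finset.mul_sum]
    rw [hsum]
    refine (mul_le_mul_of_nonneg_left (Finset.sum_le_sum fun σ _ => hσ σ)
      (by positivity)).trans ?_
    rw [Finset.mul_sum]
    simp only [← expect_sbmJoint]
    have hsplit : ∀ σ : Fin n → Fin q, expect (sbmJoint n q d lam σ) (fun z =>
          Real.exp (-K₀) + (1 + c - correlation (X.vector z) (sbmSignal n q d lam σ)) +
            W σ z / (κ * g / 2)) =
        (Real.exp (-K₀) + 1 + c) * expect (sbmJoint n q d lam σ) (fun _ => 1) -
        expect (sbmJoint n q d lam σ)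
          (fun z => correlation (X.vector z) (sbmSignal n q d lam σ)) +
        (κ * g / 2)⁻¹ * expect (sbmJoint n q d lam σ) (W σ) := by
      intro σ
      rw [← expect_const_mul, ← expect_const_mul]
      simp only [expect]
      rw [← Finset.sum_sub_distrib, ← Finset.sum_add_distrib]
      refine Finset.sum_congr rfl fun z _ => ?_
      ring
    simp only [hsplit, Finset.sum_add_distrib, Finset.sum_sub_distrib, ← Finset.mul_sum]
    rw [sum_expect_sbmJoint_one hq0]
    have hp0 : ∀ σ e, 0 ≤ sbmEdgeProb n q d lam σ e := fun σ e => by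
      rw [← hmatch]
      exact add_nonneg hb (mul_nonneg ha (h0 σ e))
    have h3 := sum_expect_observed_signal_le (n := n) hq hm1 hε0 hp0 hp hm0
    have h4 : (κ * g / 2)⁻¹ * ∑ σ : Fin n → Fin q, expect (sbmJoint n q d lam σ) (W σ) ≤
        2 * n ^ 2 * (m + ε) / (κ * g / 2) := by
      rw [div_eq_inv_mul (2 * (n : ℝ) ^ 2 * (m + ε))]
      exact mul_le_mul_of_nonneg_left h3 (by positivity)
    rw [mul_add (2 * (n : ℝ) ^ 2)] at h4
    linarith

/-! ### Error probabilities in the hidden sample problem -/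

/-- Union bound over the samples, which all have law `Q`. -/
theorem prob_hiddenNull_exists_le {ι : Type} [Fintype ι] [DecidableEq ι] {M : ℕ}
    {Q : (ι → Bool) → ℝ} (hQ : ∀ y, 0 ≤ Q y) (hQ1 : expect Q (fun _ => 1) = 1)
    (S : (ι → Bool) → Bool) :
    prob (hiddenNull M Q) (fun y => decide (∃ j : Fin M, S (fun e => y (j, e)) = true)) ≤
      M * prob Q S := by
  simp only [expect, mul_one] at hQ1
  have hnn : ∀ y : Fin M × ι → Bool, 0 ≤ hiddenNull M Q y := fun y =>
    Finset.prod_nonneg fun j _ => hQ _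
  have hj : ∀ j : Fin M, expect (hiddenNull M Q)
      (fun y => if S (fun e => y (j, e)) then 1 else 0) = prob Q S := by
    intro j
    have h1 := sum_curry_prod M (fun i z => Q z * (if i = j then (if S z then 1 else 0) else 1))
    have h2 : ∏ i : Fin M, ∑ z, Q z * (if i = j then (if S z then 1 else 0) else 1) =
        prob Q S := by
      rw [Finset.prod_eq_single j]
      · simp only [if_true, prob, expect]
      · intro i _ hi
        simp only [hi, if_false, mul_one, hQ1]
      · simp
    rw [← h2, ← h1]
    refine Finset.sum_congr rfl fun y _ => ?_
    rw [Finset.prod_mul_distrib, Finset.prod_ite_eq' Finset.univ j]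
    simp [hiddenNull]
  calc _ ≤ expect (hiddenNull M Q)
        (fun y => ∑ j : Fin M, if S (fun e => y (j, e)) then 1 else 0) := by
        refine expect_mono hnn fun y => ?_
        have hnn' : ∀ j ∈ (Finset.univ : Finset (Fin M)),
            (0 : ℝ) ≤ if S (fun e => y (j, e)) then 1 else 0 := fun j _ => by
          split_ifs <;> norm_num
        split_ifs with h
        · rw [decide_eq_true_iff] at h
          obtain ⟨j, hj⟩ := h
          refine le_trans ?_ (Finset.single_le_sum hnn' (Finset.mem_univ j))
          rw [if_pos hj]
        · exact Finset.sum_nonneg hnn'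
    _ = _ := by
        rw [expect_sum]
        simp only [hj, Finset.sum_const, Finset.card_univ, Fintype.card_fin, nsmul_eq_mul]

/-- If no sample fires, the planted one does not; the other samples integrate to one. -/
theorem prob_hiddenPlanted_forall_le {ι : Type} [Fintype ι] [DecidableEq ι] {M : ℕ} (hM : 1 ≤ M)
    {P Q : (ι → Bool) → ℝ} (hP : ∀ y, 0 ≤ P y) (hQ : ∀ y, 0 ≤ Q y)
    (hQ1 : expect Q (fun _ => 1) = 1) (S : (ι → Bool) → Bool) :
    prob (hiddenPlanted M P Q)
      (fun y => !decide (∃ j : Fin M, S (fun e => y (j, e)) = true)) ≤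
      prob P (fun y => !S y) := by
  simp only [expect, mul_one] at hQ1
  have hM0 : (M : ℝ) ≠ 0 := by positivity
  have ha : ∀ a : Fin M, ∑ y : Fin M × ι → Bool,
      (∏ j : Fin M, (if j = a then P else Q) fun e => y (j, e)) *
        (if !decide (∃ j : Fin M, S (fun e => y (j, e)) = true) then 1 else 0) ≤
      prob P (fun y => !S y) := by
    intro a
    have h1 := sum_curry_prod M (fun i z => (if i = a then P else Q) z *
      (if i = a then (if !S z then 1 else 0) else 1))
    have h2 : ∏ i : Fin M, ∑ z, (if i = a then P else Q) z *
        (if i = a then (if !S z then 1 else 0) else 1) = prob P (fun y => !S y) := by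
      rw [Finset.prod_eq_single a]
      · simp only [if_true, prob, expect]
      · intro i _ hi
        simp only [hi, if_false, mul_one, hQ1]
      · simp
    rw [← h2, ← h1]
    refine Finset.sum_le_sum fun y _ => ?_
    rw [Finset.prod_mul_distrib, Finset.prod_ite_eq' Finset.univ a]
    refine mul_le_mul_of_nonneg_left ?_ (Finset.prod_nonneg fun j _ => ?_)
    · by_cases hS : S (fun e => y (a, e)) = true
      · have : ∃ j : Fin M, S (fun e => y (j, e)) = true := ⟨a, hS⟩
        simp [this, hS]
      · simp only [Finset.mem_univ, if_true, hS]
        split_ifs <;> simp_all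
    · split_ifs
      · exact hP _
      · exact hQ _
  calc _ = (M : ℝ)⁻¹ * ∑ a : Fin M, ∑ y : Fin M × ι → Bool,
      (∏ j : Fin M, (if j = a then P else Q) fun e => y (j, e)) *
        (if !decide (∃ j : Fin M, S (fun e => y (j, e)) = true) then 1 else 0) := by
        simp only [prob, expect, hiddenPlanted]
        rw [Finset.sum_comm, Finset.mul_sum]
        refine Finset.sum_congr rfl fun y _ => ?_
        rw [mul_assoc, Finset.sum_mul]
    _ ≤ (M : ℝ)⁻¹ * ∑ _a : Fin M, prob P (fun y => !S y) := by
        refine mul_le_mul_of_nonneg_left (Finset.sum_le_sum fun a _ => ha a) (by positivity)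
    _ = _ := by
        rw [Finset.sum_const, Finset.card_univ, Fintype.card_fin, nsmul_eq_mul,
          inv_mul_cancel_left₀ hM0]

/-! ### From weak recovery to detection of a hidden sample -/

theorem sbmEdgeProb_le {n q : ℕ} {d lam : ℝ} (hq : 1 ≤ q) (hd : 0 ≤ d) (hl : 0 ≤ lam)
    (σ : Fin n → Fin q) (e : Pair n) : sbmEdgeProb n q d lam σ e ≤ (1 + q * lam) * d / n := by
  have hq' : (1 : ℝ) ≤ q := by exact_mod_cast hq
  unfold sbmEdgeProb
  split_ifs
  · gcongr
    linarith
  · gcongr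
    nlinarith

theorem sbmEdgeProb_nonneg {n q : ℕ} {d lam : ℝ} (hq : 1 ≤ q) (hd : 0 ≤ d) (hl : 0 ≤ lam)
    (hl1 : lam ≤ 1) (σ : Fin n → Fin q) (e : Pair n) : 0 ≤ sbmEdgeProb n q d lam σ e := by
  have hq' : (0 : ℝ) ≤ (q : ℝ) - 1 := by
    have : (1 : ℝ) ≤ q := by exact_mod_cast hq
    linarith
  have hl2 : 0 ≤ 1 - lam := by linarith
  unfold sbmEdgeProb
  split_ifs <;> positivity

theorem erdosRenyiLaw_eq (n : ℕ) (d : ℝ) : erdosRenyiLaw n d = productBernoulli (d / n) := rfl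

theorem sbmLaw_nonneg {n q : ℕ} (d lam : ℝ) (y : Pair n → Bool) : 0 ≤ sbmLaw n q d lam y :=
  Finset.sum_nonneg fun σ _ => sbmJoint_nonneg d lam σ y

/-- The channel parameters `a` and `b` are forced: `r ↦ b + a r` must send the constant part `d' /
n` of the edge probability to `d / n` and the kernel part `λ' d' / n` to `λ d / n`. The hypothesis
`hgap` then leaves `1 - a - b ≥ δ / 4`, so every bit is erased with probability bounded below. -/
theorem exists_hidden_detector {n q M : ℕ} {d lam d' lam' δ c : ℝ}
    (X : BoolProgram (Pair n) (Pair n)) (hM : 1 ≤ M) (hq : 2 ≤ q) (hn : 2 * q ≤ n) (hd : 0 < d)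
    (hl : 0 < lam) (hll : lam ≤ lam') (hl' : lam' < 1) (hδ : 0 < δ) (hδ1 : δ < 1)
    (hdd : d ≤ d') (hgap : lam * d ≤ (1 - δ / 2) * (lam' * d')) (hdn : d / n ≤ δ / 4)
    (hm1 : (1 + q * lam') * d' / n ≤ 1) (hc : 0 < c) (hc1 : c ≤ 1)
    (hcorr : 2 * c ≤ ∑ σ : Fin n → Fin q, expect (sbmJoint n q d lam σ)
      fun y => correlation (X.vector y) (sbmSignal n q d lam σ)) :
    ∃ A : BoolProgram (Fin M × Pair n) Unit,
      A.time ≤ M * (X.time * (200 * (Fintype.card (Pair n) + 1) ^ 2 + 8) + 4) + 2 ∧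
      prob (hiddenNull M (erdosRenyiLaw n d')) (fun y => A.accepts y) +
        prob (hiddenPlanted M (sbmLaw n q d' lam') (erdosRenyiLaw n d'))
          (fun y => !A.accepts y) ≤
      M * (4 * X.time * Real.exp (-((δ * c ^ 2 / 2048) ^ 2 * (d' * lam' ^ 2) / 16 * n))) +
        (Real.exp (-((δ * c ^ 2 / 2048) ^ 2 * (d' * lam' ^ 2) / 16 * (n / (1 + q)))) + (1 - c) +
          4096 * (1 + 8 / δ) / (δ * c ^ 2) * ((1 + q * lam') * d' / n)) := by
  have hn0 : (0 : ℝ) < n := by exact_mod_cast (by omega : 0 < n)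
  have hq0 : (2 : ℝ) ≤ q := by exact_mod_cast hq
  have hl'0 : 0 < lam' := hl.trans_le hll
  have hd'0 : 0 < d' := hd.trans_le hdd
  set m := (1 + q * lam') * d' / n with hm
  set c₁ := δ * c ^ 2 / 2048 with hc₁
  have hc₁0 : 0 < c₁ := by positivity
  have hc₁1 : c₁ ≤ 1 := by
    have : c ^ 2 ≤ 1 := pow_le_one₀ hc.le hc1
    rw [hc₁, div_le_one (by norm_num)]
    nlinarith
  set a := lam * d / (lam' * d') with ha
  set b := d / n * (1 - lam / lam') with hb
  have hratio : lam / lam' ≤ 1 := (div_le_one hl'0).2 hll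
  have ha0 : 0 ≤ a := by positivity
  have ha1 : a ≤ 1 - δ / 2 := by rwa [ha, div_le_iff₀ (by positivity)]
  have hb0 : 0 ≤ b := mul_nonneg (by positivity) (by linarith)
  have hb1 : b ≤ δ / 4 := by
    refine le_trans (mul_le_of_le_one_right (by positivity) ?_) hdn
    have : 0 ≤ lam / lam' := by positivity
    linarith
  have hdm : d' / n ≤ m := by
    rw [hm]
    gcongr
    nlinarith [mul_pos (by linarith : (0 : ℝ) < q) hl'0]
  -- Here `κ g / 4` equals `c₁ n² / 2`. The tilt `h` maximizes the resulting bound on `K`, where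
  -- bits have parameter `d' / n`; `h'` does the same for `K₀` with `m` replaced by its upper bound
  -- `(1 + q) d' / n`.
  obtain ⟨f, P, hfP⟩ := exists_rule_errors_le (M := M) (d := d) (lam := lam) (d' := d')
    (lam' := lam') (a := a) (b := b) (κ := δ / 4) (m := m) (c := c) (h := c₁ * lam' / 4)
    (K := c₁ ^ 2 * (d' * lam' ^ 2) / 16 * n) (h' := c₁ * lam' / (4 * (1 + q)))
    (K₀ := c₁ ^ 2 * (d' * lam' ^ 2) / 16 * (n / (1 + q))) X hq hn (by positivity) hc ha0 hb0
    (by positivity) (by linarith)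
    (fun σ e => by
      rw [sbmEdgeProb_eq, sbmEdgeProb_eq, ha, hb]
      field_simp
      ring)
    (sbmEdgeProb_nonneg (by omega) hd'0.le hl'0.le hl'.le)
    (sbmEdgeProb_le (by omega) hd'0.le hl'0.le) hm1 (by positivity) hdm
    (fun σ e => (sbmEdgeProb_le (by omega) hd.le hl.le σ e).trans (by rw [hm]; gcongr))
    (by positivity) hcorr (by positivity) (by nlinarith) (by positivity)
    (by
      rw [div_le_one (by positivity)]
      nlinarith)
    (le_of_eq (by rw [hc₁]; field_simp; ring))
    (by
      have h1 : (n : ℝ) ^ 2 * (m * (c₁ * lam' / (4 * (1 + q))) ^ 2) ≤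
          (n : ℝ) ^ 2 * ((1 + q) * d' / n * (c₁ * lam' / (4 * (1 + q))) ^ 2) := by
        rw [hm]
        gcongr
        nlinarith
      refine le_trans (le_of_eq ?_) (sub_le_sub_left h1 _)
      rw [hc₁]
      field_simp
      ring)
  obtain ⟨A, hA1, hA2⟩ := exists_detector X P f M
  refine ⟨A, hA1, ?_⟩
  have hER : ∀ y, 0 ≤ erdosRenyiLaw n d' y := productBernoulli_nonneg _
  have hER1 : expect (erdosRenyiLaw n d') (fun _ => 1) = 1 := expect_productBernoulli_one _
  have h1 := prob_hiddenNull_exists_le (M := M) hER hER1 (fun y => detects X P (overwrite f y) y)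
  have h2 := prob_hiddenPlanted_forall_le hM (sbmLaw_nonneg (q := q) d' lam') hER hER1
    (fun y => detects X P (overwrite f y) y)
  simp only [hA2]
  refine (add_le_add h1 h2).trans (hfP.trans (le_of_eq ?_))
  congr 2
  field_simp
  ring

/-! ### Asymptotics -/

section Asymptotics

variable {n q : ℕ → ℕ}

/-- Here `q⁸ ≤ n^(1 - 8ε)`, and the remaining `n^(8ε)` absorbs `log⁴ n`. The exponent `1/8` marks
where the sample count overtakes the bound `exp(O(q² log n))` on the truncated likelihood ratio. -/
theorem eventually_growth (hn : Tendsto n atTop atTop) (hq : ∀ k, 2 ≤ q k)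
    {ε : ℝ} (hε : 0 < ε) (hqn : ∀ᶠ k in atTop, (q k : ℝ) ≤ (n k : ℝ) ^ ((1 : ℝ) / 8 - ε)) (C : ℝ) :
    ∀ᶠ k in atTop, C * ((q k : ℝ) ^ 2 * Real.log (n k)) ≤
      (n k : ℝ) / ((q k : ℝ) ^ 6 * Real.log (n k) ^ 3) := by
  have hnR : Tendsto (fun k => (n k : ℝ)) atTop atTop := tendsto_natCast_atTop_atTop.comp hn
  have hlog : Tendsto (fun k => Real.log (n k)) atTop atTop := Real.tendsto_log_atTop.comp hnR
  have ho := (isLittleO_log_rpow_rpow_atTop (4 : ℝ) (by positivity : 0 < 8 * ε)).bound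
    (by positivity : (0 : ℝ) < 1 / (|C| + 1))
  filter_upwards [hnR.eventually ho, hqn, hnR.eventually_ge_atTop 1,
    hlog.eventually_ge_atTop 1] with k h1 h2 h3 h4
  have hq0 : (0 : ℝ) < q k := by exact_mod_cast (by have := hq k; omega : 0 < q k)
  have hn0 : (0 : ℝ) < n k := by linarith
  have hl0 : 0 < Real.log (n k) := by linarith
  rw [Real.norm_of_nonneg (by positivity), Real.norm_of_nonneg (by positivity),
    one_div_mul_eq_div, le_div_iff₀ (by positivity)] at h1
  have h5 : (q k : ℝ) ^ 8 ≤ (n k : ℝ) ^ (1 - 8 * ε) := by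
    have := pow_le_pow_left₀ hq0.le h2 8
    rw [← Real.rpow_mul_natCast hn0.le] at this
    refine this.trans (le_of_eq ?_)
    congr 1
    push_cast
    ring
  have h6 : (n k : ℝ) ^ (1 - 8 * ε) * (n k : ℝ) ^ (8 * ε) = n k := by
    rw [← Real.rpow_add hn0]
    simp
  have h7 : Real.log (n k) ^ (4 : ℝ) = Real.log (n k) ^ 4 := by
    rw [← Real.rpow_natCast]; norm_num
  rw [h7] at h1
  rw [le_div_iff₀ (by positivity)]
  have h8 : C * Real.log (n k) ^ 4 ≤ (n k : ℝ) ^ (8 * ε) := by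
    refine le_trans ?_ h1
    rw [mul_comm]
    gcongr
    linarith [le_abs_self C]
  calc C * ((q k : ℝ) ^ 2 * Real.log (n k)) * ((q k : ℝ) ^ 6 * Real.log (n k) ^ 3)
      = (q k : ℝ) ^ 8 * (C * Real.log (n k) ^ 4) := by ring
    _ ≤ (q k : ℝ) ^ 8 * (n k : ℝ) ^ (8 * ε) := by gcongr
    _ ≤ (n k : ℝ) ^ (1 - 8 * ε) * (n k : ℝ) ^ (8 * ε) := by gcongr
    _ = n k := h6

end Asymptotics

/-- Parameters with a larger signal that can be degraded to the given ones. -/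
theorem exists_stronger_parameters {n : ℕ → ℕ} {d lam : ℕ → ℝ} (hn : Tendsto n atTop atTop)
    (hKS : BelowKestenStigum n d lam) :
    ∃ (δ : ℝ) (d' lam' : ℕ → ℝ), 0 < δ ∧ δ < 1 ∧ BelowKestenStigum n d' lam' ∧
      (∀ k, lam k ≤ lam' k) ∧ (∀ k, d' k * lam' k ^ 2 = 1 - δ / 2) ∧
      ∀ᶠ k in atTop, d k ≤ d' k ∧ lam k * d k ≤ (1 - δ / 2) * (lam' k * d' k) := by
  obtain ⟨δ, hδ, hbelow⟩ := hKS.below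
  have hδ1 : δ < 1 := by
    obtain ⟨k, hk⟩ := hbelow.exists
    have := mul_pos (hKS.d_pos k) (pow_pos (hKS.lam_pos k) 2)
    linarith
  set s := 1 - δ / 2 with hs
  have hs0 : 0 < s := by linarith
  set A := s / (1 - δ) with hA
  have hA0 : 0 < A := div_pos hs0 (by linarith)
  -- Then `d' = s / λ'²`. The second entry of the maximum keeps `d' ≤ A d + 1`, hence sparse, even
  -- if `λ` is tiny. The constant `A` is chosen so that `A d ≤ d'`, and `s A ≥ 1` because `(1 -
  -- δ/2)² ≥ 1 - δ`; together they give `d ≤ s d'`.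
  set lam' : ℕ → ℝ := fun k => max (lam k) (√(s / (A * d k + 1))) with hlam'
  have hd0 := hKS.d_pos
  have hfrac : ∀ k, 0 < s / (A * d k + 1) := fun k => by
    have := hd0 k
    positivity
  have hl0 : ∀ k, 0 < lam' k := fun k => (hKS.lam_pos k).trans_le (le_max_left _ _)
  have hl1 : ∀ k, lam' k < 1 := fun k => by
    refine max_lt (hKS.lam_lt_one k) ?_
    rw [Real.sqrt_lt' one_pos, one_pow, div_lt_one (by have := hd0 k; positivity)]
    have := mul_pos hA0 (hd0 k)
    linarith
  have hprod : ∀ k, s / lam' k ^ 2 * lam' k ^ 2 = s := fun k =>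
    div_mul_cancel₀ _ (pow_pos (hl0 k) 2).ne'
  have hup : ∀ k, s / lam' k ^ 2 ≤ A * d k + 1 := fun k => by
    have h1 : s / (A * d k + 1) ≤ lam' k ^ 2 := by
      rw [← Real.sq_sqrt (hfrac k).le]
      exact pow_le_pow_left₀ (Real.sqrt_nonneg _) (le_max_right _ _) 2
    rw [div_le_iff₀ (pow_pos (hl0 k) 2)]
    have h2 : 0 < A * d k + 1 := by have := hd0 k; positivity
    rw [div_le_iff₀ h2] at h1
    linarith
  have hnR : Tendsto (fun k => (n k : ℝ)) atTop atTop := tendsto_natCast_atTop_atTop.comp hn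
  have hlow : ∀ᶠ k in atTop, A * d k ≤ s / lam' k ^ 2 := by
    filter_upwards [hbelow] with k hk
    rw [le_div_iff₀ (pow_pos (hl0 k) 2)]
    rcases max_choice (lam k) (√(s / (A * d k + 1))) with h | h
    · have : lam' k = lam k := h
      rw [this, hA, div_mul_eq_mul_div, div_mul_eq_mul_div, div_le_iff₀ (by linarith)]
      have h1 := mul_le_mul_of_nonneg_left hk.le hs0.le
      linarith
    · have : lam' k = √(s / (A * d k + 1)) := h
      have h2 : 0 < A * d k + 1 := by have := hd0 k; positivity
      rw [this, Real.sq_sqrt (hfrac k).le, mul_div_assoc', div_le_iff₀ h2]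
      nlinarith
  refine ⟨δ, fun k => s / lam' k ^ 2, lam', hδ, hδ1, ⟨fun k => div_pos hs0 (pow_pos (hl0 k) 2),
    hl0, hl1, ?_, δ / 4, by positivity, ?_⟩, fun k => le_max_left _ _, hprod, ?_⟩
  · have h1 : Tendsto (fun k => A * (d k / n k) + (n k : ℝ)⁻¹) atTop (𝓝 0) := by
      have := (hKS.sparse.const_mul A).add (tendsto_inv_atTop_zero.comp hnR)
      simpa using this
    refine squeeze_zero (fun k => ?_) (fun k => ?_) h1
    · have := hl0 k
      positivity
    · refine (div_le_div_of_nonneg_right (hup k) (Nat.cast_nonneg _)).trans (le_of_eq ?_)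
      ring
  · refine Eventually.of_forall fun k => ?_
    rw [hprod, hs]
    linarith
  · filter_upwards [hlow] with k hk
    have hA1 : 1 ≤ A := by
      rw [hA, one_le_div (by linarith)]
      linarith
    have hdd : d k ≤ s / lam' k ^ 2 := le_trans (le_mul_of_one_le_left (hd0 k).le hA1) hk
    refine ⟨hdd, ?_⟩
    have h1 : d k ≤ s * (s / lam' k ^ 2) := by
      have h2 : s * (A * d k) ≤ s * (s / lam' k ^ 2) := mul_le_mul_of_nonneg_left hk hs0.le
      have h3 : 1 ≤ s * A := by
        rw [hA, mul_div_assoc', one_le_div (by linarith), hs]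
        nlinarith
      have h4 := mul_le_mul_of_nonneg_right h3 (hd0 k).le
      linarith
    calc lam k * d k ≤ lam' k * (s * (s / lam' k ^ 2)) :=
          mul_le_mul (le_max_left _ _) h1 (hd0 k).le (hl0 k).le
      _ = _ := by ring

/-! ### Degree and number of samples, and the advantage they give. -/

noncomputable section

/-- The exponent `n / (q ^ 6 (log n) ^ 3)`. -/
def timeExponent (n q : ℕ) : ℝ := (n : ℝ) / ((q : ℝ) ^ 6 * Real.log (n : ℝ) ^ 3)

/-- The polynomial degree `n / (q ^ 6 (log n) ^ 2)`, rounded down. -/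
def testDegree (n q : ℕ) : ℕ := ⌊timeExponent n q * Real.log (n : ℝ)⌋₊

/-- The number of samples used in the hidden sample problem. -/
def sampleCount (n q : ℕ) : ℕ := ⌈Real.exp (timeExponent n q)⌉₊

end

theorem one_le_sampleCount (n q : ℕ) : 1 ≤ sampleCount n q :=
  Nat.one_le_iff_ne_zero.2 (Nat.ceil_pos.2 (Real.exp_pos _)).ne'

theorem timeExponent_nonneg (n q : ℕ) : 0 ≤ timeExponent n q := by
  have : 0 ≤ Real.log (n : ℝ) := Real.log_natCast_nonneg n
  unfold timeExponent
  positivity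

theorem timeExponent_mul_le {n q : ℕ} (hq : 1 ≤ q) (hl : 1 ≤ Real.log (n : ℝ)) :
    timeExponent n q * ((q : ℝ) ^ 2 * Real.log (n : ℝ) ^ 3) ≤ n := by
  have hq' : (1 : ℝ) ≤ q := by exact_mod_cast hq
  rw [timeExponent, div_mul_eq_mul_div, div_le_iff₀ (by positivity)]
  have : (q : ℝ) ^ 2 ≤ (q : ℝ) ^ 6 := pow_le_pow_right₀ hq' (by norm_num)
  gcongr

/-- Numerical bound for the truncated likelihood ratio divided by the number of samples. -/
theorem hidden_advantage_bound {n q R : ℕ} {η : ℝ} (hq : 2 ≤ q) (hη : 0 < η)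
    (hR : R = ⌈(q : ℝ) / η⌉₊) (hl : 1 ≤ Real.log (n : ℝ))
    (hE : (8 + 2 / η) * ((q : ℝ) ^ 2 * Real.log (n : ℝ)) ≤ timeExponent n q) :
    ((sampleCount n q : ℕ) : ℝ)⁻¹ * (((2 * ((R : ℝ) + 1)) ^ (q ^ 2) : ℝ) *
      (2 * Real.exp 1 * (testDegree n q : ℝ) ^ 2)) ≤ Real.exp (-(timeExponent n q / 2)) := by
  have hq' : (2 : ℝ) ≤ q := by exact_mod_cast hq
  set E := timeExponent n q with hEdef
  set L := Real.log (n : ℝ) with hL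
  have hn1 : (1 : ℝ) < n := by
    by_contra h
    have := Real.log_nonpos (Nat.cast_nonneg n) (not_lt.1 h)
    linarith
  have hn0 : (0 : ℝ) < n := by linarith
  have hEL : E * ((q : ℝ) ^ 2 * L ^ 3) ≤ n := timeExponent_mul_le (by omega) hl
  have hE0 : 0 ≤ E := timeExponent_nonneg n q
  have hηi : 0 < 2 / η := by positivity
  have hq2 : 2 * (q : ℝ) ≤ (q : ℝ) ^ 2 := by nlinarith
  have hL2 : 1 ≤ L ^ 2 := one_le_pow₀ hl
  have hL3 : L ≤ L ^ 3 := le_self_pow₀ hl (by norm_num)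
  have hELn : E * L ≤ n := by
    refine le_trans ?_ hEL
    refine mul_le_mul_of_nonneg_left ?_ hE0
    nlinarith
  have hEn : E ≤ n := le_trans (le_mul_of_one_le_right hE0 hl) hELn
  have hqL : (q : ℝ) ^ 2 ≤ (q : ℝ) ^ 2 * L := le_mul_of_one_le_right (by positivity) hl
  have hRn : 2 * ((R : ℝ) + 1) ≤ n := by
    have h1 : (R : ℝ) ≤ q / η + 1 := by
      rw [hR]
      exact (Nat.ceil_lt_add_one (by positivity)).le
    have h2 : (8 + 2 / η) * q ≤ (8 + 2 / η) * ((q : ℝ) ^ 2 * L) := by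
      refine mul_le_mul_of_nonneg_left ?_ (by positivity)
      linarith
    have h3 : (8 + 2 / η) * q = 8 * q + 2 * (q / η) := by ring
    linarith
  have hD : (testDegree n q : ℝ) ≤ n := (Nat.floor_le (by positivity)).trans hELn
  have he : 2 * Real.exp 1 ≤ n := by
    have := Real.exp_one_lt_d9
    have h2 : 8 * ((q : ℝ) ^ 2 * L) ≤ (8 + 2 / η) * ((q : ℝ) ^ 2 * L) := by
      gcongr
      linarith
    nlinarith
  -- Every factor is a power of a quantity at most `n`, and `8 q² log n ≤ E` absorbs the total
  -- exponent `q² + 3`.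
  have hnum : ((2 * ((R : ℝ) + 1)) ^ (q ^ 2) : ℝ) *
      (2 * Real.exp 1 * (testDegree n q : ℝ) ^ 2) ≤ Real.exp (E / 2) := by
    calc _ ≤ (n : ℝ) ^ (q ^ 2) * ((n : ℝ) * (n : ℝ) ^ 2) := by gcongr
      _ = (n : ℝ) ^ (q ^ 2 + 3) := by ring
      _ = Real.exp (((q ^ 2 + 3 : ℕ) : ℝ) * L) := by
          rw [Real.exp_nat_mul, hL, Real.exp_log hn0]
      _ ≤ Real.exp (E / 2) := by
          refine Real.exp_le_exp.2 ?_
          push_cast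
          have h2 : 8 * ((q : ℝ) ^ 2 * L) ≤ (8 + 2 / η) * ((q : ℝ) ^ 2 * L) := by
            gcongr
            linarith
          nlinarith
  have hM : Real.exp E ≤ (sampleCount n q : ℝ) := Nat.le_ceil _
  calc _ ≤ (Real.exp E)⁻¹ * Real.exp (E / 2) := by
        gcongr
    _ = _ := by
        rw [← Real.exp_neg, ← Real.exp_add]
        congr 1
        ring

/-- The constant polynomial gives the lower bound one. For the upper bound, the squared advantage
exceeds one by at most `exp(-E / 2)`. -/
theorem tendsto_lowDegAdv_hidden {n q : ℕ → ℕ} {d lam : ℕ → ℝ} {δ : ℝ}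
    (hn : Tendsto n atTop atTop) (hq : ∀ k, 2 ≤ q k) (hδ : 0 < δ) (hδ1 : δ < 1)
    (hKS : BelowKestenStigum n d lam) (hs : ∀ k, d k * lam k ^ 2 = 1 - δ / 2)
    (hgrowth : ∀ C : ℝ, ∀ᶠ k in atTop,
      C * ((q k : ℝ) ^ 2 * Real.log (n k)) ≤ timeExponent (n k) (q k))
    (hprob : ∀ᶠ k in atTop, (1 + q k * lam k) * d k / n k ≤ 1) :
    Tendsto (fun k => lowDegAdv (testDegree (n k) (q k))
      (hiddenPlanted (sampleCount (n k) (q k)) (sbmLaw (n k) (q k) (d k) (lam k))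
        (erdosRenyiLaw (n k) (d k)))
      (hiddenNull (sampleCount (n k) (q k)) (erdosRenyiLaw (n k) (d k)))) atTop (𝓝 1) := by
  have hnR : Tendsto (fun k => (n k : ℝ)) atTop atTop := tendsto_natCast_atTop_atTop.comp hn
  have hlog : Tendsto (fun k => Real.log (n k)) atTop atTop := Real.tendsto_log_atTop.comp hnR
  have hEtop : Tendsto (fun k => timeExponent (n k) (q k)) atTop atTop := by
    refine tendsto_atTop_mono' _ ?_ hlog
    filter_upwards [hgrowth 1, hlog.eventually_ge_atTop 1] with k h1 h2
    have hq' : (2 : ℝ) ≤ q k := by exact_mod_cast hq k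
    have h3 : (1 : ℝ) ≤ (q k : ℝ) ^ 2 := by nlinarith
    nlinarith
  have hupper : Tendsto (fun k => ENNReal.ofReal
      (√(1 + Real.exp (-(timeExponent (n k) (q k) / 2))))) atTop (𝓝 1) := by
    have h1 : Tendsto (fun k => 1 + Real.exp (-(timeExponent (n k) (q k) / 2))) atTop
        (𝓝 (1 + 0)) := by
      refine tendsto_const_nhds.add (Real.tendsto_exp_neg_atTop_nhds_zero.comp ?_)
      exact hEtop.atTop_div_const (by norm_num)
    have h2 := ENNReal.tendsto_ofReal h1.sqrt
    simpa using h2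
  -- Chosen so that `(1 - η)³ ≥ 1 - 3 η = 1 - δ / 4`; this gap accommodates both `e^η ≤ 1 / (1 - η)`
  -- and the factor `1 / (1 - d / n)`.
  set η := δ / 12 with hη
  have hη0 : 0 < η := by positivity
  refine tendsto_of_tendsto_of_tendsto_of_le_of_le' tendsto_const_nhds hupper
    (Eventually.of_forall fun k => ?_) ?_
  · have hq0 : q k ≠ 0 := by have := hq k; omega
    refine one_le_lowDegAdv ?_ ?_ _
    · exact expect_hiddenPlanted_one (one_le_sampleCount _ _) (expect_sbmLaw_one hq0 _ _)
        (expect_productBernoulli_one _)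
    · rw [erdosRenyiLaw_eq, hiddenNull_productBernoulli]
      exact expect_productBernoulli_one _
  · filter_upwards [hgrowth (8 + 2 / η), hprob, hlog.eventually_ge_atTop (1 + 2 / η ^ 2),
      hKS.sparse.eventually_le_const (by positivity : (0 : ℝ) < δ / 4),
      hnR.eventually_ge_atTop 1] with k h1 h2 h3 h4 h5
    have hq0 : q k ≠ 0 := by have := hq k; omega
    have hq' : (2 : ℝ) ≤ q k := by exact_mod_cast hq k
    have hn0 : (0 : ℝ) < n k := by linarith
    have hnk : n k ≠ 0 := by rintro h; rw [h] at hn0; simp at hn0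
    have hd0 : 0 < d k / n k := div_pos (hKS.d_pos k) hn0
    have hd1 : d k / n k < 1 := by linarith
    have hl1 : 1 ≤ Real.log (n k) := by
      have : 0 < 2 / η ^ 2 := by positivity
      linarith
    have hr1 : ∀ σ e, sbmEdgeProb (n k) (q k) (d k) (lam k) σ e ≤ 1 := fun σ e =>
      (sbmEdgeProb_le (Nat.one_le_iff_ne_zero.2 hq0) (hKS.d_pos k).le (hKS.lam_pos k).le σ e).trans
        h2
    set E := timeExponent (n k) (q k) with hE
    set L := Real.log (n k) with hL
    have hE0 : 0 ≤ E := timeExponent_nonneg _ _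
    have hD : 2 * (testDegree (n k) (q k) : ℝ) * (q k : ℝ) ^ 2 ≤ η ^ 2 * n k := by
      have e1 : (testDegree (n k) (q k) : ℝ) ≤ E * L := Nat.floor_le (by positivity)
      have e2 : E * ((q k : ℝ) ^ 2 * L ^ 3) ≤ n k :=
        timeExponent_mul_le (Nat.one_le_iff_ne_zero.2 hq0) hl1
      have e3 : 2 ≤ η ^ 2 * L ^ 2 := by
        have e4 : 2 / η ^ 2 ≤ L := by linarith
        rw [div_le_iff₀ (by positivity)] at e4
        nlinarith [sq_nonneg η]
      calc 2 * (testDegree (n k) (q k) : ℝ) * (q k : ℝ) ^ 2 ≤ 2 * (E * L) * (q k : ℝ) ^ 2 := by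
            gcongr
        _ ≤ (η ^ 2 * L ^ 2) * (E * L) * (q k : ℝ) ^ 2 := by gcongr
        _ = η ^ 2 * (E * ((q k : ℝ) ^ 2 * L ^ 3)) := by ring
        _ ≤ η ^ 2 * n k := by gcongr
    have hKSs : d k * lam k ^ 2 / (1 - d k / n k) * Real.exp η ≤ (1 - η) ^ 2 := by
      have f1 : (1 - δ / 2) / (1 - d k / n k) ≤ 1 - δ / 4 := by
        rw [div_le_iff₀ (by linarith)]
        nlinarith [sq_nonneg δ]
      have f2 : Real.exp η ≤ 1 / (1 - η) := by
        rw [le_div_iff₀ (by linarith)]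
        have g1 := Real.add_one_le_exp (-η)
        have g2 : Real.exp η * Real.exp (-η) = 1 := by rw [← Real.exp_add]; simp
        nlinarith [Real.exp_pos η]
      have f3 : 1 - δ / 4 ≤ (1 - η) ^ 3 := by
        have : δ = 12 * η := by rw [hη]; ring
        rw [this]
        nlinarith [sq_nonneg η, mul_nonneg (sq_nonneg η) (by linarith : (0 : ℝ) ≤ 3 - η)]
      rw [hs]
      calc (1 - δ / 2) / (1 - d k / n k) * Real.exp η ≤ (1 - η) ^ 3 * (1 / (1 - η)) := by
            refine mul_le_mul (f1.trans f3) f2 (Real.exp_pos _).le (pow_nonneg (by linarith) 3)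
        _ = (1 - η) ^ 2 := by
            have : (1 - η) ≠ 0 := by linarith
            field_simp
    have hR0 : 0 < ⌈(q k : ℝ) / η⌉₊ := Nat.ceil_pos.2 (by positivity)
    have hqR : (q k : ℝ) ≤ η * (⌈(q k : ℝ) / η⌉₊ : ℝ) := by
      have := Nat.le_ceil ((q k : ℝ) / η)
      rw [div_le_iff₀ hη0] at this
      linarith
    have hsum := sum_sq_sbm_le hnk hq0 hR0 hd0 hd1
      (sbmEdgeProb_nonneg (Nat.one_le_iff_ne_zero.2 hq0) (hKS.d_pos k).le (hKS.lam_pos k).le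
        (hKS.lam_lt_one k).le) hr1 hη0.le (by linarith) hqR hD hKSs
    refine (lowDegAdv_hidden_le (one_le_sampleCount _ _) hd0 hd1 (expect_sbmLaw_one hq0 _ _)
      _).trans (ENNReal.ofReal_le_ofReal (Real.sqrt_le_sqrt (add_le_add le_rfl ?_)))
    refine le_trans (mul_le_mul_of_nonneg_left hsum (by positivity)) ?_
    exact hidden_advantage_bound (hq k) hη0 rfl hl1 h1

noncomputable section

/-! ### Asymptotics and the main theorem -/

theorem tendsto_log_natCast {n : ℕ → ℕ} (hn : Tendsto n atTop atTop) :
    Tendsto (fun k => Real.log (n k : ℝ)) atTop atTop :=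
  Real.tendsto_log_atTop.comp (tendsto_natCast_atTop_atTop.comp hn)

/-- The time exponent tends to infinity as soon as it dominates `q² log n`. -/
theorem tendsto_timeExponent {n q : ℕ → ℕ} (hn : Tendsto n atTop atTop) (hq : ∀ k, 2 ≤ q k)
    (hgrowth : ∀ C : ℝ, ∀ᶠ k in atTop,
      C * ((q k : ℝ) ^ 2 * Real.log (n k)) ≤ timeExponent (n k) (q k)) :
    Tendsto (fun k => timeExponent (n k) (q k)) atTop atTop := by
  refine tendsto_atTop_mono' atTop ?_ (tendsto_log_natCast hn)
  filter_upwards [hgrowth 1, (tendsto_log_natCast hn).eventually_ge_atTop 0] with k h hL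
  have hq2 : (2 : ℝ) ≤ q k := by exact_mod_cast hq k
  nlinarith [mul_nonneg hL (show (0 : ℝ) ≤ (q k : ℝ) ^ 2 - 1 by nlinarith)]

/-- The largest edge probability tends to zero below the Kesten–Stigum threshold. -/
theorem tendsto_max_edgeProb {n q : ℕ → ℕ} {d lam : ℕ → ℝ} (hn : Tendsto n atTop atTop)
    (hq : ∀ k, 2 ≤ q k) (hKS : BelowKestenStigum n d lam)
    (hgrowth : ∀ C : ℝ, ∀ᶠ k in atTop,
      C * ((q k : ℝ) ^ 2 * Real.log (n k)) ≤ timeExponent (n k) (q k)) :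
    Tendsto (fun k => (1 + q k * lam k) * d k / n k) atTop (𝓝 0) := by
  obtain ⟨δ, hδ, hbelow⟩ := hKS.below
  have hlim : Tendsto (fun k => d k / (n k : ℝ) + √(d k / (n k : ℝ))) atTop (𝓝 0) := by
    simpa using hKS.sparse.add (Real.continuous_sqrt.tendsto' 0 0 (by simp) |>.comp hKS.sparse)
  refine squeeze_zero' ?_ ?_ hlim
  · refine Eventually.of_forall fun k => ?_
    have := hKS.d_pos k
    have := hKS.lam_pos k
    positivity
  · filter_upwards [hbelow, hgrowth 1, (tendsto_log_natCast hn).eventually_ge_atTop 1,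
      hn.eventually_ge_atTop 1] with k hb hg hL hn1
    have hd := hKS.d_pos k
    have hl := hKS.lam_pos k
    have hq2 : (2 : ℝ) ≤ q k := by exact_mod_cast hq k
    have hnpos : (0 : ℝ) < n k := by exact_mod_cast hn1
    have hE := timeExponent_mul_le (n := n k) (q := q k) (by linarith [hq k]) hL
    have hE0 := timeExponent_nonneg (n k) (q k)
    have hL3 : 1 ≤ Real.log (n k) ^ 3 := one_le_pow₀ hL
    have hqn : (q k : ℝ) ^ 2 ≤ n k := by
      have h1 : (q k : ℝ) ^ 2 ≤ timeExponent (n k) (q k) := by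
        nlinarith [mul_nonneg (sq_nonneg (q k : ℝ)) (sub_nonneg.2 hL)]
      have h2 : 1 ≤ (q k : ℝ) ^ 2 * Real.log (n k) ^ 3 := by nlinarith
      nlinarith [mul_nonneg hE0 (sub_nonneg.2 h2)]
    -- The square of the left side is `(q² / n) (d λ²) (d / n)`, whose first two factors are at most
    -- one.
    have hmain : q k * lam k * d k / n k ≤ √(d k / n k) := by
      apply Real.le_sqrt_of_sq_le
      rw [div_pow, div_le_div_iff₀ (by positivity) hnpos]
      have h3 : (q k * lam k * d k) ^ 2 ≤ n k * d k := by
        calc (q k * lam k * d k) ^ 2 = (q k : ℝ) ^ 2 * (d k * lam k ^ 2) * d k := by ring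
          _ ≤ n k * 1 * d k := by
            gcongr
            linarith
          _ = _ := by ring
      nlinarith
    calc (1 + q k * lam k) * d k / n k = d k / n k + q k * lam k * d k / n k := by ring
      _ ≤ _ := by linarith

/-- The number of hidden samples is at most twice the exponential of the time exponent. -/
theorem sampleCount_le (n q : ℕ) :
    (sampleCount n q : ℝ) ≤ 2 * Real.exp (timeExponent n q) := by
  have h1 := (Nat.ceil_lt_add_one (Real.exp_pos (timeExponent n q)).le).le
  have h2 := Real.one_le_exp (timeExponent_nonneg n q)
  unfold sampleCount
  linarith

/-- The running time of the hidden sample detector built from an estimator of running time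
`exp E` is at most `exp (4 * E)`. -/
theorem detector_time_le {n q T : ℕ} (hL : 1 ≤ Real.log n)
    (hE : 6 * Real.log n ≤ timeExponent n q) (hT : (T : ℝ) ≤ Real.exp (timeExponent n q)) :
    (sampleCount n q : ℝ) * (T * (200 * ((Fintype.card (Pair n) : ℝ) + 1) ^ 2 + 8) + 4) + 2 ≤
      Real.exp (4 * timeExponent n q) := by
  have hn0 : (0 : ℝ) < n := by
    rcases Nat.eq_zero_or_pos n with h | h
    · subst h
      norm_num at hL
    · exact_mod_cast h
  have hn1 : (1 : ℝ) ≤ n := by exact_mod_cast Nat.pos_of_ne_zero (by rintro rfl; simp at hn0)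
  set x := Real.exp (timeExponent n q) with hx
  have hx1 : 1 ≤ x := Real.one_le_exp (timeExponent_nonneg n q)
  have hM : (sampleCount n q : ℝ) ≤ 2 * x := sampleCount_le n q
  have hcard := card_pair_le n
  have hn2 : (1 : ℝ) ≤ (n : ℝ) ^ 2 := one_le_pow₀ hn1
  have hn4 : (1 : ℝ) ≤ (n : ℝ) ^ 4 := one_le_pow₀ hn1
  have hfac : 200 * ((Fintype.card (Pair n) : ℝ) + 1) ^ 2 + 8 ≤ 808 * (n : ℝ) ^ 4 := by
    have h : ((Fintype.card (Pair n) : ℝ) + 1) ^ 2 ≤ (2 * (n : ℝ) ^ 2) ^ 2 := by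
      gcongr
      linarith
    nlinarith
  calc (sampleCount n q : ℝ) * (T * (200 * ((Fintype.card (Pair n) : ℝ) + 1) ^ 2 + 8) + 4) + 2
      ≤ 2 * x * (x * (808 * (n : ℝ) ^ 4) + 4) + 2 := by gcongr
    _ ≤ 1626 * (n : ℝ) ^ 4 * x ^ 2 := by
      have h1 : x ≤ x ^ 2 := by nlinarith
      have h2 : x ^ 2 ≤ (n : ℝ) ^ 4 * x ^ 2 := le_mul_of_one_le_left (by positivity) hn4
      nlinarith
    -- The constant and `n⁴` cost `8 + 4 log n` in the exponent, which is at most `2 E` by `hE` and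
    -- `hL`.
    _ ≤ Real.exp 8 * Real.exp (4 * Real.log n) * x ^ 2 := by
      have h8 : (1626 : ℝ) ≤ Real.exp 8 := by
        have h := Real.exp_one_gt_d9
        calc (1626 : ℝ) ≤ 2.7 ^ 8 := by norm_num
          _ ≤ Real.exp 1 ^ 8 := by gcongr; linarith
          _ = Real.exp 8 := by rw [← Real.exp_nat_mul]; norm_num
      have h4 : (n : ℝ) ^ 4 = Real.exp (4 * Real.log n) := by
        rw [show (4 : ℝ) * Real.log n = ((4 : ℕ) : ℝ) * Real.log n by norm_num,
          Real.exp_nat_mul, Real.exp_log hn0]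
      rw [← h4]
      gcongr
    _ = Real.exp (8 + 4 * Real.log n + 2 * timeExponent n q) := by
      rw [Real.exp_add, Real.exp_add, hx, ← Real.exp_nat_mul]
      norm_num
    _ ≤ _ := Real.exp_le_exp.2 (by linarith)

/-- The time budget granted by the low-degree heuristic at degree `testDegree` exceeds
`exp (4 * E)`. -/
theorem exp_le_heuristic_budget {n q : ℕ} {C : ℝ} (hC : 0 < C) (hn : 3 ≤ n)
    (hL : 4 * C + 1 ≤ Real.log n) (hE : 1 ≤ timeExponent n q) :
    Real.exp (4 * timeExponent n q) ≤
      (Fintype.card (Fin (sampleCount n q) × Pair n) : ℝ) ^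
        ((testDegree n q : ℝ) /
          (C * Real.log (Fintype.card (Fin (sampleCount n q) × Pair n) : ℝ))) := by
  have hcard : 2 ≤ Fintype.card (Pair n) := by
    have h := two_mul_card_pair n
    have hn' : (3 : ℝ) ≤ n := by exact_mod_cast hn
    have : (2 : ℝ) ≤ Fintype.card (Pair n) := by nlinarith
    exact_mod_cast this
  have hN : 2 ≤ Fintype.card (Fin (sampleCount n q) × Pair n) := by
    rw [Fintype.card_prod, Fintype.card_fin]
    nlinarith [one_le_sampleCount n q]
  set N : ℝ := (Fintype.card (Fin (sampleCount n q) × Pair n) : ℝ) with hNdef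
  have hN2 : (2 : ℝ) ≤ N := by
    rw [hNdef]
    exact_mod_cast hN
  have hlog : 0 < Real.log N := Real.log_pos (by linarith)
  rw [Real.rpow_def_of_pos (by linarith)]
  apply Real.exp_le_exp.2
  have hD : timeExponent n q * Real.log n - 1 ≤ testDegree n q :=
    (Nat.sub_one_lt_floor _).le
  -- The logarithm of `N` cancels, so the budget is `exp(D / C)` whatever the number of samples.
  have : Real.log N * ((testDegree n q : ℝ) / (C * Real.log N)) = testDegree n q / C := by
    field_simp
  rw [this, le_div_iff₀ hC]
  nlinarith [mul_le_mul_of_nonneg_left hL (by linarith : 0 ≤ timeExponent n q)]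

/-- The exponential error terms of the hidden sample detector are dominated by
`9 exp (-K E / 2)`. -/
theorem detector_error_le {n q T : ℕ} {K : ℝ} (hq : 2 ≤ q) (hK : 0 < K)
    (hL : 1 ≤ Real.log n) (hLK : 4 / K ≤ Real.log n)
    (hT : (T : ℝ) ≤ Real.exp (timeExponent n q)) :
    (sampleCount n q : ℝ) * (4 * T * Real.exp (-(K * n))) + Real.exp (-(K * (n / (1 + q)))) ≤
      9 * Real.exp (-(K * timeExponent n q / 2)) := by
  have hE0 := timeExponent_nonneg n q
  have hM := sampleCount_le n q
  have hq2 : (2 : ℝ) ≤ q := by exact_mod_cast hq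
  have hE := timeExponent_mul_le (n := n) (q := q) (by linarith) hL
  set E := timeExponent n q with hEdef
  have hL3 : Real.log n ≤ Real.log n ^ 3 := le_self_pow₀ hL (by norm_num)
  have hqq : 1 + (q : ℝ) ≤ (q : ℝ) ^ 2 := by nlinarith
  have hqL : 4 / K ≤ (q : ℝ) ^ 2 * Real.log n ^ 3 := by nlinarith
  have hqL' : 1 + (q : ℝ) ≤ (q : ℝ) ^ 2 * Real.log n ^ 3 := by nlinarith
  have hEn : 4 * E ≤ K * n := by
    have h : E * (4 / K) ≤ n := (mul_le_mul_of_nonneg_left hqL hE0).trans hE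
    calc 4 * E = K * (E * (4 / K)) := by field_simp
      _ ≤ K * n := by gcongr
  have hEq : E ≤ n / (1 + q) := by
    rw [le_div_iff₀ (by positivity)]
    exact (mul_le_mul_of_nonneg_left hqL' hE0).trans hE
  have hEn' : E ≤ n := by
    have h : (1 : ℝ) ≤ (q : ℝ) ^ 2 * Real.log n ^ 3 := by linarith
    nlinarith [mul_le_mul_of_nonneg_left h hE0]
  have hfirst : (sampleCount n q : ℝ) * (4 * T * Real.exp (-(K * n))) ≤
      8 * Real.exp (-(K * E / 2)) := by
    calc (sampleCount n q : ℝ) * (4 * T * Real.exp (-(K * n)))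
        ≤ 2 * Real.exp E * (4 * Real.exp E * Real.exp (-(K * n))) := by gcongr
      _ = 8 * Real.exp (E + E + -(K * n)) := by
        rw [Real.exp_add, Real.exp_add]
        ring
      -- From `4 E ≤ K n` and `E ≤ n`: `2 E - K n ≤ -K n / 2 ≤ -K E / 2`.
      _ ≤ _ := by
        gcongr
        nlinarith [mul_le_mul_of_nonneg_left hEn' hK.le]
  have hsecond : Real.exp (-(K * (n / (1 + q)))) ≤ Real.exp (-(K * E / 2)) := by
    apply Real.exp_le_exp.2
    nlinarith [mul_le_mul_of_nonneg_left hEq hK.le, mul_nonneg hK.le hE0]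
  linarith

/-- Under the low-degree heuristic, no estimator of running time `exp (n / (q⁶ log³ n))` achieves
weak recovery below the Kesten–Stigum threshold. -/
theorem not_weakRecovery_of_time_le {n q : ℕ → ℕ} {d lam : ℕ → ℝ}
    (hn : Tendsto n atTop atTop) (hq : ∀ k, 2 ≤ q k) (hKS : BelowKestenStigum n d lam)
    (heuristic : SBMLowDegreeHeuristic n q)
    (hgrowth : ∀ C : ℝ, ∀ᶠ k in atTop,
      C * ((q k : ℝ) ^ 2 * Real.log (n k)) ≤ timeExponent (n k) (q k))
    {X : ∀ k, BoolProgram (Pair (n k)) (Pair (n k))}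
    (hX : ∀ᶠ k in atTop, ((X k).time : ℝ) ≤ Real.exp (timeExponent (n k) (q k))) :
    ¬ WeakRecovery n q d lam X := by
  rintro ⟨c₀, hc₀, hrec⟩
  obtain ⟨δ, d', lam', hδ, hδ1, hKS', hlam, hs, hgap⟩ := exists_stronger_parameters hn hKS
  have hm := tendsto_max_edgeProb hn hq hKS' hgrowth
  have hm1 : ∀ᶠ k in atTop, (1 + q k * lam' k) * d' k / n k ≤ 1 :=
    hm.eventually_le_const one_pos
  -- The heuristic is invoked at the stronger parameters, where the test operates, not at those of
  -- the recovery problem.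
  obtain ⟨C, hC, hno⟩ := heuristic d' lam' (fun k => sampleCount (n k) (q k)) hKS'
    (fun k => one_le_sampleCount _ _) (fun k => testDegree (n k) (q k))
    (tendsto_lowDegAdv_hidden hn hq hδ hδ1 hKS' hs hgrowth hm1)
  refine hno ?_
  -- `exists_hidden_detector` asks for mean correlation at least `2 c` and for `c ≤ 1`.
  set c : ℝ := min c₀ 1 / 2 with hcdef
  have hc : 0 < c := by positivity
  have hc1 : c ≤ 1 := by linarith [min_le_right c₀ 1]
  have hcc : 2 * c ≤ c₀ := by linarith [min_le_left c₀ 1]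
  set K : ℝ := (δ * c ^ 2 / 2048) ^ 2 * (1 - δ / 2) / 16 with hKdef
  have hK : 0 < K := by
    have : 0 < 1 - δ / 2 := by linarith
    positivity
  have hlog := tendsto_log_natCast hn
  have hEtop := tendsto_timeExponent hn hq hgrowth
  have hdetect : ∀ᶠ k in atTop, ∃ A : BoolProgram (Fin (sampleCount (n k) (q k)) × Pair (n k)) Unit,
      (A.time : ℝ) ≤ Real.exp (4 * timeExponent (n k) (q k)) ∧
      prob (hiddenNull (sampleCount (n k) (q k)) (erdosRenyiLaw (n k) (d' k)))
          (fun y => A.accepts y) +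
        prob (hiddenPlanted (sampleCount (n k) (q k)) (sbmLaw (n k) (q k) (d' k) (lam' k))
          (erdosRenyiLaw (n k) (d' k))) (fun y => !A.accepts y) ≤
      9 * Real.exp (-(K * timeExponent (n k) (q k) / 2)) + (1 - c) +
        4096 * (1 + 8 / δ) / (δ * c ^ 2) * ((1 + q k * lam' k) * d' k / n k) := by
    filter_upwards [hX, hrec, hgap, hm1, hgrowth 6, hlog.eventually_ge_atTop 1,
      hlog.eventually_ge_atTop (4 / K),
      hKS.sparse.eventually_le_const (by positivity : 0 < δ / 4)]
      with k hT hr hg hmk hgr hL hLK hdn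
    have hq2 : (2 : ℝ) ≤ q k := by exact_mod_cast hq k
    have hL6 : 6 * Real.log (n k) ≤ timeExponent (n k) (q k) := by
      refine le_trans ?_ hgr
      gcongr
      exact le_mul_of_one_le_left (by linarith) (by nlinarith)
    have hqn : 2 * q k ≤ n k := by
      have hE := timeExponent_mul_le (n := n k) (q := q k) (by linarith [hq k]) hL
      have hL3 : 1 ≤ Real.log (n k) ^ 3 := one_le_pow₀ hL
      have hE1 : 1 ≤ timeExponent (n k) (q k) := by linarith
      have h1 : (q k : ℝ) ^ 2 ≤ (q k : ℝ) ^ 2 * Real.log (n k) ^ 3 :=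
        le_mul_of_one_le_right (by positivity) hL3
      have h2 : (2 : ℝ) * q k ≤ n k := by
        nlinarith [mul_le_mul_of_nonneg_right hE1 ((sq_nonneg (q k : ℝ)).trans h1)]
      exact_mod_cast h2
    obtain ⟨A, hA, herr⟩ := exists_hidden_detector (X k) (one_le_sampleCount (n k) (q k)) (hq k)
      hqn (hKS.d_pos k) (hKS.lam_pos k) (hlam k) (hKS'.lam_lt_one k) hδ hδ1 hg.1 hg.2 hdn hmk hc hc1
      (hcc.trans hr)
    refine ⟨A, ?_, herr.trans ?_⟩
    · refine le_trans ?_ (detector_time_le hL hL6 hT)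
      exact_mod_cast hA
    · have h := detector_error_le (hq k) hK hL hLK hT
      rw [hs k]
      linarith
  obtain ⟨k₀, hk₀⟩ := eventually_atTop.1 hdetect
  -- For the finitely many indices below `k₀` any program serves; the empty one is taken.
  have hall : ∀ k, ∃ A : BoolProgram (Fin (sampleCount (n k) (q k)) × Pair (n k)) Unit, k₀ ≤ k →
      (A.time : ℝ) ≤ Real.exp (4 * timeExponent (n k) (q k)) ∧
      prob (hiddenNull (sampleCount (n k) (q k)) (erdosRenyiLaw (n k) (d' k)))
          (fun y => A.accepts y) +
        prob (hiddenPlanted (sampleCount (n k) (q k)) (sbmLaw (n k) (q k) (d' k) (lam' k))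
          (erdosRenyiLaw (n k) (d' k))) (fun y => !A.accepts y) ≤
      9 * Real.exp (-(K * timeExponent (n k) (q k) / 2)) + (1 - c) +
        4096 * (1 + 8 / δ) / (δ * c ^ 2) * ((1 + q k * lam' k) * d' k / n k) := fun k => by
    by_cases hk : k₀ ≤ k
    · obtain ⟨A, hA⟩ := hk₀ k hk
      exact ⟨A, fun _ => hA⟩
    · exact ⟨⟨[], fun _ => []⟩, fun h => absurd h hk⟩
  choose A hA using hall
  refine ⟨A, ?_, c / 2, by positivity, ?_⟩
  · filter_upwards [eventually_ge_atTop k₀, hn.eventually_ge_atTop 3,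
      hlog.eventually_ge_atTop (4 * C + 1), hEtop.eventually_ge_atTop 1] with k hk hn3 hL hE
    exact (hA k hk).1.trans (exp_le_heuristic_budget hC hn3 hL hE)
  · have hexp : Tendsto (fun k => 9 * Real.exp (-(K * timeExponent (n k) (q k) / 2)))
        atTop (𝓝 0) := by
      have h := Real.tendsto_exp_neg_atTop_nhds_zero.comp
        ((hEtop.const_mul_atTop hK).atTop_div_const (two_pos : (0 : ℝ) < 2))
      simpa using h.const_mul 9
    have hmB := hm.const_mul (4096 * (1 + 8 / δ) / (δ * c ^ 2))
    rw [mul_zero] at hmB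
    filter_upwards [eventually_ge_atTop k₀,
      hexp.eventually_le_const (by positivity : 0 < c / 4),
      hmB.eventually_le_const (by positivity : 0 < c / 4)] with k hk h1 h2
    refine (hA k hk).2.trans ?_
    linarith

/-- The exponent defect for which `n ^ (1 - r) = n / (q⁶ log³ n)`. -/
def exponentDefect (n q : ℕ) : ℝ :=
  (6 * Real.log q + 3 * Real.log (Real.log n)) / Real.log n

theorem rpow_one_sub_exponentDefect {n q : ℕ} (hq : 1 ≤ q) (hL : 1 ≤ Real.log n) :
    (n : ℝ) ^ (1 - exponentDefect n q) = timeExponent n q := by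
  have hn0 : (0 : ℝ) < n := by
    rcases Nat.eq_zero_or_pos n with h | h
    · subst h
      norm_num at hL
    · exact_mod_cast h
  have hq0 : (0 : ℝ) < q := by exact_mod_cast hq
  have hL0 : 0 < Real.log n := by linarith
  have h : Real.log n * (1 - exponentDefect n q) =
      Real.log n - (((6 : ℕ) : ℝ) * Real.log q + ((3 : ℕ) : ℝ) * Real.log (Real.log n)) := by
    unfold exponentDefect
    push_cast
    field_simp
  rw [Real.rpow_def_of_pos hn0, h, Real.exp_sub, Real.exp_add, Real.exp_nat_mul, Real.exp_nat_mul,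
    Real.exp_log hn0, Real.exp_log hq0, Real.exp_log hL0]
  rfl

theorem tendsto_exponentDefect {n q : ℕ → ℕ} (hn : Tendsto n atTop atTop)
    (hsub : Tendsto (fun k => Real.log (q k : ℝ) / Real.log (n k : ℝ)) atTop (𝓝 0)) :
    Tendsto (fun k => exponentDefect (n k) (q k)) atTop (𝓝 0) := by
  have hloglog : Tendsto (fun k => Real.log (Real.log (n k : ℝ)) / Real.log (n k : ℝ))
      atTop (𝓝 0) :=
    (Real.isLittleO_log_id_atTop.tendsto_div_nhds_zero).comp (tendsto_log_natCast hn)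
  have h := (hsub.const_mul 6).add (hloglog.const_mul 3)
  rw [mul_zero, mul_zero, add_zero] at h
  refine h.congr fun k => ?_
  unfold exponentDefect
  ring

theorem eventually_le_rpow_of_log_ratio {n q : ℕ → ℕ} (hn : Tendsto n atTop atTop)
    (hq : ∀ k, 2 ≤ q k) {a : ℝ} (ha : 0 < a)
    (hsub : Tendsto (fun k => Real.log (q k : ℝ) / Real.log (n k : ℝ)) atTop (𝓝 0)) :
    ∀ᶠ k in atTop, (q k : ℝ) ≤ (n k : ℝ) ^ a := by
  filter_upwards [hsub.eventually_le_const ha, (tendsto_log_natCast hn).eventually_ge_atTop 1,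
    hn.eventually_ge_atTop 1] with k h hL hn1
  have hq0 : (0 : ℝ) < q k := by exact_mod_cast (by linarith [hq k] : 0 < q k)
  rw [div_le_iff₀ (by linarith)] at h
  rw [Real.rpow_def_of_pos (by exact_mod_cast hn1), ← Real.log_le_iff_le_exp hq0]
  linarith

end

theorem mainTheorem4 (n q : ℕ → ℕ) (d lam : ℕ → ℝ)
    (hn : Tendsto n atTop atTop) (hq : ∀ k, 2 ≤ q k)
    (hKS : BelowKestenStigum n d lam)
    (heuristic : SBMLowDegreeHeuristic n q) :
    ((∃ ε : ℝ, 0 < ε ∧ ∀ᶠ k in atTop, (q k : ℝ) ≤ (n k : ℝ) ^ ((1 : ℝ) / 8 - ε)) →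
      ¬ ∃ X : ∀ k, BoolProgram (Pair (n k)) (Pair (n k)),
        WeakRecovery n q d lam X ∧
        ∀ᶠ k in atTop, ((X k).time : ℝ) ≤
          Real.exp ((n k : ℝ) / ((q k : ℝ) ^ 6 * Real.log (n k : ℝ) ^ 3))) ∧
    (Tendsto (fun k => Real.log (q k : ℝ) / Real.log (n k : ℝ)) atTop (𝓝 0) →
      ∃ r : ℕ → ℝ, Tendsto r atTop (𝓝 0) ∧
        ¬ ∃ X : ∀ k, BoolProgram (Pair (n k)) (Pair (n k)),
          WeakRecovery n q d lam X ∧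
          ∀ᶠ k in atTop, ((X k).time : ℝ) ≤ Real.exp ((n k : ℝ) ^ (1 - r k))) := by
  constructor
  · rintro ⟨ε, hε, hqn⟩ ⟨X, hrec, hX⟩
    exact not_weakRecovery_of_time_le hn hq hKS heuristic (eventually_growth hn hq hε hqn) hX hrec
  · intro hsub
    refine ⟨fun k => exponentDefect (n k) (q k), tendsto_exponentDefect hn hsub, ?_⟩
    rintro ⟨X, hrec, hX⟩
    -- Any positive exponent below `1/8` would do.
    have hqn : ∀ᶠ k in atTop, (q k : ℝ) ≤ (n k : ℝ) ^ ((1 : ℝ) / 8 - 1 / 16) :=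
      eventually_le_rpow_of_log_ratio hn hq (by norm_num) hsub
    refine not_weakRecovery_of_time_le hn hq hKS heuristic
      (eventually_growth hn hq (by norm_num) hqn) ?_ hrec
    filter_upwards [hX, (tendsto_log_natCast hn).eventually_ge_atTop 1] with k hk hL
    rwa [rpow_one_sub_exponentDefect (by linarith [hq k]) hL] at hk
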